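/- **Theorem 2 (observer convergence).** Let $\varepsilon>0$, $\nu\in C^1([-1,1])$, and let $\bar\lambda$ be such that $\lambda:=\bar\lambda-\tfrac12\nu'-\tfrac{1}{4\varepsilon}\nu^2\in C^1([-1,1])$ (for $\nu=0$ this says $\lambda=\bar\lambda\in C^1([-1,1])$). Consider the reaction–advection–diffusion system $$\partial_t\bar u=\varepsilon\,\partial_y^2\bar u+\nu(y)\,\partial_y\bar u+\bar\lambda(y)\,\bar u,\quad y\in(-1,1),\qquad \bar u(-1,t)=\bar{\mathcal U}_1(t),\quad \bar u(1,t)=\bar{\mathcal U}_2(t),$$ and set $u(y,t):=\exp\big(\int_{-1}^y\frac{\nu(z)}{2\varepsilon}dz\big)\bar u(y,t)$, so that $\partial_t u=\varepsilon\,\partial_y^2u+\lambda u$, $u(-1,t)=\mathcal U_1(t):=\bar{\mathcal U}_1(t)$ and $u(1,t)=\mathcal U_2(t):=\exp\big(\int_{-1}^1\frac{\nu(z)}{2\varepsilon}dz\big)\bar{\mathcal U}_2(t)$. Let $\hat y_0\in(-1,1)$, and suppose that $u(\hat y_0,t)$ and $\partial_yu(\hat y_0,t)$ are measured. Put $s_1:=-(1+\hat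 y_0)$, $s_2:=1-\hat y_0$, and, for $i\in\{1,2\}$, $\check\varepsilon_i:=\varepsilon/s_i^2$ and $\check\lambda_i(x):=\lambda(\hat y_0+s_ix)$ for $x\in[0,1]$; let $\check c_1,\check c_2>0$. (a) For each $i$ the kernel equations $$\partial_x^2\Phi_i-\partial_y^2\Phi_i=-\frac{\check\lambda_i(x)+\check c_i}{\check\varepsilon_i}\Phi_i,\qquad \Phi_i(1,y)=0,\qquad \Phi_i(x,x)=-\int_x^1\frac{\check\lambda_i(z)+\check c_i}{2\check\varepsilon_i}\,dz$$ have a solution $\Phi_i\in C^2(\mathcal T)$ on the closed triangle $\mathcal T=\{0\le y\le x\le1\}$. (b) For any such $\Phi_1,\Phi_2$ put $\phi_i(x):=-\check\varepsilon_i\Phi_i(x,0)$. Then there are constants $\check{\bar\Pi},\check\gamma_{\min}>0$ with the following property. Let $t_0\in\mathbb R$, let $\bar u$ be a solution of the system for $t>t_0$ with some inputs $\bar{\mathcal U}_1,\bar{\mathcal U}_2$, and let $\hat u_1,\hat u_2$ be solutions for $t>t_0$ of the two decoupled estimators, $x\in(0,1)$, $$\partial_t\hat u_i=\check\varepsilon_i\,\partial_x^2\hat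 u_i+\check\lambda_i(x)\,\hat u_i+\phi_i(x)\big(s_i\,\partial_yu(\hat y_0,t)-\partial_x\hat u_i(0,t)\big),\qquad \hat u_i(0,t)=u(\hat y_0,t),\qquad \hat u_i(1,t)=\mathcal U_i(t).$$ Define $$\hat u(y,t):=\begin{cases}\hat u_1\big(\frac{\hat y_0-y}{1+\hat y_0},t\big)& y\le\hat y_0\\[2pt] \hat u_2\big(\frac{y-\hat y_0}{1-\hat y_0},t\big)& y>\hat y_0\end{cases}\qquad\text{and}\qquad \hat{\bar u}(y,t):=\exp\Big(-\int_{-1}^y\frac{\nu(z)}{2\varepsilon}dz\Big)\hat u(y,t).$$ Then for all $t\ge t_0$ $$\|\bar u(\cdot,t)-\hat{\bar u}(\cdot,t)\|_{L^2(-1,1)}\le\check{\bar\Pi}\,e^{-\check\gamma_{\min}(t-t_0)}\,\|\bar u(\cdot,t_0)-\hat{\bar u}(\cdot,t_0)\|_{L^2(-1,1)}.$$ Here solutions are classical for $t>t_0$: of class $C^{2,1}$ (in space, time) in the open space interval and continuous up to its end points, with $\partial_x\hat u_i$ continuous up to $x=0$; their initial values at $t_0$ are in $L^2$ and are attained in the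 sense of $L^2$. -/

import Mathlib

open Set MeasureTheory Filter Topology

/-! Functions of space and time are written `f y t`, space variable first. -/

/-- `∂ₓ f`. -/
noncomputable def pdX (f : ℝ → ℝ → ℝ) (x t : ℝ) : ℝ := deriv (fun z => f z t) x

/-- `∂ₓ² f`. -/
noncomputable def pdXX (f : ℝ → ℝ → ℝ) (x t : ℝ) : ℝ := deriv (fun z => pdX f z t) x

/-- `∂ₜ f`. -/
noncomputable def pdT (f : ℝ → ℝ → ℝ) (x t : ℝ) : ℝ := deriv (fun s => f x s) t

/-- `f` is of class `C^{2,1}` (twice in space, once in time) on `I × (t₀, ∞)`, for an open `I`. -/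
structure IsC21On (f : ℝ → ℝ → ℝ) (I : Set ℝ) (t₀ : ℝ) : Prop where
  diff_x : ∀ x ∈ I, ∀ t > t₀, DifferentiableAt ℝ (fun z => f z t) x
  diff_xx : ∀ x ∈ I, ∀ t > t₀, DifferentiableAt ℝ (fun z => pdX f z t) x
  diff_t : ∀ x ∈ I, ∀ t > t₀, DifferentiableAt ℝ (fun s => f x s) t
  cont_x : ContinuousOn (fun p : ℝ × ℝ => pdX f p.1 p.2) (I ×ˢ Ioi t₀)
  cont_xx : ContinuousOn (fun p : ℝ × ℝ => pdXX f p.1 p.2) (I ×ˢ Ioi t₀)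
  cont_t : ContinuousOn (fun p : ℝ × ℝ => pdT f p.1 p.2) (I ×ˢ Ioi t₀)

/-- The initial value `f(·, t₀)` is in `L²(a, b)` and is attained in `L²(a, b)`. -/
structure HasL2InitialValue (f : ℝ → ℝ → ℝ) (a b t₀ : ℝ) : Prop where
  memLp : MemLp (fun x => f x t₀) 2 (volume.restrict (Ioo a b))
  tendsto : Tendsto (fun t => eLpNorm (fun x => f x t - f x t₀) 2 (volume.restrict (Ioo a b)))
    (𝓝[>] t₀) (𝓝 0)

/-- The exponent `∫_{-1}^y ν(z) / (2ε) dz` of the transformation that removes the advection. -/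
noncomputable def gaugeExp (ε : ℝ) (ν : ℝ → ℝ) (y : ℝ) : ℝ := ∫ z in (-1 : ℝ)..y, ν z / (2 * ε)

/-- The reaction coefficient `λ = λ̄ - ν'/2 - ν²/(4ε)` left after the advection is removed. -/
noncomputable def reaction (ε : ℝ) (ν lamBar : ℝ → ℝ) (y : ℝ) : ℝ :=
  lamBar y - derivWithin ν (Icc (-1) 1) y / 2 - ν y ^ 2 / (4 * ε)

/-- `u(y,t) = exp(∫_{-1}^y ν/(2ε)) ū(y,t)`. -/
noncomputable def gauged (ε : ℝ) (ν : ℝ → ℝ) (ubar : ℝ → ℝ → ℝ) (y t : ℝ) : ℝ :=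
  Real.exp (gaugeExp ε ν y) * ubar y t

/-- `ū` is a classical solution, for times after `t₀`, of
`∂ₜ ū = ε ∂_y² ū + ν ∂_y ū + λ̄ ū` on `(-1,1)`, `ū(-1,t) = Ū₁(t)`, `ū(1,t) = Ū₂(t)`,
with an initial value in `L²(-1,1)`. -/
structure IsPlantSolution (ε : ℝ) (ν lamBar : ℝ → ℝ) (Ubar : Fin 2 → ℝ → ℝ) (t₀ : ℝ)
    (ubar : ℝ → ℝ → ℝ) : Prop where
  regular : IsC21On ubar (Ioo (-1) 1) t₀
  cont : ContinuousOn (fun p : ℝ × ℝ => ubar p.1 p.2) (Icc (-1) 1 ×ˢ Ioi t₀)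
  initial : HasL2InitialValue ubar (-1) 1 t₀
  pde : ∀ y ∈ Ioo (-1 : ℝ) 1, ∀ t > t₀,
    pdT ubar y t = ε * pdXX ubar y t + ν y * pdX ubar y t + lamBar y * ubar y t
  left : ∀ t > t₀, ubar (-1) t = Ubar 0 t
  right : ∀ t > t₀, ubar 1 t = Ubar 1 t

/-- The slopes of the two folding maps `x ↦ y₀ + slope * x` from `[0,1]` onto `[-1,y₀]`
and `[y₀,1]`. Index `0` is the left piece, index `1` the right one. -/
def foldSlope (y₀ : ℝ) (i : Fin 2) : ℝ := ![-(1 + y₀), 1 - y₀] i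

/-- Folded diffusion coefficients `ε/(1+y₀)²` and `ε/(1-y₀)²`. -/
noncomputable def foldDiff (ε y₀ : ℝ) (i : Fin 2) : ℝ := ε / foldSlope y₀ i ^ 2

/-- Folded reaction coefficients `λ(y₀ - (1+y₀)x)` and `λ(y₀ + (1-y₀)x)`. -/
def foldReaction (lam : ℝ → ℝ) (y₀ : ℝ) (i : Fin 2) (x : ℝ) : ℝ := lam (y₀ + foldSlope y₀ i * x)

/-- The triangle `0 ≤ y ≤ x ≤ 1`. -/
def triangle : Set (ℝ × ℝ) := {p | 0 ≤ p.2 ∧ p.2 ≤ p.1 ∧ p.1 ≤ 1}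

/-- `Φ` is a `C²` solution on the closed triangle of the Klein-Gordon kernel equations
`Φ_xx - Φ_yy = -((λ(x)+c)/ε) Φ`, `Φ(1,y) = 0`, `Φ(x,x) = -∫_x^1 (λ(z)+c)/(2ε) dz`. -/
structure IsObserverKernel (ε : ℝ) (lam : ℝ → ℝ) (c : ℝ) (Φ : ℝ → ℝ → ℝ) : Prop where
  regular : ContDiffOn ℝ 2 (fun p : ℝ × ℝ => Φ p.1 p.2) triangle
  pde : ∀ x y : ℝ, 0 < y → y < x → x < 1 →
    deriv (fun z => deriv (fun z' => Φ z' y) z) x - deriv (fun z => deriv (fun z' => Φ x z') z) y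
      = -((lam x + c) / ε) * Φ x y
  side : ∀ y ∈ Icc (0 : ℝ) 1, Φ 1 y = 0
  diag : ∀ x ∈ Icc (0 : ℝ) 1, Φ x x = -∫ z in x..1, (lam z + c) / (2 * ε)

/-- The output injection gain `φ(x) = -ε Φ(x,0)`. -/
def observerGain (ε : ℝ) (Φ : ℝ → ℝ → ℝ) (x : ℝ) : ℝ := -ε * Φ x 0

/-- `v` is a classical solution, for times after `t₀`, of one estimator on `[0,1]`:
`∂ₜ v = ε ∂ₓ² v + λ(x) v + φ(x) (Y₁(t) - ∂ₓ v(0,t))`, `v(0,t) = Y₀(t)`, `v(1,t) = B(t)`,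
with an initial value in `L²(0,1)`. The slope `∂ₓ v(0,t)` is one-sided, and `∂ₓ v` is continuous
up to `x = 0`. -/
structure IsEstimatorSolution (ε : ℝ) (lam φ Y₀ Y₁ B : ℝ → ℝ) (t₀ : ℝ) (v : ℝ → ℝ → ℝ) :
    Prop where
  regular : IsC21On v (Ioo 0 1) t₀
  cont : ContinuousOn (fun p : ℝ × ℝ => v p.1 p.2) (Icc 0 1 ×ˢ Ioi t₀)
  diff_zero : ∀ t > t₀, DifferentiableWithinAt ℝ (fun z => v z t) (Icc 0 1) 0
  cont_slope : ContinuousOn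
    (fun p : ℝ × ℝ => derivWithin (fun z => v z p.2) (Icc 0 1) p.1) (Ico 0 1 ×ˢ Ioi t₀)
  initial : HasL2InitialValue v 0 1 t₀
  pde : ∀ x ∈ Ioo (0 : ℝ) 1, ∀ t > t₀,
    pdT v x t = ε * pdXX v x t + lam x * v x t
      + φ x * (Y₁ t - derivWithin (fun z => v z t) (Icc 0 1) 0)
  left : ∀ t > t₀, v 0 t = Y₀ t
  right : ∀ t > t₀, v 1 t = B t

/-- The boundary inputs after the transformation: `𝒰₁ = Ū₁` and
`𝒰₂ = exp(∫_{-1}^1 ν/(2ε)) Ū₂`. -/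
noncomputable def gaugedInput (ε : ℝ) (ν : ℝ → ℝ) (Ubar : Fin 2 → ℝ → ℝ) (i : Fin 2) (t : ℝ) : ℝ :=
  Real.exp (gaugeExp ε ν (![-1, 1] i)) * Ubar i t

/-- The pair of decoupled estimators with gains from the kernels `Φ`. They see the true state only
through the measurements `u(y₀,t)` and `∂_y u(y₀,t)`, and the boundary inputs. -/
def IsObserverSolution (ε : ℝ) (ν lamBar : ℝ → ℝ) (y₀ : ℝ) (Φ : Fin 2 → ℝ → ℝ → ℝ)
    (Ubar : Fin 2 → ℝ → ℝ) (ubar : ℝ → ℝ → ℝ) (t₀ : ℝ) (uhat : Fin 2 → ℝ → ℝ → ℝ) : Prop :=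
  ∀ i : Fin 2, IsEstimatorSolution (foldDiff ε y₀ i) (foldReaction (reaction ε ν lamBar) y₀ i)
    (observerGain (foldDiff ε y₀ i) (Φ i))
    (fun t => gauged ε ν ubar y₀ t)
    (fun t => foldSlope y₀ i * pdX (gauged ε ν ubar) y₀ t)
    (gaugedInput ε ν Ubar i) t₀ (uhat i)

/-- The state estimate `û` on `[-1,1]`, reassembled from the two estimators. -/
noncomputable def unfolded (y₀ : ℝ) (uhat : Fin 2 → ℝ → ℝ → ℝ) (y t : ℝ) : ℝ :=
  if y ≤ y₀ then uhat 0 ((y₀ - y) / (1 + y₀)) t else uhat 1 ((y - y₀) / (1 - y₀)) t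

/-- The estimate `exp(-∫_{-1}^y ν/(2ε)) û(y,t)` of `ū`. -/
noncomputable def stateEstimate (ε : ℝ) (ν : ℝ → ℝ) (y₀ : ℝ) (uhat : Fin 2 → ℝ → ℝ → ℝ)
    (y t : ℝ) : ℝ :=
  Real.exp (-gaugeExp ε ν y) * unfolded y₀ uhat y t

/-! ### Functions of two real variables -/

/-! Once the advection is removed by the exponential factor and the interval is folded at the
measurement point, the estimation error splits into two uncoupled problems on `[0,1]`: `e_t = ε e_xx
+ λ e - φ(x) e_x(0,t)` with `e = 0` at both ends (`isErrorSystem_foldError`). The backstepping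
transformation `e(x) = w(x) - ∫_0^x Φ(x,y) w(y) dy` is designed so that formally `w_t = ε w_xx - c
w` with Dirichlet conditions, which decays in `L²` like `exp(-ct)`. The transformation and its
inverse are bounded in `L²`, so passing between `e` and `w` costs only a constant.

Neither smoothness of `e` up to `x = 1` nor differentiability of `w` is available, so the argument
runs by duality. For `s(x) = sin(nπx)`, the adjoint equation `s(x) = p(x) - ∫_x^1 Φ(y,x) p(y) dy`
has a solution `p`, and the kernel equations make `p` an eigenfunction: `ε p'' + λ p = -(c + ε(nπ)²)
p`, `p(1) = 0`, with the nonlocal condition `p(0) = ∫_0^1 Φ(y,0) p(y) dy`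
(`exists_adjoint_eigenfunction`). Since `φ = -ε Φ(·,0)`, this condition makes the boundary term at
`0` cancel the output injection, and `∫ e p` is exactly exponential in time
(`IsErrorSystem.integral_decay`). But `∫ e p = ∫ w s` (`exists_backstepping_transform`), so each
sine coefficient of `w` decays at least like `exp(-ct)`, and Parseval (`hasSum_sq_integral_sin`)
adds them up in `exists_integral_sq_decay`.

The kernel exists because characteristic coordinates turn its equations into a Goursat problem,
equivalent to an integral equation that is a contraction in a weighted sup norm
(`exists_observerKernel`). The decay between two times after `t₀` reaches `t₀` itself because the
initial value is attained in `L²` (`eLpNorm_decay_of_integral_sq_decay`). -/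

theorem hasFDerivAt_of_continuous_partials {f f₁ f₂ : ℝ → ℝ → ℝ}
    (h₁ : ∀ x y, HasDerivAt (fun z => f z y) (f₁ x y) x)
    (h₂ : ∀ x y, HasDerivAt (fun z => f x z) (f₂ x y) y)
    (c₁ : Continuous fun p : ℝ × ℝ => f₁ p.1 p.2) (c₂ : Continuous fun p : ℝ × ℝ => f₂ p.1 p.2)
    (p : ℝ × ℝ) :
    HasFDerivAt (fun p : ℝ × ℝ => f p.1 p.2)
      (f₁ p.1 p.2 • ContinuousLinearMap.fst ℝ ℝ ℝ + f₂ p.1 p.2 • ContinuousLinearMap.snd ℝ ℝ ℝ)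
      p := by
  have key := hasStrictFDerivAt_uncurry_coprod (𝕜 := ℝ) (u := p) (f := f)
    (f₁ := fun x y => ContinuousLinearMap.toSpanSingleton ℝ (f₁ x y))
    (f₂ := fun x y => ContinuousLinearMap.toSpanSingleton ℝ (f₂ x y))
    (Eventually.of_forall fun v => (h₁ v.1 v.2).hasFDerivAt)
    (Eventually.of_forall fun v => (h₂ v.1 v.2).hasFDerivAt)
    (((ContinuousLinearMap.toSpanSingletonCLE (𝕜 := ℝ) (E := ℝ)).continuous.comp c₁).continuousAt)
    (((ContinuousLinearMap.toSpanSingletonCLE (𝕜 := ℝ) (E := ℝ)).continuous.comp c₂).continuousAt)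
  refine key.hasFDerivAt.congr_fderiv ?_
  ext <;> simp [Function.HasUncurry.uncurry]

theorem contDiff_succ_of_partials {n : ℕ} {f f₁ f₂ : ℝ → ℝ → ℝ}
    (h₁ : ∀ x y, HasDerivAt (fun z => f z y) (f₁ x y) x)
    (h₂ : ∀ x y, HasDerivAt (fun z => f x z) (f₂ x y) y)
    (c₁ : ContDiff ℝ n fun p : ℝ × ℝ => f₁ p.1 p.2)
    (c₂ : ContDiff ℝ n fun p : ℝ × ℝ => f₂ p.1 p.2) :
    ContDiff ℝ (n + 1) (fun p : ℝ × ℝ => f p.1 p.2) := by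
  refine (contDiff_succ_iff_hasFDerivAt (n := n)).2 ⟨_, ?_,
    hasFDerivAt_of_continuous_partials h₁ h₂ c₁.continuous c₂.continuous⟩
  exact (c₁.smul contDiff_const).add (c₂.smul contDiff_const)

theorem intervalIntegral_swap_of_continuous {F : ℝ → ℝ → ℝ}
    (hF : Continuous fun p : ℝ × ℝ => F p.1 p.2) (a b c d : ℝ) :
    ∫ x in a..b, ∫ y in c..d, F x y = ∫ y in c..d, ∫ x in a..b, F x y := by
  apply intervalIntegral_intervalIntegral_swap
  have : IntegrableOn F.uncurry (uIcc a b ×ˢ uIcc c d) :=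
    ContinuousOn.integrableOn_compact (isCompact_uIcc.prod isCompact_uIcc) hF.continuousOn
  exact this.mono_set (prod_mono uIoc_subset_uIcc uIoc_subset_uIcc)

theorem continuous_primitive_of_uncurry {h : ℝ → ℝ → ℝ}
    (ch : Continuous fun p : ℝ × ℝ => h p.1 p.2) :
    Continuous fun p : ℝ × ℝ => ∫ s in (0 : ℝ)..p.2, h p.1 s := by
  refine intervalIntegral.continuous_parametric_intervalIntegral_of_continuous
    (f := fun (p : ℝ × ℝ) s => h p.1 s) ?_ continuous_snd
  exact ch.comp ((continuous_fst.comp continuous_fst).prodMk continuous_snd)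

/-- Differentiation under the integral sign, continuous integrands. -/
theorem hasDerivAt_param_integral {h h' : ℝ → ℝ → ℝ}
    (hd : ∀ x s, HasDerivAt (fun z => h z s) (h' x s) x)
    (ch : Continuous fun p : ℝ × ℝ => h p.1 p.2) (ch' : Continuous fun p : ℝ × ℝ => h' p.1 p.2)
    (a b x : ℝ) :
    HasDerivAt (fun z => ∫ s in a..b, h z s) (∫ s in a..b, h' x s) x := by
  -- By Fubini the parametric integral is a primitive of a continuous function, so the fundamental
  -- theorem of calculus replaces dominated convergence.
  have e : ∀ z, ∫ s in a..b, h z s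
      = (∫ s in a..b, h 0 s) + ∫ y in (0 : ℝ)..z, ∫ s in a..b, h' y s := by
    intro z
    have hs : ∀ u, Continuous (h u) := fun u => ch.comp (continuous_const.prodMk continuous_id)
    have hx : ∀ s, Continuous fun u => h' u s :=
      fun s => ch'.comp (continuous_id.prodMk continuous_const)
    rw [intervalIntegral_swap_of_continuous ch']
    have : ∀ s, ∫ y in (0 : ℝ)..z, h' y s = h z s - h 0 s := fun s =>
      intervalIntegral.integral_eq_sub_of_hasDerivAt (fun y _ => hd y s)
        ((hx s).intervalIntegrable _ _)
    simp_rw [this]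
    rw [intervalIntegral.integral_sub ((hs z).intervalIntegrable _ _)
      ((hs 0).intervalIntegrable _ _)]
    ring
  have c : Continuous fun y => ∫ s in a..b, h' y s :=
    intervalIntegral.continuous_parametric_intervalIntegral_of_continuous' (f := h') ch' a b
  have := (intervalIntegral.integral_hasDerivAt_right (c.intervalIntegrable 0 x)
    (c.stronglyMeasurableAtFilter _ _) c.continuousAt).const_add (∫ s in a..b, h 0 s)
  exact this.congr_of_eventuallyEq (Eventually.of_forall e)

/-- Leibniz rule with a moving upper end. -/
theorem hasDerivAt_diag_integral {h h' : ℝ → ℝ → ℝ}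
    (hd : ∀ x s, HasDerivAt (fun z => h z s) (h' x s) x)
    (ch : Continuous fun p : ℝ × ℝ => h p.1 p.2) (ch' : Continuous fun p : ℝ × ℝ => h' p.1 p.2)
    (x : ℝ) :
    HasDerivAt (fun z => ∫ s in (0 : ℝ)..z, h z s) (h x x + ∫ s in (0 : ℝ)..x, h' x s) x := by
  have hs : ∀ u, Continuous (h u) := fun u => ch.comp (continuous_const.prodMk continuous_id)
  -- The parameter and the upper end are made independent variables; the rule is then the chain rule
  -- along the diagonal.
  have key := hasFDerivAt_of_continuous_partials (f := fun u v => ∫ s in (0 : ℝ)..v, h u s)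
    (f₁ := fun u v => ∫ s in (0 : ℝ)..v, h' u s) (f₂ := h)
    (fun u v => hasDerivAt_param_integral hd ch ch' 0 v u)
    (fun u v => intervalIntegral.integral_hasDerivAt_right ((hs u).intervalIntegrable 0 v)
      ((hs u).stronglyMeasurableAtFilter _ _) (hs u).continuousAt)
    (continuous_primitive_of_uncurry ch') ch (x, x)
  have h2 := HasFDerivAt.comp_hasDerivAt (f := fun z : ℝ => (z, z)) x key
    ((hasDerivAt_id' x).prodMk (hasDerivAt_id' x))
  refine (h2.congr_deriv ?_)
  simp [add_comm]

theorem continuous_curry_left {h : ℝ → ℝ → ℝ} (ch : Continuous fun p : ℝ × ℝ => h p.1 p.2)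
    (x : ℝ) : Continuous (h x) := ch.comp (continuous_const.prodMk continuous_id)

theorem continuous_curry_right {h : ℝ → ℝ → ℝ} (ch : Continuous fun p : ℝ × ℝ => h p.1 p.2)
    (y : ℝ) : Continuous fun x => h x y := ch.comp (continuous_id.prodMk continuous_const)

theorem hasDerivAt_integral_upper {f : ℝ → ℝ} (hf : Continuous f) (a x : ℝ) :
    HasDerivAt (fun z => ∫ s in a..z, f s) (f x) x :=
  intervalIntegral.integral_hasDerivAt_right (hf.intervalIntegrable a x)
      (hf.stronglyMeasurableAtFilter _ _) hf.continuousAt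

/-- Fubini on the triangle. -/
theorem integral_triangle_swap {k : ℝ → ℝ → ℝ} (ck : Continuous fun p : ℝ × ℝ => k p.1 p.2) :
    ∫ x in (0 : ℝ)..1, ∫ y in x..1, k x y = ∫ y in (0 : ℝ)..1, ∫ x in (0 : ℝ)..y, k x y := by
  set K : ℝ → ℝ → ℝ := fun y x => ∫ z in (0 : ℝ)..y, k x z with hK
  have cK : Continuous fun p : ℝ × ℝ => K p.1 p.2 :=
    (continuous_primitive_of_uncurry ck).comp continuous_swap
  have cks : Continuous fun p : ℝ × ℝ => k p.2 p.1 := ck.comp continuous_swap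
  have hd : ∀ y x, HasDerivAt (fun z => K z x) (k x y) y := fun y x =>
    hasDerivAt_integral_upper (continuous_curry_left ck x) 0 y
  have cdiag : Continuous fun y => K y y := cK.comp (continuous_id.prodMk continuous_id)
  have cin : Continuous fun y => ∫ x in (0 : ℝ)..y, k x y :=
    (continuous_primitive_of_uncurry (h := fun y x => k x y) cks).comp
      (continuous_id.prodMk continuous_id)
  have e1 : ∀ x, ∫ y in x..1, k x y = K 1 x - K x x := fun x => by
    have c := continuous_curry_left ck x
    rw [hK]; simp only
    rw [← intervalIntegral.integral_interval_sub_left (c.intervalIntegrable 0 1)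
      (c.intervalIntegrable 0 x)]
  -- The Leibniz rule for `y ↦ ∫_0^y K y x dx`, integrated over `[0,1]`; its diagonal term `K y y`
  -- is the one subtracted in `e1`.
  have e2 := intervalIntegral.integral_eq_sub_of_hasDerivAt (a := 0) (b := 1)
    (fun y _ => hasDerivAt_diag_integral (h := K) (h' := fun y x => k x y) hd cK cks y)
    ((cdiag.add cin).intervalIntegrable 0 1)
  rw [intervalIntegral.integral_add (cdiag.intervalIntegrable _ _)
    (cin.intervalIntegrable _ _)] at e2
  simp_rw [e1]
  rw [intervalIntegral.integral_sub ((continuous_curry_left cK 1).intervalIntegrable _ _)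
    (cdiag.intervalIntegrable _ _)]
  simp at e2
  linarith

/-! ### Volterra equations -/

/-- Banach's fixed point theorem for the norm `sup |f|/ω`: conjugating `A` with multiplication by
`ω` gives a contraction of ratio `1/2` in the ordinary sup norm. -/
theorem exists_fixed_of_weighted_contraction {X : Type*} [TopologicalSpace X] [CompactSpace X]
    (ω : C(X, ℝ)) (hω : ∀ x, 0 < ω x) (A : C(X, ℝ) → C(X, ℝ))
    (hA : ∀ f g : C(X, ℝ), ∀ M : ℝ, 0 ≤ M → (∀ x, |f x - g x| ≤ M * ω x) →
      ∀ x, |A f x - A g x| ≤ M / 2 * ω x) : ∃ f, A f = f := by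
  let ω' : C(X, ℝ) := ⟨fun x => (ω x)⁻¹, ω.continuous.inv₀ fun x => (hω x).ne'⟩
  let T : C(X, ℝ) → C(X, ℝ) := fun h => ω' * A (ω * h)
  have hT : ContractingWith (1 / 2) T := by
    refine ⟨by norm_num, LipschitzWith.of_dist_le_mul fun f g => ?_⟩
    refine (ContinuousMap.dist_le (by positivity)).2 fun x => ?_
    have h1 : ∀ x, |(ω * f) x - (ω * g) x| ≤ dist f g * ω x := fun x => by
      have := ContinuousMap.dist_apply_le_dist (f := f) (g := g) x
      rw [Real.dist_eq] at this
      rw [ContinuousMap.mul_apply, ContinuousMap.mul_apply, ← mul_sub, abs_mul,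
        abs_of_pos (hω x), mul_comm]
      exact mul_le_mul_of_nonneg_right this (hω x).le
    have h2 := hA _ _ _ dist_nonneg h1 x
    have h3 : dist (T f x) (T g x) = (ω x)⁻¹ * |A (ω * f) x - A (ω * g) x| := by
      simp only [T, ω', ContinuousMap.mul_apply, ContinuousMap.coe_mk]
      rw [Real.dist_eq, ← mul_sub, abs_mul, abs_of_pos (inv_pos.2 (hω x))]
    rw [h3, inv_mul_le_iff₀ (hω x)]
    simp only [NNReal.coe_div, NNReal.coe_one, NNReal.coe_ofNat]
    linarith
  have hfix : T (ContractingWith.fixedPoint T hT) = _ := hT.fixedPoint_isFixedPt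
  refine ⟨ω * ContractingWith.fixedPoint T hT, ?_⟩
  conv_rhs => rw [← hfix]
  ext x
  simp [T, ω', (hω x).ne']

/-- The factor `1/K` gained by integrating an exponential weight makes a Volterra operator contract
once `K` is large. -/
theorem integral_abs_le_of_le_exp {u : ℝ → ℝ} (hu : Continuous u) {C K x : ℝ} (hK : 0 < K)
    (hx : 0 ≤ x) (hC : 0 ≤ C) (h : ∀ y ∈ Icc 0 x, |u y| ≤ C * Real.exp (K * y)) :
    |∫ y in (0 : ℝ)..x, u y| ≤ C / K * Real.exp (K * x) := by
  have ce : Continuous fun y => C * Real.exp (K * y) := by fun_prop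
  have h1 : |∫ y in (0 : ℝ)..x, u y| ≤ ∫ y in (0 : ℝ)..x, C * Real.exp (K * y) := by
    refine (intervalIntegral.abs_integral_le_integral_abs hx).trans ?_
    exact intervalIntegral.integral_mono_on hx (hu.abs.intervalIntegrable _ _)
      (ce.intervalIntegrable _ _) h
  have h2 : ∫ y in (0 : ℝ)..x, C * Real.exp (K * y)
      = C / K * Real.exp (K * x) - C / K * Real.exp (K * 0) :=
    intervalIntegral.integral_eq_sub_of_hasDerivAt (f := fun y => C / K * Real.exp (K * y))
      (fun y _ => by
        have := ((hasDerivAt_id y).const_mul K).exp.const_mul (C / K)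
        refine this.congr_deriv ?_
        simp only [id]
        field_simp) (ce.intervalIntegrable _ _)
  have : 0 ≤ C / K * Real.exp (K * 0) := by positivity
  linarith

/-- The weight `exp(Kx)` with `K = 2(M+1)`, where `M` bounds the kernel on the square, brings the
contraction ratio `M/K` below `1/2`. No smallness of the kernel is needed. -/
theorem exists_volterra_solution {k : ℝ → ℝ → ℝ} (ck : Continuous fun p : ℝ × ℝ => k p.1 p.2)
    {g : ℝ → ℝ} (cg : ContinuousOn g (Icc 0 1)) :
    ∃ f : ℝ → ℝ, Continuous f ∧ ∀ x ∈ Icc (0 : ℝ) 1, f x = g x + ∫ y in (0 : ℝ)..x, k x y * f y := by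
  obtain ⟨M, hM⟩ := (isCompact_Icc.prod (isCompact_Icc (a := (0 : ℝ)) (b := 1))
    |>.exists_bound_of_continuousOn (s := Icc (0 : ℝ) 1 ×ˢ Icc (0 : ℝ) 1) ck.continuousOn)
  have hM0 : 0 ≤ M := (norm_nonneg _).trans (hM (0, 0) (by simp))
  let E : C(Icc (0 : ℝ) 1, ℝ) → ℝ → ℝ := fun f y => f (projIcc 0 1 zero_le_one y)
  have cE : ∀ f, Continuous (E f) := fun f => f.continuous.comp continuous_projIcc
  have ckE : ∀ f, Continuous fun p : ℝ × ℝ => k p.1 p.2 * E f p.2 := fun f =>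
    ck.mul ((cE f).comp continuous_snd)
  let A : C(Icc (0 : ℝ) 1, ℝ) → C(Icc (0 : ℝ) 1, ℝ) := fun f =>
    ⟨fun x => g x + ∫ y in (0 : ℝ)..x, k x y * E f y,
      (cg.comp_continuous continuous_subtype_val fun x => x.2).add
        ((continuous_primitive_of_uncurry (h := fun x y => k x y * E f y) (ckE f)).comp
          (continuous_subtype_val.prodMk continuous_subtype_val))⟩
  set K := 2 * (M + 1)
  have hK : 0 < K := by positivity
  obtain ⟨f, hf⟩ := exists_fixed_of_weighted_contraction
    (⟨fun x => Real.exp (K * x), by fun_prop⟩ : C(Icc (0 : ℝ) 1, ℝ))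
    (fun x => Real.exp_pos _) A (by
      intro f g L hL h x
      have e : A f x - A g x = ∫ y in (0 : ℝ)..x, k x y * (E f y - E g y) := by
        have hc : ∀ f, Continuous fun y => k x y * E f y := fun f =>
          (continuous_curry_left ck x).mul (cE f)
        simp only [A, ContinuousMap.coe_mk]
        simp_rw [mul_sub]
        rw [intervalIntegral.integral_sub ((hc f).intervalIntegrable _ _)
          ((hc g).intervalIntegrable _ _)]
        ring
      rw [e]
      refine (integral_abs_le_of_le_exp (C := M * L) (K := K) ?_ hK x.2.1 (by positivity) ?_).trans ?_
      · exact (continuous_curry_left ck x).mul ((cE f).sub (cE g))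
      · intro y hy
        have hy1 : y ∈ Icc (0 : ℝ) 1 := ⟨hy.1, hy.2.trans x.2.2⟩
        have := h ⟨y, hy1⟩
        rw [abs_mul, mul_assoc]
        refine mul_le_mul (hM (x, y) ⟨x.2, hy1⟩) ?_ (abs_nonneg _) hM0
        simp only [E, projIcc_of_mem zero_le_one hy1]
        exact this
      · refine mul_le_mul_of_nonneg_right ?_ (Real.exp_pos _).le
        rw [div_le_iff₀ hK]
        simp only [K]; nlinarith)
  refine ⟨E f, cE f, fun x hx => ?_⟩
  have := congrArg (fun h => h ⟨x, hx⟩) hf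
  simp only [A, ContinuousMap.coe_mk] at this
  rw [this]
  simp only [E, projIcc_of_mem zero_le_one hx]

/-- Cauchy–Schwarz on an interval of length at most one: expanding `∫ (|f| - m)² ≥ 0`, with `m` the
integral of `|f|`, gives `(2 - x) m² ≤ ∫ f²`. -/
theorem sq_integral_abs_le {f : ℝ → ℝ} (hf : Continuous f) {x : ℝ} (hx : x ∈ Icc (0 : ℝ) 1) :
    (∫ y in (0 : ℝ)..x, |f y|) ^ 2 ≤ ∫ y in (0 : ℝ)..x, f y ^ 2 := by
  set m := ∫ y in (0 : ℝ)..x, |f y|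
  have h0 : 0 ≤ ∫ y in (0 : ℝ)..x, (|f y| - m) ^ 2 :=
    intervalIntegral.integral_nonneg hx.1 fun y _ => sq_nonneg _
  have e : ∫ y in (0 : ℝ)..x, (|f y| - m) ^ 2
      = (∫ y in (0 : ℝ)..x, f y ^ 2) - 2 * m * m + m ^ 2 * x := by
    have : ∀ y, (|f y| - m) ^ 2 = f y ^ 2 - 2 * m * |f y| + m ^ 2 := fun y => by
      rw [sub_sq, sq_abs]; ring
    simp_rw [this]
    rw [intervalIntegral.integral_add, intervalIntegral.integral_sub,
      intervalIntegral.integral_const_mul, intervalIntegral.integral_const]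
    · simp only [sub_zero, smul_eq_mul, m]; ring
    all_goals exact Continuous.intervalIntegrable (by fun_prop) _ _
  nlinarith [hx.2, sq_nonneg m]

/-- Gronwall in `L²`: the hypothesis gives `f² ≤ 2g² + K ∫_0^x f²` with `K = 2M²`, so `2 ∫_0^x g² -
exp(-Kx) ∫_0^x f²` is nondecreasing from `0`. -/
theorem integral_sq_le_of_volterra {f g : ℝ → ℝ} (hf : Continuous f) (hg : Continuous g) {M : ℝ}
    (h : ∀ x ∈ Icc (0 : ℝ) 1, |f x| ≤ |g x| + M * ∫ y in (0 : ℝ)..x, |f y|) :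
    ∫ x in (0 : ℝ)..1, f x ^ 2 ≤ 2 * Real.exp (2 * M ^ 2) * ∫ x in (0 : ℝ)..1, g x ^ 2 := by
  set K := 2 * M ^ 2
  set D : ℝ → ℝ := fun x => 2 * (∫ y in (0 : ℝ)..x, g y ^ 2)
    - (∫ y in (0 : ℝ)..x, f y ^ 2) * Real.exp (-K * x) with hD
  have hd : ∀ x, HasDerivAt D (2 * g x ^ 2 - (f x ^ 2 * Real.exp (-K * x)
      + (∫ y in (0 : ℝ)..x, f y ^ 2) * (Real.exp (-K * x) * (-K)))) x := fun x => by
    have h1 := (hasDerivAt_integral_upper (hg.pow 2) 0 x).const_mul 2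
    have h2 := hasDerivAt_integral_upper (hf.pow 2) 0 x
    have h3 : HasDerivAt (fun x => Real.exp (-K * x)) (Real.exp (-K * x) * (-K)) x := by
      simpa using! ((hasDerivAt_id x).const_mul (-K)).exp
    exact h1.sub (h2.mul h3)
  have hmono : MonotoneOn D (Icc 0 1) := by
    refine monotoneOn_of_deriv_nonneg (convex_Icc 0 1)
      (fun x _ => (hd x).continuousAt.continuousWithinAt)
      (fun x _ => (hd x).differentiableAt.differentiableWithinAt) fun x hx => ?_
    rw [interior_Icc] at hx
    have hx' : x ∈ Icc (0 : ℝ) 1 := Ioo_subset_Icc_self hx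
    rw [(hd x).deriv]
    have e1 := sq_integral_abs_le hf hx'
    have e2 := h x hx'
    set m := ∫ y in (0 : ℝ)..x, |f y|
    have e3 : f x ^ 2 ≤ 2 * g x ^ 2 + K * ∫ y in (0 : ℝ)..x, f y ^ 2 := by
      have : f x ^ 2 ≤ (|g x| + M * m) ^ 2 := by
        rw [← sq_abs (f x)]; exact pow_le_pow_left₀ (abs_nonneg _) e2 2
      have e4 : M ^ 2 * m ^ 2 ≤ M ^ 2 * ∫ y in (0 : ℝ)..x, f y ^ 2 :=
        mul_le_mul_of_nonneg_left e1 (sq_nonneg M)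
      simp only [K]
      nlinarith [sq_nonneg (|g x| - M * m), sq_abs (g x)]
    have e5 : Real.exp (-K * x) ≤ 1 := by
      rw [Real.exp_le_one_iff]
      have : 0 ≤ K * x := mul_nonneg (by positivity) hx'.1
      linarith
    have e6 := Real.exp_pos (-K * x)
    nlinarith [mul_le_mul_of_nonneg_right e3 e6.le,
      mul_le_mul_of_nonneg_left e5 (by positivity : 0 ≤ 2 * g x ^ 2)]
  have h01 := hmono (left_mem_Icc.2 zero_le_one) (right_mem_Icc.2 zero_le_one) zero_le_one
  simp only [hD, intervalIntegral.integral_same] at h01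
  have e : Real.exp (-K * 1) * Real.exp K = 1 := by rw [← Real.exp_add]; simp
  have := mul_le_mul_of_nonneg_right (sub_nonneg.1 (by linarith : 0 ≤ 2 * (∫ y in (0 : ℝ)..1, g y ^ 2)
    - (∫ y in (0 : ℝ)..1, f y ^ 2) * Real.exp (-K * 1))) (Real.exp_pos K).le
  rw [mul_assoc, e, mul_one] at this
  linarith

/-! ### Extensions -/

/-- The one-sided derivative is extended by constants beyond the end points and integrated back. -/
theorem exists_contDiff_extension {f : ℝ → ℝ} (hf : ContDiffOn ℝ 1 f (Icc 0 1)) :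
    ∃ g : ℝ → ℝ, ContDiff ℝ 1 g ∧ EqOn g f (Icc 0 1) := by
  have u : UniqueDiffOn ℝ (Icc (0 : ℝ) 1) := uniqueDiffOn_Icc zero_lt_one
  have cd : ContinuousOn (derivWithin f (Icc 0 1)) (Icc 0 1) :=
    hf.continuousOn_derivWithin u le_rfl
  set d := IccExtend (zero_le_one (α := ℝ)) ((Icc (0 : ℝ) 1).domRestrict (derivWithin f (Icc 0 1)))
  have cdd : Continuous d := continuousOn_iff_continuous_domRestrict.1 cd |>.Icc_extend'
  have hd : ∀ x ∈ Icc (0 : ℝ) 1, d x = derivWithin f (Icc 0 1) x := fun x hx => by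
    simp [d, IccExtend_of_mem, hx, Set.domRestrict]
  have hg : ∀ x, HasDerivAt (fun x => f 0 + ∫ y in (0 : ℝ)..x, d y) (d x) x := fun x =>
    (hasDerivAt_integral_upper cdd 0 x).const_add _
  refine ⟨fun x => f 0 + ∫ y in (0 : ℝ)..x, d y, ?_, fun x hx => ?_⟩
  · refine contDiff_one_iff_deriv.2 ⟨fun x => (hg x).differentiableAt, ?_⟩
    have : deriv (fun x => f 0 + ∫ y in (0 : ℝ)..x, d y) = d := funext fun x => (hg x).deriv
    rwa [this]
  · have : ∫ y in (0 : ℝ)..x, d y = f x - f 0 := by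
      refine intervalIntegral.integral_eq_sub_of_hasDerivAt_of_le hx.1
        (hf.continuousOn.mono (Icc_subset_Icc_right hx.2)) (fun y hy => ?_)
        (cdd.intervalIntegrable _ _)
      have hy' : y ∈ Icc (0 : ℝ) 1 := ⟨hy.1.le, hy.2.le.trans hx.2⟩
      rw [hd y hy']
      exact ((hf.differentiableOn one_ne_zero y hy').hasDerivWithinAt).hasDerivAt
        (Icc_mem_nhds hy.1 (hy.2.trans_le hx.2))
    simp [this]

/-- A continuous retraction of the plane onto the triangle. -/
noncomputable def triangleRetract (p : ℝ × ℝ) : ℝ × ℝ :=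
  (max 0 (min p.1 1), max 0 (min p.2 (max 0 (min p.1 1))))

theorem continuous_triangleRetract : Continuous triangleRetract := by
  unfold triangleRetract; fun_prop

theorem triangleRetract_mem (p : ℝ × ℝ) : triangleRetract p ∈ triangle := by
  refine ⟨le_max_left _ _, ?_, ?_⟩
  · exact max_le (le_max_left _ _) (min_le_right _ _)
  · exact max_le zero_le_one (min_le_right _ _)

theorem triangleRetract_of_mem {p : ℝ × ℝ} (hp : p ∈ triangle) : triangleRetract p = p := by
  obtain ⟨h1, h2, h3⟩ := hp
  have : max 0 (min p.1 1) = p.1 := by rw [min_eq_left h3, max_eq_right (h1.trans h2)]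
  simp only [triangleRetract, this, min_eq_left h2, max_eq_right h1]

theorem continuous_comp_triangleRetract {f : ℝ × ℝ → ℝ} (hf : ContinuousOn f triangle) :
    Continuous (f ∘ triangleRetract) :=
  hf.comp_continuous continuous_triangleRetract triangleRetract_mem

/-! ### The Goursat problem -/

theorem hasDerivAt_fst_of_differentiableAt {f : ℝ → ℝ → ℝ} {x y : ℝ}
    (hf : DifferentiableAt ℝ (fun p : ℝ × ℝ => f p.1 p.2) (x, y)) :
    HasDerivAt (fun z => f z y) (fderiv ℝ (fun p : ℝ × ℝ => f p.1 p.2) (x, y) (1, 0)) x :=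
  HasFDerivAt.comp_hasDerivAt (f := fun z : ℝ => (z, y)) x hf.hasFDerivAt
    ((hasDerivAt_id' x).prodMk (hasDerivAt_const x y))

theorem hasDerivAt_snd_of_differentiableAt {f : ℝ → ℝ → ℝ} {x y : ℝ}
    (hf : DifferentiableAt ℝ (fun p : ℝ × ℝ => f p.1 p.2) (x, y)) :
    HasDerivAt (fun z => f x z) (fderiv ℝ (fun p : ℝ × ℝ => f p.1 p.2) (x, y) (0, 1)) y :=
  HasFDerivAt.comp_hasDerivAt (f := fun z : ℝ => (x, z)) y hf.hasFDerivAt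
    ((hasDerivAt_const y x).prodMk (hasDerivAt_id' y))

theorem contDiff_one_primitive {h : ℝ → ℝ → ℝ} (ch : ContDiff ℝ 1 fun p : ℝ × ℝ => h p.1 p.2) :
    ContDiff ℝ 1 fun p : ℝ × ℝ => ∫ s in (0 : ℝ)..p.2, h p.1 s := by
  have hdiff := ch.differentiable one_ne_zero
  have c' : Continuous fun p : ℝ × ℝ => fderiv ℝ (fun p : ℝ × ℝ => h p.1 p.2) p (1, 0) :=
    (ch.continuous_fderiv one_ne_zero).clm_apply continuous_const
  exact contDiff_succ_of_partials (n := 0) (f := fun x y => ∫ s in (0 : ℝ)..y, h x s)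
    (f₁ := fun x y => ∫ s in (0 : ℝ)..y, fderiv ℝ (fun p : ℝ × ℝ => h p.1 p.2) (x, s) (1, 0))
    (f₂ := h)
    (fun x y => hasDerivAt_param_integral
      (h' := fun x s => fderiv ℝ (fun p : ℝ × ℝ => h p.1 p.2) (x, s) (1, 0))
      (fun x s => hasDerivAt_fst_of_differentiableAt (hdiff (x, s))) ch.continuous c' 0 y x)
    (fun x y => hasDerivAt_integral_upper (continuous_curry_left ch.continuous x) 0 y)
    (contDiff_zero.2 (continuous_primitive_of_uncurry
      (h := fun x s => fderiv ℝ (fun p : ℝ × ℝ => h p.1 p.2) (x, s) (1, 0)) c'))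
    (contDiff_zero.2 ch.continuous)

theorem continuous_integral_of_uncurry {h : ℝ → ℝ → ℝ}
    (ch : Continuous fun p : ℝ × ℝ => h p.1 p.2) (a b : ℝ) :
    Continuous fun x => ∫ s in a..b, h x s :=
  intervalIntegral.continuous_parametric_intervalIntegral_of_continuous' (f := h) ch a b

/-- The integral of `h` over the rectangle with corners `(η, 0)` and `(ξ, η)`. -/
noncomputable def goursatIntegral (h : ℝ → ℝ → ℝ) (ξ η : ℝ) : ℝ :=
  ∫ τ in η..ξ, ∫ s in (0 : ℝ)..η, h τ s

theorem goursatIntegral_eq {h : ℝ → ℝ → ℝ} (ch : Continuous fun p : ℝ × ℝ => h p.1 p.2)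
    (ξ η : ℝ) : goursatIntegral h ξ η
      = (∫ τ in (0 : ℝ)..ξ, ∫ s in (0 : ℝ)..η, h τ s)
        - ∫ τ in (0 : ℝ)..η, ∫ s in (0 : ℝ)..η, h τ s := by
  have c := continuous_integral_of_uncurry ch 0 η
  exact (intervalIntegral.integral_interval_sub_left (c.intervalIntegrable 0 ξ)
      (c.intervalIntegrable 0 η)).symm

theorem hasDerivAt_goursatIntegral_fst {h : ℝ → ℝ → ℝ}
    (ch : Continuous fun p : ℝ × ℝ => h p.1 p.2) (ξ η : ℝ) :
    HasDerivAt (fun z => goursatIntegral h z η) (∫ s in (0 : ℝ)..η, h ξ s) ξ :=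
  hasDerivAt_integral_upper (continuous_integral_of_uncurry ch 0 η) η ξ

theorem hasDerivAt_goursatIntegral_snd {h : ℝ → ℝ → ℝ}
    (ch : Continuous fun p : ℝ × ℝ => h p.1 p.2) (ξ η : ℝ) :
    HasDerivAt (fun z => goursatIntegral h ξ z)
      ((∫ τ in η..ξ, h τ η) - ∫ s in (0 : ℝ)..η, h η s) η := by
  have cJ : Continuous fun p : ℝ × ℝ => ∫ s in (0 : ℝ)..p.1, h p.2 s :=
    (continuous_primitive_of_uncurry ch).comp continuous_swap
  have hd : ∀ x τ, HasDerivAt (fun z => ∫ s in (0 : ℝ)..z, h τ s) (h τ x) x := fun x τ =>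
    hasDerivAt_integral_upper (continuous_curry_left ch τ) 0 x
  have h1 := hasDerivAt_param_integral (h := fun x τ => ∫ s in (0 : ℝ)..x, h τ s)
    (h' := fun x τ => h τ x) hd cJ (ch.comp continuous_swap) 0 ξ η
  have h2 := hasDerivAt_diag_integral (h := fun x τ => ∫ s in (0 : ℝ)..x, h τ s)
    (h' := fun x τ => h τ x) hd cJ (ch.comp continuous_swap) η
  have c := continuous_curry_right ch η
  refine ((h1.sub h2).congr_of_eventuallyEq
    (Eventually.of_forall fun z => goursatIntegral_eq ch ξ z)).congr_deriv ?_
  rw [← intervalIntegral.integral_interval_sub_left (c.intervalIntegrable 0 ξ)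
      (c.intervalIntegrable 0 η)]
  ring

theorem continuous_goursatIntegral {h : ℝ → ℝ → ℝ} (ch : Continuous fun p : ℝ × ℝ => h p.1 p.2) :
    Continuous fun p : ℝ × ℝ => goursatIntegral h p.1 p.2 := by
  have cJ : Continuous fun p : ℝ × ℝ => ∫ s in (0 : ℝ)..p.1, h p.2 s :=
    (continuous_primitive_of_uncurry ch).comp continuous_swap
  have cK := continuous_primitive_of_uncurry (h := fun x τ => ∫ s in (0 : ℝ)..x, h τ s) cJ
  simp_rw [goursatIntegral_eq ch]
  exact (cK.comp (continuous_snd.prodMk continuous_fst)).sub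
    (cK.comp (continuous_snd.prodMk continuous_snd))

/-- The analogue of the exponential weight for arguments of either sign: `cosh` is even, and its
primitive `sinh(K·)/K` is at most `cosh(K·)/K` in absolute value. Each integration either gains
`1/K` or costs a length bounded by a multiple of `R`, and at least one of the two gains. -/
theorem abs_goursatIntegral_le {u : ℝ → ℝ → ℝ} {C K R ξ η : ℝ}
    (hK : 0 < K) (hC : 0 ≤ C) (hξ : |ξ| ≤ R) (hη : |η| ≤ R)
    (h : ∀ τ s, |τ| ≤ R → |s| ≤ R → |u τ s| ≤ C * (Real.cosh (K * τ) + Real.cosh (K * s))) :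
    |goursatIntegral u ξ η| ≤ 3 * R * C / K * (Real.cosh (K * ξ) + Real.cosh (K * η)) := by
  have hR : 0 ≤ R := (abs_nonneg _).trans hξ
  have hprim : ∀ a b : ℝ, ∫ s in a..b, Real.cosh (K * s)
      = Real.sinh (K * b) / K - Real.sinh (K * a) / K := fun a b =>
    intervalIntegral.integral_eq_sub_of_hasDerivAt (f := fun y => Real.sinh (K * y) / K)
      (fun y _ => by
      have := ((((hasDerivAt_id' y).const_mul K).sinh).div_const K)
      refine this.congr_deriv ?_
      field_simp) (Continuous.intervalIntegrable (by fun_prop) _ _)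
  have hsc : ∀ x, |Real.sinh x| ≤ Real.cosh x := fun x => by
    rw [abs_le]
    have h1 := Real.exp_pos x
    have h2 := Real.exp_pos (-x)
    rw [Real.sinh_eq, Real.cosh_eq]
    constructor <;> linarith
  have hmem : ∀ a b t, |a| ≤ R → |b| ≤ R → t ∈ uIoc a b → |t| ≤ R := fun a b t ha hb ht => by
    have := uIoc_subset_uIcc ht
    rw [mem_uIcc] at this
    rw [abs_le] at *
    rcases this with h | h <;> constructor <;> linarith [h.1, h.2]
  have hcη := Real.cosh_pos (K * η)
  have inner : ∀ τ, |τ| ≤ R → |∫ s in (0 : ℝ)..η, u τ s|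
      ≤ C * (R * Real.cosh (K * τ) + Real.cosh (K * η) / K) := fun τ hτ => by
    have h1 : ‖∫ s in (0 : ℝ)..η, u τ s‖
        ≤ |∫ s in (0 : ℝ)..η, C * (Real.cosh (K * τ) + Real.cosh (K * s))| := by
      refine intervalIntegral.norm_integral_le_abs_of_norm_le ?_
        (Continuous.intervalIntegrable (by fun_prop) _ _)
      refine (ae_restrict_iff' measurableSet_uIoc).2 (Eventually.of_forall fun s hs => ?_)
      exact h τ s hτ (hmem 0 η s (by simpa using hR) hη hs)
    refine h1.trans ?_
    rw [intervalIntegral.integral_const_mul, intervalIntegral.integral_add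
      (by simp) (Continuous.intervalIntegrable (by fun_prop) _ _), hprim,
      intervalIntegral.integral_const, abs_mul, abs_of_nonneg hC]
    refine mul_le_mul_of_nonneg_left ((abs_add_le _ _).trans (add_le_add ?_ ?_)) hC
    · rw [smul_eq_mul, abs_mul, sub_zero, abs_of_pos (Real.cosh_pos _)]
      exact mul_le_mul_of_nonneg_right hη (Real.cosh_pos _).le
    · simp only [mul_zero, Real.sinh_zero, zero_div, sub_zero]
      rw [abs_div, abs_of_pos hK]
      exact div_le_div_of_nonneg_right (hsc _) hK.le
  have h1 : ‖goursatIntegral u ξ η‖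
      ≤ |∫ τ in η..ξ, C * (R * Real.cosh (K * τ) + Real.cosh (K * η) / K)| := by
    refine intervalIntegral.norm_integral_le_abs_of_norm_le ?_
      (Continuous.intervalIntegrable (by fun_prop) _ _)
    refine (ae_restrict_iff' measurableSet_uIoc).2 (Eventually.of_forall fun τ hτ => ?_)
    exact inner τ (hmem η ξ τ hη hξ hτ)
  refine h1.trans ?_
  rw [intervalIntegral.integral_const_mul, intervalIntegral.integral_add
      (Continuous.intervalIntegrable (by fun_prop) _ _) (by simp),
      intervalIntegral.integral_const_mul, hprim,
      intervalIntegral.integral_const, abs_mul, abs_of_nonneg hC, smul_eq_mul]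
  have a1 := abs_le.1 (hsc (K * ξ))
  have a2 := abs_le.1 (hsc (K * η))
  have a3 := abs_le.1 hξ
  have a4 := abs_le.1 hη
  have e : R * (Real.sinh (K * ξ) / K - Real.sinh (K * η) / K) + (ξ - η) * (Real.cosh (K * η) / K)
      = (R * (Real.sinh (K * ξ) - Real.sinh (K * η)) + (ξ - η) * Real.cosh (K * η)) / K := by
    field_simp
  rw [e, abs_div, abs_of_pos hK]
  have : |R * (Real.sinh (K * ξ) - Real.sinh (K * η)) + (ξ - η) * Real.cosh (K * η)|
      ≤ 3 * R * (Real.cosh (K * ξ) + Real.cosh (K * η)) := by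
    have b1 : |R * (Real.sinh (K * ξ) - Real.sinh (K * η))|
        ≤ R * (Real.cosh (K * ξ) + Real.cosh (K * η)) := by
      rw [abs_mul, abs_of_nonneg hR]
      refine mul_le_mul_of_nonneg_left ?_ hR
      rw [abs_le]; constructor <;> linarith
    have b2 : |(ξ - η) * Real.cosh (K * η)| ≤ 2 * R * Real.cosh (K * η) := by
      rw [abs_mul, abs_of_pos hcη]
      refine mul_le_mul_of_nonneg_right ?_ hcη.le
      rw [abs_le]; constructor <;> linarith
    have b3 : 0 ≤ R * Real.cosh (K * ξ) := mul_nonneg hR (Real.cosh_pos _).le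
    have := abs_add_le (R * (Real.sinh (K * ξ) - Real.sinh (K * η))) ((ξ - η) * Real.cosh (K * η))
    nlinarith
  calc C * (_ / K) ≤ C * (3 * R * (Real.cosh (K * ξ) + Real.cosh (K * η)) / K) := by gcongr
    _ = _ := by ring

/-- Contraction on the square `[-R,R]²` with the `cosh` weight; `K = 6R(M+1)` makes the factor
`3RM/K` at most `1/2`. Working on the whole plane with a compactly supported coefficient keeps all
later derivatives two-sided. -/
theorem exists_goursat_solution {m g : ℝ → ℝ → ℝ} {R : ℝ} (hR : 0 < R)
    (cm : Continuous fun p : ℝ × ℝ => m p.1 p.2) (cg : Continuous fun p : ℝ × ℝ => g p.1 p.2)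
    (hm : ∀ τ s, R < |τ| ∨ R < |s| → m τ s = 0) :
    ∃ G : ℝ → ℝ → ℝ, (Continuous fun p : ℝ × ℝ => G p.1 p.2) ∧
      ∀ ξ η, G ξ η = g ξ η + goursatIntegral (fun τ s => m τ s * G τ s) ξ η := by
  have hRR : -R ≤ R := by linarith
  obtain ⟨M, hM⟩ := (isCompact_Icc.prod (isCompact_Icc (a := -R) (b := R))
    |>.exists_bound_of_continuousOn (s := Icc (-R) R ×ˢ Icc (-R) R) cm.continuousOn)
  have hM0 : 0 ≤ M := (norm_nonneg _).trans (hM (0, 0) (by simp [hR.le]))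
  let E : C(Icc (-R) R × Icc (-R) R, ℝ) → ℝ → ℝ → ℝ := fun f τ s => f (projIcc (-R) R hRR τ, projIcc (-R) R hRR s)
  have cE : ∀ f, Continuous fun p : ℝ × ℝ => E f p.1 p.2 := fun f =>
    f.continuous.comp ((continuous_projIcc.comp continuous_fst).prodMk
      (continuous_projIcc.comp continuous_snd))
  have cmE : ∀ f, Continuous fun p : ℝ × ℝ => m p.1 p.2 * E f p.1 p.2 := fun f => cm.mul (cE f)
  have cemb : Continuous fun x : Icc (-R) R × Icc (-R) R => ((x.1 : ℝ), (x.2 : ℝ)) :=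
    (continuous_subtype_val.comp continuous_fst).prodMk
      (continuous_subtype_val.comp continuous_snd)
  let A : C(Icc (-R) R × Icc (-R) R, ℝ) → C(Icc (-R) R × Icc (-R) R, ℝ) := fun f =>
    ⟨fun x => g x.1 x.2 + goursatIntegral (fun τ s => m τ s * E f τ s) x.1 x.2,
      (cg.comp cemb).add ((continuous_goursatIntegral
        (h := fun τ s => m τ s * E f τ s) (cmE f)).comp cemb)⟩
  have mem : ∀ x : Icc (-R) R, |(x : ℝ)| ≤ R := fun x => abs_le.2 x.2
  set K := 6 * R * (M + 1)
  have hK : 0 < K := by positivity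
  obtain ⟨f, hf⟩ := exists_fixed_of_weighted_contraction
    (⟨fun x => Real.cosh (K * x.1) + Real.cosh (K * x.2), by fun_prop⟩ : C(Icc (-R) R × Icc (-R) R, ℝ))
    (fun x => add_pos (Real.cosh_pos _) (Real.cosh_pos _)) A (by
      intro f g L hL h x
      have e : A f x - A g x
          = goursatIntegral (fun τ s => m τ s * (E f τ s - E g τ s)) x.1 x.2 := by
        have hc : ∀ f τ, Continuous fun s => m τ s * E f τ s := fun f τ =>
          continuous_curry_left (h := fun τ s => m τ s * E f τ s) (cmE f) τ
        have hc2 : ∀ f, Continuous fun τ => ∫ s in (0 : ℝ)..x.2, m τ s * E f τ s := fun f =>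
          continuous_integral_of_uncurry (h := fun τ s => m τ s * E f τ s) (cmE f) _ _
        simp only [A, ContinuousMap.coe_mk, goursatIntegral]
        simp_rw [mul_sub]
        have hs : ∀ τ, ∫ s in (0 : ℝ)..x.2, (m τ s * E f τ s - m τ s * E g τ s)
            = (∫ s in (0 : ℝ)..x.2, m τ s * E f τ s) - ∫ s in (0 : ℝ)..x.2, m τ s * E g τ s :=
          fun τ => intervalIntegral.integral_sub ((hc f τ).intervalIntegrable 0 x.2)
            ((hc g τ).intervalIntegrable 0 x.2)
        simp_rw [hs]
        rw [intervalIntegral.integral_sub ((hc2 f).intervalIntegrable _ _)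
          ((hc2 g).intervalIntegrable _ _)]
        ring
      rw [e]
      refine (abs_goursatIntegral_le (C := M * L) (K := K) hK (by positivity) (mem x.1) (mem x.2)
        ?_).trans ?_
      · intro τ s hτ hs
        have hτ' := abs_le.1 hτ
        have hs' := abs_le.1 hs
        have := h (⟨τ, hτ'⟩, ⟨s, hs'⟩)
        rw [abs_mul, mul_assoc]
        refine mul_le_mul (hM (τ, s) ⟨hτ', hs'⟩) ?_ (abs_nonneg _) hM0
        simp only [E, projIcc_of_mem hRR hτ', projIcc_of_mem hRR hs']
        exact this
      · refine mul_le_mul_of_nonneg_right ?_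
          (add_pos (Real.cosh_pos _) (Real.cosh_pos _)).le
        rw [div_le_iff₀ hK]
        simp only [K]
        nlinarith [mul_nonneg hR.le hL])
  have cG : Continuous fun p : ℝ × ℝ =>
      g p.1 p.2 + goursatIntegral (fun τ s => m τ s * E f τ s) p.1 p.2 :=
    cg.add (continuous_goursatIntegral (h := fun τ s => m τ s * E f τ s) (cmE f))
  refine ⟨fun ξ η => g ξ η + goursatIntegral (fun τ s => m τ s * E f τ s) ξ η, cG, fun ξ η => ?_⟩
  -- Outside the square `m` vanishes, and inside it the fixed point equation applies; hence the
  -- integrand involves the solution itself everywhere and the equation holds on the plane.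
  have key : (fun τ s => m τ s * E f τ s)
      = fun τ s => m τ s * (g τ s + goursatIntegral (fun τ s => m τ s * E f τ s) τ s) := by
    funext τ s
    by_cases hτs : R < |τ| ∨ R < |s|
    · rw [hm τ s hτs, zero_mul, zero_mul]
    · push Not at hτs
      have hτ' := abs_le.1 hτs.1
      have hs' := abs_le.1 hτs.2
      have := congrArg (fun h => h (⟨τ, hτ'⟩, ⟨s, hs'⟩)) hf
      simp only [A, ContinuousMap.coe_mk] at this
      rw [this]
      simp only [E, projIcc_of_mem hRR hτ', projIcc_of_mem hRR hs']
  simp only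
  rw [← key]

theorem contDiff_goursat_partials {h : ℝ → ℝ → ℝ} (ch : ContDiff ℝ 1 fun p : ℝ × ℝ => h p.1 p.2) :
    ContDiff ℝ 1 fun p : ℝ × ℝ =>
      (∫ τ in p.2..p.1, h τ p.2) - ∫ s in (0 : ℝ)..p.2, h p.2 s := by
  have c1 := contDiff_one_primitive ch
  have c2 := contDiff_one_primitive (h := fun y x => h x y) (ch.comp (contDiff_snd.prodMk contDiff_fst))
  have e : ∀ x y : ℝ, ∫ τ in y..x, h τ y
      = (∫ τ in (0 : ℝ)..x, h τ y) - ∫ τ in (0 : ℝ)..y, h τ y := fun x y =>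
    (intervalIntegral.integral_interval_sub_left
      ((continuous_curry_right ch.continuous y).intervalIntegrable 0 x)
      ((continuous_curry_right ch.continuous y).intervalIntegrable 0 y)).symm
  simp_rw [e]
  exact ((c2.comp (contDiff_snd.prodMk contDiff_fst)).sub
    (c2.comp (contDiff_snd.prodMk contDiff_snd))).sub (c1.comp (contDiff_snd.prodMk contDiff_snd))

/-- A `C²` solution of `G_ξη = m G`, `G(ξ,ξ) = 0`, `G_ξ(ξ,0) = -α(ξ)`, with its derivatives. -/
theorem exists_goursat_contDiff {m : ℝ → ℝ → ℝ} {α : ℝ → ℝ} {R : ℝ} (hR : 0 < R)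
    (cm : ContDiff ℝ 1 fun p : ℝ × ℝ => m p.1 p.2) (cα : ContDiff ℝ 1 α)
    (hm : ∀ τ s, R < |τ| ∨ R < |s| → m τ s = 0) :
    ∃ G P Q : ℝ → ℝ → ℝ, (ContDiff ℝ 2 fun p : ℝ × ℝ => G p.1 p.2) ∧
      (ContDiff ℝ 1 fun p : ℝ × ℝ => P p.1 p.2) ∧ (ContDiff ℝ 1 fun p : ℝ × ℝ => Q p.1 p.2) ∧
      (∀ ξ η, HasDerivAt (fun z => G z η) (P ξ η) ξ) ∧
      (∀ ξ η, HasDerivAt (fun z => G ξ z) (Q ξ η) η) ∧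
      (∀ ξ η, HasDerivAt (fun z => P ξ z) (m ξ η * G ξ η) η) ∧
      (∀ ξ η, HasDerivAt (fun z => Q z η) (m ξ η * G ξ η) ξ) ∧
      (∀ ξ, G ξ ξ = 0) ∧ ∀ ξ, G ξ 0 = -∫ τ in (0 : ℝ)..ξ, α τ := by
  have cg : Continuous fun p : ℝ × ℝ => -∫ τ in p.2..p.1, α τ := by
    have e : ∀ x y : ℝ, ∫ τ in y..x, α τ = (∫ τ in (0 : ℝ)..x, α τ) - ∫ τ in (0 : ℝ)..y, α τ :=
      fun x y => (intervalIntegral.integral_interval_sub_left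
        (cα.continuous.intervalIntegrable 0 x) (cα.continuous.intervalIntegrable 0 y)).symm
    have c := intervalIntegral.continuous_primitive
      (fun a b => cα.continuous.intervalIntegrable (μ := volume) a b) 0
    exact ((c.comp continuous_fst).sub (c.comp continuous_snd)).neg.congr
      fun p => congrArg Neg.neg (e p.1 p.2).symm
  obtain ⟨G, cG, hG⟩ := exists_goursat_solution (g := fun ξ η => -∫ τ in η..ξ, α τ) hR
    cm.continuous cg hm
  set k : ℝ → ℝ → ℝ := fun τ s => m τ s * G τ s with hk
  have ck : Continuous fun p : ℝ × ℝ => k p.1 p.2 := cm.continuous.mul cG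
  set P : ℝ → ℝ → ℝ := fun ξ η => -α ξ + ∫ s in (0 : ℝ)..η, k ξ s
  set Q : ℝ → ℝ → ℝ := fun ξ η => α η + ((∫ τ in η..ξ, k τ η) - ∫ s in (0 : ℝ)..η, k η s)
  have hGP : ∀ ξ η, HasDerivAt (fun z => G z η) (P ξ η) ξ := fun ξ η =>
    (((hasDerivAt_integral_upper cα.continuous η ξ).neg).add
      (hasDerivAt_goursatIntegral_fst ck ξ η)).congr_of_eventuallyEq
      (Eventually.of_forall fun z => hG z η)
  have hα' : ∀ ξ η, HasDerivAt (fun z => -∫ τ in z..ξ, α τ) (α η) η := fun ξ η => by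
    have := hasDerivAt_integral_upper cα.continuous ξ η
    refine this.congr_of_eventuallyEq (Eventually.of_forall fun z => ?_)
    exact (intervalIntegral.integral_symm _ _).symm
  have hGQ : ∀ ξ η, HasDerivAt (fun z => G ξ z) (Q ξ η) η := fun ξ η =>
    ((hα' ξ η).add (hasDerivAt_goursatIntegral_snd ck ξ η)).congr_of_eventuallyEq
      (Eventually.of_forall fun z => hG ξ z)
  have cP : Continuous fun p : ℝ × ℝ => P p.1 p.2 :=
    (cα.continuous.comp continuous_fst).neg.add (continuous_primitive_of_uncurry ck)
  have cQ : Continuous fun p : ℝ × ℝ => Q p.1 p.2 := by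
    have e : ∀ x y : ℝ, ∫ τ in y..x, k τ y
        = (∫ τ in (0 : ℝ)..x, k τ y) - ∫ τ in (0 : ℝ)..y, k τ y := fun x y =>
      (intervalIntegral.integral_interval_sub_left
        ((continuous_curry_right ck y).intervalIntegrable 0 x)
        ((continuous_curry_right ck y).intervalIntegrable 0 y)).symm
    have c1 := continuous_primitive_of_uncurry ck
    have c2 := continuous_primitive_of_uncurry (h := fun y x => k x y) (ck.comp continuous_swap)
    simp only [Q]
    simp_rw [e]
    exact (cα.continuous.comp continuous_snd).add
      (((c2.comp (continuous_snd.prodMk continuous_fst)).sub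
        (c2.comp (continuous_snd.prodMk continuous_snd))).sub
        (c1.comp (continuous_snd.prodMk continuous_snd)))
  -- Bootstrap: continuous first derivatives make `G`, hence `k = mG`, of class `C¹`; the formulas
  -- for `P` and `Q` are then `C¹`, and so `G` is `C²`.
  have cG1 : ContDiff ℝ 1 fun p : ℝ × ℝ => G p.1 p.2 :=
    contDiff_succ_of_partials (n := 0) hGP hGQ (contDiff_zero.2 cP) (contDiff_zero.2 cQ)
  have ck1 : ContDiff ℝ 1 fun p : ℝ × ℝ => k p.1 p.2 := cm.mul cG1
  have cP1 : ContDiff ℝ 1 fun p : ℝ × ℝ => P p.1 p.2 :=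
    (cα.comp contDiff_fst).neg.add (contDiff_one_primitive ck1)
  have cQ1 : ContDiff ℝ 1 fun p : ℝ × ℝ => Q p.1 p.2 :=
    (cα.comp contDiff_snd).add (contDiff_goursat_partials ck1)
  refine ⟨G, P, Q, contDiff_succ_of_partials (n := 1) hGP hGQ cP1 cQ1, cP1, cQ1, hGP, hGQ,
    fun ξ η => ?_, fun ξ η => ?_, fun ξ => ?_, fun ξ => ?_⟩
  · exact (hasDerivAt_integral_upper (continuous_curry_left ck ξ) 0 η).const_add _
  · exact ((hasDerivAt_integral_upper (continuous_curry_right ck η) η ξ).sub_const _).const_add _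
  · rw [hG]; simp [goursatIntegral]
  · rw [hG]; simp [goursatIntegral]

/-- In the characteristic coordinates `ξ = 2 - x - y`, `η = x - y` one has `Φ_xx - Φ_yy = -4 G_ξη`.
The side `x = 1` becomes `ξ = η`, the diagonal becomes `η = 0`, and `x = 1 - (ξ - η)/2`. This
explains both the factor `1/4` and the argument of `α`. -/
theorem exists_observerKernel {ε : ℝ} {lam : ℝ → ℝ} (hlam : ContDiffOn ℝ 1 lam (Icc 0 1)) (c : ℝ) :
    ∃ Φ, IsObserverKernel ε lam c Φ := by
  obtain ⟨a, ca, ha⟩ := exists_contDiff_extension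
    (f := fun x => (lam x + c) / ε) ((hlam.add contDiffOn_const).div_const ε)
  set α : ℝ → ℝ := fun τ => a (1 - τ / 2) / 4 with hα
  have cα : ContDiff ℝ 1 α := by
    refine ContDiff.div_const (ca.comp ?_) _
    fun_prop
  -- On the triangle `ξ` and `η` lie in `[0,2]`, where the cutoff equals one, so truncating the
  -- coefficient does not change the equation there.
  let χ : ContDiffBump (0 : ℝ) := ⟨2, 3, by norm_num, by norm_num⟩
  have χ1 : ∀ x ∈ Icc (0 : ℝ) 2, χ x = 1 := fun x hx => χ.one_of_mem_closedBall (by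
    rw [Metric.mem_closedBall, Real.dist_eq, sub_zero, abs_of_nonneg hx.1]; exact hx.2)
  have χ0 : ∀ x, 3 < |x| → χ x = 0 := fun x hx => χ.zero_of_le_dist (by
    rw [Real.dist_eq, sub_zero]; exact hx.le)
  have cχ : ContDiff ℝ 1 χ := χ.contDiff
  obtain ⟨G, P, Q, cG, cP, cQ, hGP, hGQ, hPη, hQξ, hdiag, h0⟩ := exists_goursat_contDiff
    (m := fun τ s => α (τ - s) * (χ τ * χ s)) (α := α) (R := 3) (by norm_num)
    ((cα.comp (contDiff_fst.sub contDiff_snd)).mul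
      ((cχ.comp contDiff_fst).mul (cχ.comp contDiff_snd))) cα
    (fun τ s h => by rcases h with h | h <;> simp [χ0 _ h])
  refine ⟨fun x y => G (2 - x - y) (x - y), ?_, ?_, ?_, ?_⟩
  · exact (cG.comp (f := fun p : ℝ × ℝ => (2 - p.1 - p.2, p.1 - p.2)) (by fun_prop)).contDiffOn
  · intro x y hy hyx hx
    have chain : ∀ {F A B : ℝ → ℝ → ℝ}, Differentiable ℝ (fun p : ℝ × ℝ => F p.1 p.2) →
        (∀ ξ η, HasDerivAt (fun z => F z η) (A ξ η) ξ) →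
        (∀ ξ η, HasDerivAt (fun z => F ξ z) (B ξ η) η) → ∀ x y,
        HasDerivAt (fun z => F (2 - z - y) (z - y)) (-A (2 - x - y) (x - y)
          + B (2 - x - y) (x - y)) x ∧
        HasDerivAt (fun z => F (2 - x - z) (x - z)) (-A (2 - x - y) (x - y)
          - B (2 - x - y) (x - y)) y := by
      intro F A B dF hA hB x y
      set p : ℝ × ℝ := (2 - x - y, x - y)
      have dp := (dF p).hasFDerivAt
      have e1 := (hasDerivAt_fst_of_differentiableAt (dF p)).unique (hA _ _)
      have e2 := (hasDerivAt_snd_of_differentiableAt (dF p)).unique (hB _ _)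
      set L := fderiv ℝ (fun p : ℝ × ℝ => F p.1 p.2) p
      have eL : ∀ u v : ℝ, L (u, v) = u * A (2 - x - y) (x - y) + v * B (2 - x - y) (x - y) := by
        intro u v
        have : ((u, v) : ℝ × ℝ) = u • ((1, 0) : ℝ × ℝ) + v • ((0, 1) : ℝ × ℝ) := by simp
        rw [this, map_add, map_smul, map_smul, e1, e2]; simp
      have d1 : HasDerivAt (fun z : ℝ => (2 - z - y, z - y)) (-1, 1) x :=
        (((hasDerivAt_id' x).const_sub 2).sub_const y).prodMk ((hasDerivAt_id' x).sub_const y)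
      have d2 : HasDerivAt (fun z : ℝ => (2 - x - z, x - z)) (-1, -1) y :=
        ((hasDerivAt_id' y).const_sub (2 - x)).prodMk ((hasDerivAt_id' y).const_sub x)
      refine ⟨(HasFDerivAt.comp_hasDerivAt (f := fun z : ℝ => (2 - z - y, z - y)) x dp d1).congr_deriv
        ?_, (HasFDerivAt.comp_hasDerivAt (f := fun z : ℝ => (2 - x - z, x - z)) y dp d2).congr_deriv
        ?_⟩
      · rw [eL]; ring
      · rw [eL]; ring
    have dP := cP.differentiable one_ne_zero
    have dQ := cQ.differentiable one_ne_zero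
    have dG := cG.differentiable two_ne_zero
    have hPξ : ∀ ξ η, HasDerivAt (fun z => P z η) _ ξ := fun ξ η =>
      hasDerivAt_fst_of_differentiableAt (dP (ξ, η))
    have hQη : ∀ ξ η, HasDerivAt (fun z => Q ξ z) _ η := fun ξ η =>
      hasDerivAt_snd_of_differentiableAt (dQ (ξ, η))
    have e1 : (fun z => deriv (fun z' => G (2 - z' - y) (z' - y)) z)
        = fun z => -P (2 - z - y) (z - y) + Q (2 - z - y) (z - y) :=
      funext fun z => (chain dG hGP hGQ z y).1.deriv
    have e2 : (fun z => deriv (fun z' => G (2 - x - z') (x - z')) z)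
        = fun z => -P (2 - x - z) (x - z) - Q (2 - x - z) (x - z) :=
      funext fun z => (chain dG hGP hGQ x z).2.deriv
    rw [e1, e2]
    have cPx := chain dP (A := fun ξ η => fderiv ℝ (fun p : ℝ × ℝ => P p.1 p.2) (ξ, η) (1, 0))
      hPξ hPη x y
    have cQx := chain dQ (B := fun ξ η => fderiv ℝ (fun p : ℝ × ℝ => Q p.1 p.2) (ξ, η) (0, 1))
      hQξ hQη x y
    have e3 : HasDerivAt (fun z => -P (2 - z - y) (z - y) + Q (2 - z - y) (z - y)) _ x :=
      cPx.1.neg.add cQx.1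
    have e4 : HasDerivAt (fun z => -P (2 - x - z) (x - z) - Q (2 - x - z) (x - z)) _ y :=
      cPx.2.neg.sub cQx.2
    rw [e3.deriv, e4.deriv]
    have hax : a x = (lam x + c) / ε := ha ⟨by linarith, by linarith⟩
    have m1 : α (2 - x - y - (x - y)) = a x / 4 := by
      simp only [hα]; congr 2; ring
    rw [m1, χ1 (2 - x - y) ⟨by linarith, by linarith⟩, χ1 (x - y) ⟨by linarith, by linarith⟩, hax]
    ring
  · intro y hy
    have := hdiag (1 - y)
    rw [show (2 - 1 - y : ℝ) = 1 - y by ring, this]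
  · intro x hx
    simp only [sub_self]
    rw [show 2 - x - x = 2 - 2 * x by ring, h0]
    congr 1
    have e1 : ∫ z in x..1, (lam z + c) / (2 * ε) = ∫ z in x..1, a z / 2 := by
      refine intervalIntegral.integral_congr fun z hz => ?_
      rw [uIcc_of_le hx.2] at hz
      rw [ha ⟨hx.1.trans hz.1, hz.2⟩, div_div, mul_comm]
    -- The substitution `z = 1 - τ/2` turns `∫_0^{2-2x} α` into `∫_x^1 a/2`.
    have e2 := intervalIntegral.integral_comp_sub_div (a := 0) (b := 2 - 2 * x) a
      (two_ne_zero (α := ℝ)) 1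
    rw [e1, intervalIntegral.integral_div, intervalIntegral.integral_div, e2]
    rw [show (1 - (2 - 2 * x) / 2 : ℝ) = x by ring, show (1 - 0 / 2 : ℝ) = 1 by ring]
    simp only [smul_eq_mul]; ring

/-! ### One-sided calculus on the triangle -/

theorem convex_triangle : Convex ℝ triangle := by
  have e : triangle = {p : ℝ × ℝ | 0 ≤ p.2} ∩ ({p : ℝ × ℝ | p.2 - p.1 ≤ 0} ∩ {p : ℝ × ℝ | p.1 ≤ 1}) := by
    ext p; simp [triangle]
  rw [e]
  exact (convex_halfSpace_ge (LinearMap.snd ℝ ℝ ℝ).isLinear 0).inter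
    ((convex_halfSpace_le ((LinearMap.snd ℝ ℝ ℝ) - (LinearMap.fst ℝ ℝ ℝ)).isLinear 0).inter
      (convex_halfSpace_le (LinearMap.fst ℝ ℝ ℝ).isLinear 1))

theorem triangle_mem_nhds {x y : ℝ} (hy : 0 < y) (hyx : y < x) (hx : x < 1) :
    triangle ∈ 𝓝 (x, y) := by
  have : {p : ℝ × ℝ | 0 < p.2 ∧ p.2 < p.1 ∧ p.1 < 1} ∈ 𝓝 (x, y) := by
    refine IsOpen.mem_nhds ?_ ⟨hy, hyx, hx⟩
    exact (isOpen_lt continuous_const continuous_snd).inter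
      ((isOpen_lt continuous_snd continuous_fst).inter (isOpen_lt continuous_fst continuous_const))
  exact mem_of_superset this fun p hp => ⟨hp.1.le, hp.2.1.le, hp.2.2.le⟩

theorem uniqueDiffOn_triangle : UniqueDiffOn ℝ triangle :=
  uniqueDiffOn_convex convex_triangle ⟨(2 / 3, 1 / 3), mem_interior_iff_mem_nhds.2
    (triangle_mem_nhds (by norm_num) (by norm_num) (by norm_num))⟩

/-- The two one-sided partial derivatives on the triangle. -/
noncomputable def triFst (F : ℝ × ℝ → ℝ) (p : ℝ × ℝ) : ℝ := fderivWithin ℝ F triangle p (1, 0)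

noncomputable def triSnd (F : ℝ × ℝ → ℝ) (p : ℝ × ℝ) : ℝ := fderivWithin ℝ F triangle p (0, 1)

theorem contDiffOn_triFst {F : ℝ × ℝ → ℝ} {n : ℕ} (hF : ContDiffOn ℝ (n + 1) F triangle) :
    ContDiffOn ℝ n (triFst F) triangle :=
  (hF.fderivWithin uniqueDiffOn_triangle le_rfl).clm_apply contDiffOn_const

theorem contDiffOn_triSnd {F : ℝ × ℝ → ℝ} {n : ℕ} (hF : ContDiffOn ℝ (n + 1) F triangle) :
    ContDiffOn ℝ n (triSnd F) triangle :=
  (hF.fderivWithin uniqueDiffOn_triangle le_rfl).clm_apply contDiffOn_const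

theorem hasDerivWithinAt_triFst {F : ℝ × ℝ → ℝ} (hF : DifferentiableOn ℝ F triangle) {x y : ℝ}
    (h : (x, y) ∈ triangle) :
    HasDerivWithinAt (fun z => F (z, y)) (triFst F (x, y)) (Icc y 1) x :=
  HasFDerivWithinAt.comp_hasDerivWithinAt (f := fun z : ℝ => (z, y)) x
    (hF _ h).hasFDerivWithinAt
    ((hasDerivAt_id' x).prodMk (hasDerivAt_const x y)).hasDerivWithinAt
    fun _ hz => ⟨h.1, hz.1, hz.2⟩

theorem hasDerivWithinAt_triSnd {F : ℝ × ℝ → ℝ} (hF : DifferentiableOn ℝ F triangle) {x y : ℝ}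
    (h : (x, y) ∈ triangle) :
    HasDerivWithinAt (fun z => F (x, z)) (triSnd F (x, y)) (Icc 0 x) y :=
  HasFDerivWithinAt.comp_hasDerivWithinAt (f := fun z : ℝ => (x, z)) y
    (hF _ h).hasFDerivWithinAt
    ((hasDerivAt_const y x).prodMk (hasDerivAt_id' y)).hasDerivWithinAt
    fun _ hz => ⟨hz.1, hz.2, h.2.2⟩

theorem hasDerivAt_diag_triangle {F : ℝ × ℝ → ℝ} (hF : DifferentiableOn ℝ F triangle) {x : ℝ}
    (h : x ∈ Ioo (0 : ℝ) 1) :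
    HasDerivAt (fun z => F (z, z)) (triFst F (x, x) + triSnd F (x, x)) x := by
  have hx : (x, x) ∈ triangle := ⟨h.1.le, le_rfl, h.2.le⟩
  have := HasFDerivWithinAt.comp_hasDerivWithinAt (f := fun z : ℝ => (z, z)) (s := Icc 0 1) x
    (hF _ hx).hasFDerivWithinAt
    ((hasDerivAt_id' x).prodMk (hasDerivAt_id' x)).hasDerivWithinAt
    fun z hz => (⟨hz.1, le_rfl, hz.2⟩ : (z, z) ∈ triangle)
  refine (this.hasDerivAt (Icc_mem_nhds h.1 h.2)).congr_deriv ?_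
  rw [triFst, triSnd, ← map_add]; simp

/-- A function on the triangle with a continuous one-sided derivative in the second variable
extends to the plane with a continuous derivative in that variable. -/
theorem exists_extension_snd {F : ℝ × ℝ → ℝ} {D : ℝ → ℝ → ℝ} (hF : DifferentiableOn ℝ F triangle)
    (cD : Continuous fun p : ℝ × ℝ => D p.1 p.2) (hD : ∀ p ∈ triangle, D p.1 p.2 = triSnd F p) :
    ∃ E : ℝ → ℝ → ℝ, (Continuous fun p : ℝ × ℝ => E p.1 p.2) ∧
      (∀ p ∈ triangle, E p.1 p.2 = F p) ∧ ∀ x y, HasDerivAt (fun z => E x z) (D x y) y := by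
  have cF := continuous_comp_triangleRetract hF.continuousOn
  set f : ℝ → ℝ := fun x => (F ∘ triangleRetract) (x, x)
  have cf : Continuous f := cF.comp (continuous_id.prodMk continuous_id)
  have hf : ∀ x ∈ Icc (0 : ℝ) 1, f x = F (x, x) := fun x hx => by
    simp only [f, Function.comp]
    rw [triangleRetract_of_mem ⟨hx.1, le_rfl, hx.2⟩]
  have cI : Continuous fun p : ℝ × ℝ => ∫ z in p.1..p.2, D p.1 z := by
    have e : ∀ x y : ℝ, ∫ z in x..y, D x z = (∫ z in (0 : ℝ)..y, D x z) - ∫ z in (0 : ℝ)..x, D x z :=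
      fun x y => (intervalIntegral.integral_interval_sub_left
        ((continuous_curry_left cD x).intervalIntegrable 0 y)
        ((continuous_curry_left cD x).intervalIntegrable 0 x)).symm
    have c := continuous_primitive_of_uncurry cD
    exact (c.sub (c.comp (continuous_fst.prodMk continuous_fst))).congr fun p => (e p.1 p.2).symm
  -- The extension integrates the given derivative away from the diagonal, a part of the triangle
  -- that every vertical section over `[0,1]` meets.
  refine ⟨fun x y => f x + ∫ z in x..y, D x z, (cf.comp continuous_fst).add cI, ?_, fun x y =>
    (hasDerivAt_integral_upper (continuous_curry_left cD x) x y).const_add _⟩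
  rintro ⟨x, y⟩ ⟨h1, h2, h3⟩
  simp only at h1 h2 h3 ⊢
  have hsub : Icc y x ⊆ Icc 0 x := Icc_subset_Icc_left h1
  have hI : ∫ z in y..x, D x z = F (x, x) - F (x, y) := by
    refine intervalIntegral.integral_eq_sub_of_hasDerivAt_of_le (f := fun z => F (x, z)) h2 ?_ ?_
      ((continuous_curry_left cD x).intervalIntegrable _ _)
    · intro z hz
      exact ((hasDerivWithinAt_triSnd hF (x := x) (y := z) ⟨h1.trans hz.1, hz.2, h3⟩).mono
        hsub).continuousWithinAt
    · intro z hz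
      have hzT : (x, z) ∈ triangle := ⟨h1.trans hz.1.le, hz.2.le, h3⟩
      rw [show D x z = triSnd F (x, z) from hD _ hzT]
      exact (hasDerivWithinAt_triSnd hF hzT).hasDerivAt (Icc_mem_nhds (h1.trans_lt hz.1) hz.2)
  rw [intervalIntegral.integral_symm, hI, hf x ⟨h1.trans h2, h3⟩]
  ring

theorem hasDerivAt_integral_lower {h h' : ℝ → ℝ → ℝ}
    (hd : ∀ x s, HasDerivAt (fun z => h z s) (h' x s) x)
    (ch : Continuous fun p : ℝ × ℝ => h p.1 p.2) (ch' : Continuous fun p : ℝ × ℝ => h' p.1 p.2)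
    (x : ℝ) :
    HasDerivAt (fun z => ∫ s in z..1, h z s) (-h x x + ∫ s in x..1, h' x s) x := by
  have e : ∀ {h : ℝ → ℝ → ℝ}, (Continuous fun p : ℝ × ℝ => h p.1 p.2) → ∀ z : ℝ,
      ∫ s in z..1, h z s = (∫ s in (0 : ℝ)..1, h z s) - ∫ s in (0 : ℝ)..z, h z s := fun ch z =>
    (intervalIntegral.integral_interval_sub_left
      ((continuous_curry_left ch z).intervalIntegrable 0 1)
      ((continuous_curry_left ch z).intervalIntegrable 0 z)).symm
  refine (((hasDerivAt_param_integral hd ch ch' 0 1 x).sub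
    (hasDerivAt_diag_integral hd ch ch' x)).congr_of_eventuallyEq
    (Eventually.of_forall (e ch))).congr_deriv ?_
  rw [e ch']; ring

theorem continuous_integral_lower {h : ℝ → ℝ → ℝ} (ch : Continuous fun p : ℝ × ℝ => h p.1 p.2) :
    Continuous fun z => ∫ s in z..1, h z s := by
  have c := continuous_primitive_of_uncurry ch
  refine ((c.comp (continuous_id.prodMk (continuous_const (y := (1 : ℝ))))).sub
    (c.comp (continuous_id.prodMk continuous_id))).congr fun z => ?_
  exact intervalIntegral.integral_interval_sub_left
      ((continuous_curry_left ch z).intervalIntegrable 0 1)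
      ((continuous_curry_left ch z).intervalIntegrable 0 z)

/-- The reflection `x ↦ 1 - x` reduces this to the forward equation. -/
theorem exists_backward_volterra_solution {k : ℝ → ℝ → ℝ}
    (ck : Continuous fun p : ℝ × ℝ => k p.1 p.2) {g : ℝ → ℝ} (cg : Continuous g) :
    ∃ f : ℝ → ℝ, Continuous f ∧
      ∀ x ∈ Icc (0 : ℝ) 1, f x = g x + ∫ y in x..1, k x y * f y := by
  obtain ⟨f, cf, hf⟩ := exists_volterra_solution (k := fun X Y => k (1 - X) (1 - Y))
    (ck.comp (by fun_prop : Continuous fun p : ℝ × ℝ => (1 - p.1, 1 - p.2)))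
    (g := fun X => g (1 - X)) (cg.comp (by fun_prop)).continuousOn
  refine ⟨fun x => f (1 - x), cf.comp (by fun_prop), fun x hx => ?_⟩
  simp only
  rw [hf (1 - x) ⟨by linarith [hx.2], by linarith [hx.1]⟩]
  have := intervalIntegral.integral_comp_sub_left (a := x) (b := 1)
    (fun Y => k x (1 - Y) * f Y) 1
  simp only [sub_sub_cancel, sub_self] at this ⊢
  rw [this]

/-- After the reflection, the `L²` Gronwall estimate with zero data gives `∫ f² = 0`; the Volterra
bound then upgrades this to vanishing at every point. -/
theorem eq_zero_of_backward_volterra {k : ℝ → ℝ → ℝ}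
    (ck : Continuous fun p : ℝ × ℝ => k p.1 p.2) {f : ℝ → ℝ} (cf : Continuous f)
    (h : ∀ x ∈ Icc (0 : ℝ) 1, f x = ∫ y in x..1, k x y * f y) : ∀ x ∈ Icc (0 : ℝ) 1, f x = 0 := by
  obtain ⟨M, hM⟩ := (isCompact_Icc.prod (isCompact_Icc (a := (0 : ℝ)) (b := 1))
    |>.exists_bound_of_continuousOn (s := Icc (0 : ℝ) 1 ×ˢ Icc (0 : ℝ) 1) ck.continuousOn)
  set F : ℝ → ℝ := fun X => f (1 - X)
  have cF : Continuous F := cf.comp (by fun_prop)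
  have hF : ∀ X ∈ Icc (0 : ℝ) 1, |F X| ≤ M * ∫ y in (0 : ℝ)..X, |F y| := by
    intro X hX
    have hx : 1 - X ∈ Icc (0 : ℝ) 1 := ⟨by linarith [hX.2], by linarith [hX.1]⟩
    have e := intervalIntegral.integral_comp_sub_left (a := 1 - X) (b := 1) (fun y => |F y|) 1
    simp only [F, sub_sub_cancel, sub_self] at e
    simp only [F]
    rw [← e, h _ hx, ← intervalIntegral.integral_const_mul]
    refine (intervalIntegral.abs_integral_le_integral_abs hx.2).trans ?_
    refine intervalIntegral.integral_mono_on hx.2 ?_ ?_ fun y hy => ?_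
    · exact (((continuous_curry_left ck _).mul cf).abs).intervalIntegrable _ _
    · exact (cf.abs.const_mul M).intervalIntegrable _ _
    · rw [abs_mul]
      exact mul_le_mul_of_nonneg_right (hM (1 - X, y) ⟨hx, hx.1.trans hy.1, hy.2⟩) (abs_nonneg _)
  have h0 := integral_sq_le_of_volterra (g := fun _ => 0) cF continuous_const (M := M)
    (fun x hx => by simpa using! hF x hx)
  simp only [ne_eq, OfNat.ofNat_ne_zero, not_false_eq_true, zero_pow,
    intervalIntegral.integral_zero, mul_zero] at h0
  intro x hx
  have hX : 1 - x ∈ Icc (0 : ℝ) 1 := ⟨by linarith [hx.2], by linarith [hx.1]⟩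
  have h1 := hF _ hX
  have h2 := sq_integral_abs_le cF hX
  have h3 : ∫ y in (0 : ℝ)..(1 - x), F y ^ 2 ≤ ∫ y in (0 : ℝ)..1, F y ^ 2 :=
    intervalIntegral.integral_mono_interval le_rfl hX.1 hX.2
      (Eventually.of_forall fun y => sq_nonneg _) ((cF.pow 2).intervalIntegrable _ _)
  have h4 : ∫ y in (0 : ℝ)..(1 - x), |F y| = 0 := by
    apply pow_eq_zero_iff two_ne_zero |>.1
    exact le_antisymm (h2.trans (h3.trans h0)) (sq_nonneg _)
  rw [h4, mul_zero] at h1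
  have := abs_nonpos_iff.1 h1
  simpa [F] using this

/-! ### Adjoint eigenfunctions -/

section Kernel
variable {ε c : ℝ} {lam : ℝ → ℝ} {Φ : ℝ → ℝ → ℝ}

theorem IsObserverKernel.differentiableOn (hΦ : IsObserverKernel ε lam c Φ) :
    DifferentiableOn ℝ (fun p : ℝ × ℝ => Φ p.1 p.2) triangle :=
  hΦ.regular.differentiableOn two_ne_zero

theorem IsObserverKernel.contDiffOn_fst (hΦ : IsObserverKernel ε lam c Φ) :
    ContDiffOn ℝ 1 (triFst fun p : ℝ × ℝ => Φ p.1 p.2) triangle :=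
  contDiffOn_triFst (n := 1) hΦ.regular

theorem IsObserverKernel.contDiffOn_snd (hΦ : IsObserverKernel ε lam c Φ) :
    ContDiffOn ℝ 1 (triSnd fun p : ℝ × ℝ => Φ p.1 p.2) triangle :=
  contDiffOn_triSnd (n := 1) hΦ.regular

/-- The iterated ordinary derivatives of the kernel equation agree in the interior with the
one-sided ones, which stay continuous up to the boundary of the triangle and can therefore be
integrated. -/
theorem IsObserverKernel.wave (hΦ : IsObserverKernel ε lam c Φ) {x y : ℝ} (hy : 0 < y)
    (hyx : y < x) (hx : x < 1) :
    triFst (triFst fun p : ℝ × ℝ => Φ p.1 p.2) (x, y)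
      - triSnd (triSnd fun p : ℝ × ℝ => Φ p.1 p.2) (x, y) = -((lam x + c) / ε) * Φ x y := by
  have h := hΦ.pde x y hy hyx hx
  have e1 : (fun z => deriv (fun z' => Φ z' y) z) =ᶠ[𝓝 x]
      fun z => triFst (fun p : ℝ × ℝ => Φ p.1 p.2) (z, y) := by
    filter_upwards [Ioo_mem_nhds hyx hx] with z hz
    exact ((hasDerivWithinAt_triFst hΦ.differentiableOn
      ⟨hy.le, hz.1.le, hz.2.le⟩).hasDerivAt (Icc_mem_nhds hz.1 hz.2)).deriv
  have e2 : (fun z => deriv (fun z' => Φ x z') z) =ᶠ[𝓝 y]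
      fun z => triSnd (fun p : ℝ × ℝ => Φ p.1 p.2) (x, z) := by
    filter_upwards [Ioo_mem_nhds hy hyx] with z hz
    exact ((hasDerivWithinAt_triSnd hΦ.differentiableOn
      ⟨hz.1.le, hz.2.le, hx.le⟩).hasDerivAt (Icc_mem_nhds hz.1 hz.2)).deriv
  have hT : (x, y) ∈ triangle := ⟨hy.le, hyx.le, hx.le⟩
  rw [e1.deriv_eq, e2.deriv_eq, ((hasDerivWithinAt_triFst
      (hΦ.contDiffOn_fst.differentiableOn one_ne_zero) hT).hasDerivAt (Icc_mem_nhds hyx hx)).deriv,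
    ((hasDerivWithinAt_triSnd (hΦ.contDiffOn_snd.differentiableOn one_ne_zero) hT).hasDerivAt
      (Icc_mem_nhds hy hyx)).deriv] at h
  exact h

theorem IsObserverKernel.hasDerivAt_diag (hΦ : IsObserverKernel ε lam c Φ)
    (hlam : ContinuousOn lam (Icc 0 1)) {x : ℝ} (hx : x ∈ Ioo (0 : ℝ) 1) :
    HasDerivAt (fun z => Φ z z) ((lam x + c) / (2 * ε)) x := by
  have cl : ContinuousOn (fun z => (lam z + c) / (2 * ε)) (Icc 0 1) :=
    (hlam.add continuousOn_const).div_const _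
  have h := intervalIntegral.integral_hasDerivAt_left (a := x) (b := 1)
    (f := fun z => (lam z + c) / (2 * ε))
    ((cl.mono (by rw [uIcc_of_le hx.2.le]; exact Icc_subset_Icc_left hx.1.le)).intervalIntegrable)
    ((cl.mono Ioo_subset_Icc_self).stronglyMeasurableAtFilter isOpen_Ioo x hx)
    (cl.continuousAt (Icc_mem_nhds hx.1 hx.2))
  have h2 := h.neg
  rw [neg_neg] at h2
  refine h2.congr_of_eventuallyEq ?_
  filter_upwards [Ioo_mem_nhds hx.1 hx.2] with z hz
  exact hΦ.diag z ⟨hz.1.le, hz.2.le⟩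

/-- Integration by parts twice against the kernel in its first variable. -/
theorem IsObserverKernel.integral_parts (hΦ : IsObserverKernel ε lam c Φ) {p p' p'' : ℝ → ℝ}
    (cp : Continuous p) (cp' : Continuous p') (cp'' : Continuous p'')
    (hp : ∀ x ∈ Ioo (0 : ℝ) 1, HasDerivAt p (p' x) x)
    (hp' : ∀ x ∈ Ioo (0 : ℝ) 1, HasDerivAt p' (p'' x) x) (p1 : p 1 = 0) {x : ℝ}
    (hx : x ∈ Ioo (0 : ℝ) 1) :
    ∫ y in x..1, (Φ y x * p'' y - triFst (triFst fun p : ℝ × ℝ => Φ p.1 p.2) (y, x) * p y)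
      = triFst (fun p : ℝ × ℝ => Φ p.1 p.2) (x, x) * p x - Φ x x * p' x := by
  set F : ℝ × ℝ → ℝ := fun p => Φ p.1 p.2
  have mT : ∀ y ∈ Icc x 1, (y, x) ∈ triangle := fun y hy => ⟨hx.1.le, hy.1, hy.2⟩
  have cpair : ContinuousOn (fun y : ℝ => (y, x)) (Icc x 1) := by fun_prop
  have cF : ContinuousOn (fun y => F (y, x)) (Icc x 1) :=
    hΦ.regular.continuousOn.comp cpair mT
  have cF1 : ContinuousOn (fun y => triFst F (y, x)) (Icc x 1) :=
    hΦ.contDiffOn_fst.continuousOn.comp cpair mT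
  have cF11 : ContinuousOn (fun y => triFst (triFst F) (y, x)) (Icc x 1) :=
    (contDiffOn_triFst (n := 0) hΦ.contDiffOn_fst).continuousOn.comp cpair mT
  have key := intervalIntegral.integral_eq_sub_of_hasDerivAt_of_le hx.2.le
    (f := fun y => F (y, x) * p' y - triFst F (y, x) * p y)
    (f' := fun y => F (y, x) * p'' y - triFst (triFst F) (y, x) * p y)
    ((cF.mul cp'.continuousOn).sub (cF1.mul cp.continuousOn)) (fun y hy => by
      have hy01 : y ∈ Ioo (0 : ℝ) 1 := ⟨hx.1.trans hy.1, hy.2⟩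
      have yT := mT y ⟨hy.1.le, hy.2.le⟩
      have d1 := (hasDerivWithinAt_triFst hΦ.differentiableOn yT).hasDerivAt
        (Icc_mem_nhds hy.1 hy.2)
      have d2 := (hasDerivWithinAt_triFst (hΦ.contDiffOn_fst.differentiableOn one_ne_zero)
        yT).hasDerivAt (Icc_mem_nhds hy.1 hy.2)
      refine ((d1.mul (hp' y hy01)).sub (d2.mul (hp y hy01))).congr_deriv ?_
      ring)
    (((cF.mul cp''.continuousOn).sub (cF11.mul cp.continuousOn)).intervalIntegrable_of_Icc hx.2.le)
  have e1 : F (1, x) = 0 := hΦ.side x ⟨hx.1.le, hx.2.le⟩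
  rw [e1, p1] at key
  rw [key]; simp only [F]; ring

/-- The adjoint backstepping transformation intertwines `ε∂² + λ` with `ε∂² - c`. Concretely, the
residual `r = ε p'' + (λ + c + εκ) p` satisfies `r(x) = ∫_x^1 Φ(y,x) r(y) dy`: two integrations by
parts and the wave equation leave only diagonal terms, which the prescribed values of `Φ(x,x)`
cancel. Uniqueness for Volterra equations forces `r = 0`. The conditions at `0` and `1` are the
transformation evaluated there. -/
theorem exists_adjoint_eigenfunction (hε : 0 < ε) (hlam : ContinuousOn lam (Icc 0 1))
    (hΦ : IsObserverKernel ε lam c Φ) {s s' : ℝ → ℝ} {κ : ℝ}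
    (hs : ∀ x, HasDerivAt s (s' x) x) (hs' : ∀ x, HasDerivAt s' (-κ * s x) x)
    (s0 : s 0 = 0) (s1 : s 1 = 0) :
    ∃ p p' p'' : ℝ → ℝ, Continuous p ∧ Continuous p' ∧ Continuous p'' ∧
      (∀ x ∈ Ioo (0 : ℝ) 1, HasDerivAt p (p' x) x) ∧
      (∀ x ∈ Ioo (0 : ℝ) 1, HasDerivAt p' (p'' x) x) ∧
      (∀ x ∈ Ioo (0 : ℝ) 1, ε * p'' x + lam x * p x = -(c + ε * κ) * p x) ∧
      p 1 = 0 ∧ p 0 = ∫ y in (0 : ℝ)..1, Φ y 0 * p y ∧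
      ∀ x ∈ Icc (0 : ℝ) 1, s x = p x - ∫ y in x..1, Φ y x * p y := by
  set F : ℝ × ℝ → ℝ := fun p => Φ p.1 p.2
  obtain ⟨lamE, clamE, hlamE⟩ : ∃ l : ℝ → ℝ, Continuous l ∧ ∀ x ∈ Icc (0 : ℝ) 1, l x = lam x :=
    ⟨IccExtend zero_le_one ((Icc (0 : ℝ) 1).domRestrict lam),
      (continuousOn_iff_continuous_domRestrict.1 hlam).Icc_extend',
      fun x hx => by simp [IccExtend_of_mem, hx, Set.domRestrict]⟩
  have c22 : Continuous fun p : ℝ × ℝ => (triSnd (triSnd F) ∘ triangleRetract) (p.1, p.2) :=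
    continuous_comp_triangleRetract (contDiffOn_triSnd (n := 0) hΦ.contDiffOn_snd).continuousOn
  set D22 : ℝ → ℝ → ℝ := fun x y => (triSnd (triSnd F) ∘ triangleRetract) (x, y)
  have h22 : ∀ p ∈ triangle, D22 p.1 p.2 = triSnd (triSnd F) p := fun p hp => by
    simp [D22, triangleRetract_of_mem hp]
  -- The unknown is differentiated through the second slot of `Φ(y,x)`, so only that slot needs
  -- extension: `D22` is extended by retraction, then `D2` and `E` by integrating successively.
  obtain ⟨D2, cD2, h2, hD2⟩ := exists_extension_snd
    (hΦ.contDiffOn_snd.differentiableOn one_ne_zero) c22 h22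
  obtain ⟨E, cE, hE, hEd⟩ := exists_extension_snd hΦ.differentiableOn cD2 h2
  have csw : ∀ {h : ℝ → ℝ → ℝ}, (Continuous fun p : ℝ × ℝ => h p.1 p.2) →
      Continuous fun p : ℝ × ℝ => h p.2 p.1 := fun h => h.comp continuous_swap
  have cs : Continuous s := continuous_iff_continuousAt.2 fun x => (hs x).continuousAt
  have cs' : Continuous s' := continuous_iff_continuousAt.2 fun x => (hs' x).continuousAt
  obtain ⟨q, cq, hq⟩ := exists_backward_volterra_solution (k := fun x y => E y x) (csw cE) cs
  have cEq : Continuous fun p : ℝ × ℝ => E p.2 p.1 * q p.2 := (csw cE).mul (cq.comp continuous_snd)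
  have cD2q : Continuous fun p : ℝ × ℝ => D2 p.2 p.1 * q p.2 :=
    (csw cD2).mul (cq.comp continuous_snd)
  have cD22q : Continuous fun p : ℝ × ℝ => D22 p.2 p.1 * q p.2 :=
    (csw (h := D22) c22).mul (cq.comp continuous_snd)
  have cdiag : Continuous fun x => E x x := cE.comp (continuous_id.prodMk continuous_id)
  have cdiag2 : Continuous fun x => D2 x x := cD2.comp (continuous_id.prodMk continuous_id)
  -- The Volterra solution `q` is merely continuous; `p` equals it on `[0,1]` and is differentiable,
  -- being the right-hand side of its equation.
  set p : ℝ → ℝ := fun x => s x + ∫ y in x..1, E y x * q y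
  set p' : ℝ → ℝ := fun x => s' x + (-(E x x * q x) + ∫ y in x..1, D2 y x * q y)
  set p'' : ℝ → ℝ := fun x => -κ * s x + (-((lamE x + c) / (2 * ε) * p x + E x x * p' x)
    + (-(D2 x x * q x) + ∫ y in x..1, D22 y x * q y))
  have cp : Continuous p := cs.add (continuous_integral_lower (h := fun x y => E y x * q y) cEq)
  have cp' : Continuous p' := cs'.add (((cdiag.mul cq).neg).add
    (continuous_integral_lower (h := fun x y => D2 y x * q y) cD2q))
  have cp'' : Continuous p'' := (cs.const_mul _).add
    (((((clamE.add continuous_const).div_const _).mul cp).add (cdiag.mul cp')).neg.add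
      ((cdiag2.mul cq).neg.add (continuous_integral_lower (h := fun x y => D22 y x * q y) cD22q)))
  have hpq : ∀ x ∈ Icc (0 : ℝ) 1, p x = q x := fun x hx => (hq x hx).symm
  have hp : ∀ x, HasDerivAt p (p' x) x := fun x =>
    (hs x).add (hasDerivAt_integral_lower (h := fun x y => E y x * q y)
      (h' := fun x y => D2 y x * q y) (fun x y => (hEd y x).mul_const _) cEq cD2q x)
  have hEdiag : ∀ x ∈ Icc (0 : ℝ) 1, E x x = Φ x x := fun x hx => hE (x, x) ⟨hx.1, le_rfl, hx.2⟩
  have hp' : ∀ x ∈ Ioo (0 : ℝ) 1, HasDerivAt p' (p'' x) x := by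
    intro x hx
    have hx' := Ioo_subset_Icc_self hx
    have d1 : HasDerivAt (fun x => E x x * q x) ((lamE x + c) / (2 * ε) * p x + E x x * p' x) x := by
      have := (hΦ.hasDerivAt_diag hlam hx).mul (hp x)
      rw [hlamE x hx', hEdiag x hx']
      refine this.congr_of_eventuallyEq ?_
      filter_upwards [Ioo_mem_nhds hx.1 hx.2] with z hz
      have hz' := Ioo_subset_Icc_self hz
      simp only [Pi.mul_apply]
      rw [hpq z hz', hEdiag z hz']
    exact (hs' x).add (d1.neg.add (hasDerivAt_integral_lower (h := fun x y => D2 y x * q y)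
      (h' := fun x y => D22 y x * q y) (fun x y => (hD2 y x).mul_const _) cD2q cD22q x))
  have p1 : p 1 = 0 := by simp [p, s1]
  have hΦint : ∀ x ∈ Icc (0 : ℝ) 1, ∀ f g : ℝ → ℝ, (∀ y ∈ Icc x 1, f y = g y) →
      ∫ y in x..1, E y x * f y = ∫ y in x..1, Φ y x * g y := by
    intro x hx f g hfg
    refine intervalIntegral.integral_congr fun y hy => ?_
    rw [uIcc_of_le hx.2] at hy
    have := hE (y, x) ⟨hx.1, hy.1, hy.2⟩
    simp only at this ⊢
    rw [this, hfg y hy]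
  have hsp : ∀ x ∈ Icc (0 : ℝ) 1, s x = p x - ∫ y in x..1, Φ y x * p y := by
    intro x hx
    rw [← hΦint x hx q p fun y hy => (hpq y ⟨hx.1.trans hy.1, hy.2⟩).symm]
    simp [p]
  set μ := c + ε * κ
  set r : ℝ → ℝ := fun x => ε * p'' x + (lamE x + μ) * p x
  have cr : Continuous r := (cp''.const_mul _).add ((clamE.add continuous_const).mul cp)
  have hr : ∀ x ∈ Icc (0 : ℝ) 1, r x = ∫ y in x..1, E y x * r y := by
    have cEr : Continuous fun p : ℝ × ℝ => E p.2 p.1 * r p.2 :=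
      (csw cE).mul (cr.comp continuous_snd)
    have hopen : EqOn r (fun x => ∫ y in x..1, E y x * r y) (Ioo 0 1) := by
      intro x hx
      have hx' := Ioo_subset_Icc_self hx
      have parts := hΦ.integral_parts cp cp' cp'' (fun x _ => hp x) hp' p1 hx
      have diag : triFst F (x, x) + triSnd F (x, x) = (lam x + c) / (2 * ε) :=
        (hasDerivAt_diag_triangle hΦ.differentiableOn hx).unique (hΦ.hasDerivAt_diag hlam hx)
      have e2 : D2 x x = triSnd F (x, x) := h2 (x, x) ⟨hx.1.le, le_rfl, hx.2.le⟩
      have cΦp : IntervalIntegrable (fun y => E y x * p y) volume x 1 :=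
        ((continuous_curry_right cE x).mul cp).intervalIntegrable _ _
      have cD22p : IntervalIntegrable (fun y => D22 y x * q y) volume x 1 :=
        ((continuous_curry_right (h := D22) c22 x).mul cq).intervalIntegrable _ _
      -- The wave equation trades `(λ + c) Φ` for `ε (Φ_yy - Φ_xx)`: the `Φ_xx` part is integrated
      -- by parts, the `Φ_yy` part already occurs in `p''`, and `μ - c = εκ` remains.
      have e3 : ∫ y in x..1, E y x * r y
          = ε * (∫ y in x..1, (Φ y x * p'' y - triFst (triFst F) (y, x) * p y))
            + ε * (∫ y in x..1, D22 y x * q y) + (μ - c) * ∫ y in x..1, E y x * p y := by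
        have cT : IntervalIntegrable
            (fun y => Φ y x * p'' y - triFst (triFst F) (y, x) * p y) volume x 1 := by
          have mT : ∀ y ∈ Icc x 1, (y, x) ∈ triangle := fun y hy => ⟨hx.1.le, hy.1, hy.2⟩
          have cpair : ContinuousOn (fun y : ℝ => (y, x)) (Icc x 1) := by fun_prop
          refine ContinuousOn.intervalIntegrable_of_Icc hx.2.le ?_
          exact ((hΦ.regular.continuousOn.comp cpair mT).mul cp''.continuousOn).sub
            (((contDiffOn_triFst (n := 0) hΦ.contDiffOn_fst).continuousOn.comp cpair mT).mul
              cp.continuousOn)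
        rw [← intervalIntegral.integral_const_mul, ← intervalIntegral.integral_const_mul,
          ← intervalIntegral.integral_const_mul, ← intervalIntegral.integral_add
            (cT.const_mul ε) (cD22p.const_mul ε), ← intervalIntegral.integral_add
            ((cT.const_mul ε).add (cD22p.const_mul ε)) (cΦp.const_mul _)]
        refine intervalIntegral.integral_congr_Ioo_of_le hx.2.le fun y hy => ?_
        have hyT : (y, x) ∈ triangle := ⟨hx.1.le, hy.1.le, hy.2.le⟩
        have w := hΦ.wave hx.1 hy.1 hy.2
        have k1 := hE _ hyT
        have k2 := h22 _ hyT
        have hy01 : y ∈ Icc (0 : ℝ) 1 := ⟨hx.1.le.trans hy.1.le, hy.2.le⟩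
        simp only at k1
        simp only at k2
        simp only [r]
        rw [k1, k2, ← hpq y hy01, hlamE y hy01]
        have w2 : ε * triFst (triFst F) (y, x)
            = ε * triSnd (triSnd F) (y, x) - (lam y + c) * Φ y x := by
          rw [sub_eq_iff_eq_add] at w
          rw [w]; field_simp; ring
        linear_combination p y * w2
      have hsx : s x = p x - ∫ y in x..1, E y x * p y := by
        rw [hsp x hx', hΦint x hx' p p fun _ _ => rfl]
      have hEx := hEdiag x hx'
      have hqx := hpq x hx'
      simp only
      rw [e3, parts]
      have hp''x : p'' x = -κ * s x + (-((lamE x + c) / (2 * ε) * p x + E x x * p' x)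
        + (-(D2 x x * q x) + ∫ y in x..1, D22 y x * q y)) := rfl
      simp only [r]
      rw [hp''x, hsx, hEx, ← hqx, e2, hlamE x hx', eq_sub_of_add_eq diag]
      simp only [μ]
      field_simp
      ring
    -- The wave equation and the diagonal derivative are known only in the interior; continuity
    -- carries the identity to the end points.
    have := hopen.closure cr (continuous_integral_lower (h := fun x y => E y x * r y) cEr)
    rw [closure_Ioo zero_ne_one] at this
    exact this
  have hr0 := eq_zero_of_backward_volterra (k := fun x y => E y x) (csw cE) cr hr
  refine ⟨p, p', p'', cp, cp', cp'', fun x _ => hp x, hp', fun x hx => ?_, p1, ?_, hsp⟩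
  · have hx' := Ioo_subset_Icc_self hx
    have := hr0 x hx'
    simp only [r] at this
    rw [hlamE x hx'] at this
    linarith
  · have := hsp 0 (left_mem_Icc.2 zero_le_one)
    rw [s0] at this
    linarith

end Kernel

/-! ### The Parseval identity for sines -/

/-- The odd extension of `w` from the positive half-line. -/
noncomputable def oddExtension (w : ℝ → ℝ) (x : ℝ) : ℝ := if 0 < x then w x else -w (-x)

theorem memLp_oddExtension {w : ℝ → ℝ} (cw : Continuous w) :
    MemLp (fun x => (oddExtension w x : ℂ)) 2 (volume.restrict (Ioc (-1) 1)) := by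
  obtain ⟨M, hM⟩ := isCompact_Icc.exists_bound_of_continuousOn (s := Icc (-1 : ℝ) 1) cw.continuousOn
  refine MemLp.of_bound ?_ M ?_
  · have : Measurable (oddExtension w) :=
      Measurable.ite measurableSet_Ioi cw.measurable (cw.comp continuous_neg).neg.measurable
    exact (Complex.measurable_ofReal.comp this).aestronglyMeasurable
  · refine (ae_restrict_iff' measurableSet_Ioc).2 (Eventually.of_forall fun x hx => ?_)
    rw [Complex.norm_real, oddExtension]
    split_ifs
    · exact hM x ⟨hx.1.le, hx.2⟩
    · rw [norm_neg]; exact hM _ ⟨by linarith [hx.2], by linarith [hx.1]⟩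

theorem integral_neg_one_one {g : ℝ → ℂ} (h1 : IntervalIntegrable g volume (-1) 0)
    (h2 : IntervalIntegrable g volume 0 1) :
    ∫ x in (-1 : ℝ)..1, g x = (∫ x in (0 : ℝ)..1, g (-x)) + ∫ x in (0 : ℝ)..1, g x := by
  rw [← intervalIntegral.integral_add_adjacent_intervals h1 h2,
    intervalIntegral.integral_comp_neg g]
  simp

/-- On an interval of length `2` the characters are `exp(iπnx)`; folding `(-1,0)` onto `(0,1)` with
the odd sign leaves their sine part. -/
theorem fourierCoeffOn_oddExtension {w : ℝ → ℝ} (cw : Continuous w) (n : ℤ) :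
    fourierCoeffOn (show (-1 : ℝ) < 1 by norm_num) (fun x => (oddExtension w x : ℂ)) n
      = -Complex.I * ((∫ x in (0 : ℝ)..1, w x * Real.sin (n * Real.pi * x) : ℝ) : ℂ) := by
  rw [fourierCoeffOn_eq_integral]
  set e : ℝ → ℂ := fun x => Complex.exp (-(n * Real.pi * x) * Complex.I)
  have ce : Continuous e := by fun_prop
  have he : ∀ x : ℝ, fourier (-n) (x : AddCircle (1 - (-1 : ℝ))) = e x := fun x => by
    rw [fourier_coe_apply]
    simp only [e]
    congr 1
    push_cast
    ring
  simp_rw [he, smul_eq_mul]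
  have i1 : IntervalIntegrable (fun x => e x * (oddExtension w x : ℂ)) volume 0 1 := by
    have cw' : Continuous fun x => e x * (w x : ℂ) := by fun_prop
    refine (cw'.intervalIntegrable 0 1).congr_uIoo fun x hx => ?_
    rw [uIoo_of_le zero_le_one] at hx
    simp [oddExtension, hx.1]
  have i2 : IntervalIntegrable (fun x => e x * (oddExtension w x : ℂ)) volume (-1) 0 := by
    have cw' : Continuous fun x => e x * ((-w (-x) : ℝ) : ℂ) := by fun_prop
    refine (cw'.intervalIntegrable (-1) 0).congr_uIoo fun x hx => ?_
    rw [uIoo_of_le (by norm_num)] at hx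
    simp [oddExtension, hx.2.le.not_gt]
  have cw' : Continuous fun x => (w x : ℂ) := Complex.continuous_ofReal.comp cw
  rw [integral_neg_one_one i2 i1]
  have k1 : ∫ x in (0 : ℝ)..1, e (-x) * (oddExtension w (-x) : ℂ)
      = ∫ x in (0 : ℝ)..1, -(e (-x) * (w x : ℂ)) := by
    refine intervalIntegral.integral_congr_Ioo_of_le zero_le_one fun x hx => ?_
    simp [oddExtension, hx.1.le.not_gt]
  have k2 : ∫ x in (0 : ℝ)..1, e x * (oddExtension w x : ℂ) = ∫ x in (0 : ℝ)..1, e x * (w x : ℂ) := by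
    refine intervalIntegral.integral_congr_Ioo_of_le zero_le_one fun x hx => ?_
    simp [oddExtension, hx.1]
  rw [k1, k2, ← intervalIntegral.integral_add (Continuous.intervalIntegrable (by fun_prop) _ _)
    (Continuous.intervalIntegrable (by fun_prop) _ _), ← intervalIntegral.integral_ofReal,
    ← intervalIntegral.integral_const_mul, ← intervalIntegral.integral_smul]
  refine intervalIntegral.integral_congr fun x _ => ?_
  simp only [e, Complex.real_smul]
  push_cast
  rw [Complex.sin]
  have : (-(n * Real.pi * -x) * Complex.I : ℂ) = n * Real.pi * x * Complex.I := by ring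
  rw [this]
  field_simp
  linear_combination 2 * (w x : ℂ) * (Complex.exp (-(n * Real.pi * x * Complex.I))
    - Complex.exp (n * Real.pi * x * Complex.I)) * Complex.I_sq

/-- Parseval for the odd extension. The sum over all integers counts each sine twice, which supplies
the factor `2` of the usual sine series identity. -/
theorem hasSum_sq_integral_sin {w : ℝ → ℝ} (cw : Continuous w) :
    HasSum (fun n : ℤ => (∫ x in (0 : ℝ)..1, w x * Real.sin (n * Real.pi * x)) ^ 2)
      (∫ x in (0 : ℝ)..1, w x ^ 2) := by
  have h := hasSum_sq_fourierCoeffOn (show (-1 : ℝ) < 1 by norm_num) (memLp_oddExtension cw)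
  simp_rw [fourierCoeffOn_oddExtension cw] at h
  convert h using 1
  · funext n
    rw [norm_mul, norm_neg, Complex.norm_I, one_mul, Complex.norm_real, Real.norm_eq_abs, sq_abs]
  · have hodd : ∀ x, ‖(oddExtension w x : ℂ)‖ ^ 2 = if 0 < x then w x ^ 2 else w (-x) ^ 2 :=
      fun x => by
        rw [Complex.norm_real, Real.norm_eq_abs, sq_abs, oddExtension]
        split_ifs <;> ring
    have i1 : ∫ x in (0 : ℝ)..1, ‖(oddExtension w x : ℂ)‖ ^ 2 = ∫ x in (0 : ℝ)..1, w x ^ 2 := by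
      refine intervalIntegral.integral_congr_Ioo_of_le zero_le_one fun x hx => ?_
      simp only [hodd, if_pos hx.1]
    have i2 : ∫ x in (-1 : ℝ)..0, ‖(oddExtension w x : ℂ)‖ ^ 2 = ∫ x in (0 : ℝ)..1, w x ^ 2 := by
      have : ∫ x in (-1 : ℝ)..0, ‖(oddExtension w x : ℂ)‖ ^ 2 = ∫ x in (-1 : ℝ)..0, w (-x) ^ 2 := by
        refine intervalIntegral.integral_congr_Ioo_of_le (by norm_num) fun x hx => ?_
        simp only [hodd, if_neg (not_lt.2 hx.2.le)]
      rw [this, intervalIntegral.integral_comp_neg fun x => w x ^ 2]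
      simp
    have hi : IntervalIntegrable (fun x => ‖(oddExtension w x : ℂ)‖ ^ 2) volume (-1) 1 := by
      rw [intervalIntegrable_iff_integrableOn_Ioc_of_le (by norm_num)]
      exact (memLp_oddExtension cw).integrable_norm_pow two_ne_zero
    have m0 : (0 : ℝ) ∈ uIcc (-1 : ℝ) 1 := by rw [uIcc_of_le (by norm_num)]; constructor <;> norm_num
    rw [← intervalIntegral.integral_add_adjacent_intervals (b := 0)
      (hi.mono_set (uIcc_subset_uIcc_left m0)) (hi.mono_set (uIcc_subset_uIcc_right m0)), i1, i2]
    rw [smul_eq_mul]; ring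

/-! ### Weak form of the error equation -/

theorem exists_continuous_extension_Icc {f : ℝ → ℝ} {a b : ℝ} (hab : a ≤ b)
    (hf : ContinuousOn f (Icc a b)) :
    ∃ g : ℝ → ℝ, Continuous g ∧ ∀ x ∈ Icc a b, g x = f x :=
  ⟨IccExtend hab ((Icc a b).domRestrict f),
    (continuousOn_iff_continuous_domRestrict.1 hf).Icc_extend',
    fun x hx => by simp [IccExtend_of_mem, hx, Set.domRestrict]⟩

theorem exists_continuous_extension_rect {f : ℝ → ℝ → ℝ} {a b c d : ℝ} (hab : a ≤ b) (hcd : c ≤ d)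
    (hf : ContinuousOn (fun p : ℝ × ℝ => f p.1 p.2) (Icc a b ×ˢ Icc c d)) :
    ∃ g : ℝ → ℝ → ℝ, (Continuous fun p : ℝ × ℝ => g p.1 p.2) ∧
      ∀ x ∈ Icc a b, ∀ t ∈ Icc c d, g x t = f x t := by
  refine ⟨fun x t => f (projIcc a b hab x) (projIcc c d hcd t), ?_, fun x hx t ht => ?_⟩
  · exact hf.comp_continuous (f := fun p : ℝ × ℝ =>
      ((projIcc a b hab p.1 : ℝ), (projIcc c d hcd p.2 : ℝ))) (by fun_prop)
      fun p => ⟨Subtype.coe_prop _, Subtype.coe_prop _⟩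
  · simp only [projIcc_of_mem hab hx, projIcc_of_mem hcd ht]

theorem continuous_integral_of_continuous_ends {X : Type*} [TopologicalSpace X]
    [FirstCountableTopology X] [LocallyCompactSpace X]
    {f : X → ℝ → ℝ} (hf : Continuous f.uncurry) {a b : X → ℝ}
    (ha : Continuous a) (hb : Continuous b) : Continuous fun x => ∫ t in a x..b x, f x t := by
  have c : ∀ x, Continuous (f x) := fun x => hf.comp (continuous_const.prodMk continuous_id)
  refine ((intervalIntegral.continuous_parametric_intervalIntegral_of_continuous
    (μ := volume) (a₀ := 0) hf hb).sub (intervalIntegral.continuous_parametric_intervalIntegral_of_continuous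
    (μ := volume) (a₀ := 0) hf ha)).congr fun x => ?_
  exact intervalIntegral.integral_interval_sub_left ((c x).intervalIntegrable _ _)
    ((c x).intervalIntegrable _ _)

/-- Classical solutions `e` of `eₜ = ε eₓₓ + λ e - φ eₓ(0,t)`, `e(0,t) = e(1,t) = 0`, on `[0,1]`. -/
structure IsErrorSystem (ε : ℝ) (lam φ : ℝ → ℝ) (t₀ : ℝ) (e ex exx et : ℝ → ℝ → ℝ) : Prop where
  cont : ContinuousOn (fun p : ℝ × ℝ => e p.1 p.2) (Icc 0 1 ×ˢ Ioi t₀)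
  cont_x : ContinuousOn (fun p : ℝ × ℝ => ex p.1 p.2) (Ico 0 1 ×ˢ Ioi t₀)
  cont_xx : ContinuousOn (fun p : ℝ × ℝ => exx p.1 p.2) (Ioo 0 1 ×ˢ Ioi t₀)
  cont_t : ContinuousOn (fun p : ℝ × ℝ => et p.1 p.2) (Ioo 0 1 ×ˢ Ioi t₀)
  deriv_x : ∀ x ∈ Ioo (0 : ℝ) 1, ∀ t > t₀, HasDerivAt (fun z => e z t) (ex x t) x
  deriv_xx : ∀ x ∈ Ioo (0 : ℝ) 1, ∀ t > t₀, HasDerivAt (fun z => ex z t) (exx x t) x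
  deriv_t : ∀ x ∈ Ioo (0 : ℝ) 1, ∀ t > t₀, HasDerivAt (fun s => e x s) (et x t) t
  pde : ∀ x ∈ Ioo (0 : ℝ) 1, ∀ t > t₀,
    et x t = ε * exx x t + lam x * e x t - φ x * ex 0 t
  left : ∀ t > t₀, e 0 t = 0
  right : ∀ t > t₀, e 1 t = 0

section ErrorSystem
variable {ε μ t₀ : ℝ} {lam φ p p' p'' : ℝ → ℝ} {e ex exx et : ℝ → ℝ → ℝ}

/-- The derivative `e_x` need not have a limit at `x = 1`. The test function `p(x) - kx`, with `k =
p(b)/b`, vanishes at `b` and removes `e_x(b,t)` from the boundary terms; the linear correction has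
no second derivative and contributes only the terms with `k`. -/
theorem IsErrorSystem.integral_time_deriv (h : IsErrorSystem ε lam φ t₀ e ex exx et)
    (hlam : ContinuousOn lam (Icc 0 1)) (hφ : ContinuousOn φ (Icc 0 1))
    (cp : Continuous p) (cp'' : Continuous p'')
    (hp : ∀ x ∈ Ioo (0 : ℝ) 1, HasDerivAt p (p' x) x)
    (hp' : ∀ x ∈ Ioo (0 : ℝ) 1, HasDerivAt p' (p'' x) x)
    (ode : ∀ x ∈ Ioo (0 : ℝ) 1, ε * p'' x + lam x * p x = -μ * p x)
    {a b k t : ℝ} (ha : 0 < a) (hab : a ≤ b) (hb : b < 1) (ht : t₀ < t) (hk : p b = k * b) :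
    ∫ x in a..b, et x t * (p x - k * x)
      = ε * (-(e b t * (p' b - k)) - ex a t * (p a - k * a) + e a t * (p' a - k))
        - μ * (∫ x in a..b, e x t * p x) - k * (∫ x in a..b, lam x * x * e x t)
        - ex 0 t * ∫ x in a..b, φ x * (p x - k * x) := by
  have sub : Icc a b ⊆ Ioo (0 : ℝ) 1 := fun x hx => ⟨ha.trans_le hx.1, hx.2.trans_lt hb⟩
  have cpair : ContinuousOn (fun x : ℝ => (x, t)) (Icc a b) := by fun_prop
  have ce : ContinuousOn (fun x => e x t) (Icc a b) :=
    h.cont.comp cpair fun x hx => ⟨Ioo_subset_Icc_self (sub hx), ht⟩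
  have cexx : ContinuousOn (fun x => exx x t) (Icc a b) :=
    h.cont_xx.comp cpair fun x hx => ⟨sub hx, ht⟩
  have clam := hlam.mono (sub.trans Ioo_subset_Icc_self)
  have cφ := hφ.mono (sub.trans Ioo_subset_Icc_self)
  have cid : ContinuousOn (fun x : ℝ => x) (Icc a b) := continuousOn_id
  have cP : ContinuousOn (fun x => p x - k * x) (Icc a b) := by fun_prop
  have i1 : IntervalIntegrable (fun x => exx x t * (p x - k * x) - e x t * p'' x) volume a b :=
    ((cexx.mul cP).sub (ce.mul cp''.continuousOn)).intervalIntegrable_of_Icc hab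
  have i2 : IntervalIntegrable (fun x => e x t * p x) volume a b :=
    (ce.mul cp.continuousOn).intervalIntegrable_of_Icc hab
  have i3 : IntervalIntegrable (fun x => lam x * x * e x t) volume a b :=
    ((clam.mul cid).mul ce).intervalIntegrable_of_Icc hab
  have i4 : IntervalIntegrable (fun x => φ x * (p x - k * x)) volume a b :=
    (cφ.mul cP).intervalIntegrable_of_Icc hab
  have parts := intervalIntegral.integral_eq_sub_of_hasDerivAt
    (f := fun x => ex x t * (p x - k * x) - e x t * (p' x - k)) (a := a) (b := b)
    (f' := fun x => exx x t * (p x - k * x) - e x t * p'' x) (fun x hx => by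
      rw [uIcc_of_le hab] at hx
      have hx' := sub hx
      have d1 : HasDerivAt (fun x => p x - k * x) (p' x - k) x := by
        simpa using! (hp x hx').sub ((hasDerivAt_id' x).const_mul k)
      have d2 : HasDerivAt (fun x => p' x - k) (p'' x) x := (hp' x hx').sub_const k
      refine (((h.deriv_xx x hx' t ht).mul d1).sub ((h.deriv_x x hx' t ht).mul d2)).congr_deriv ?_
      ring) i1
  have e1 : ∫ x in a..b, et x t * (p x - k * x)
      = ε * (∫ x in a..b, (exx x t * (p x - k * x) - e x t * p'' x))
        - μ * (∫ x in a..b, e x t * p x) - k * (∫ x in a..b, lam x * x * e x t)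
        - ex 0 t * ∫ x in a..b, φ x * (p x - k * x) := by
    rw [← intervalIntegral.integral_const_mul, ← intervalIntegral.integral_const_mul,
      ← intervalIntegral.integral_const_mul, ← intervalIntegral.integral_const_mul,
      ← intervalIntegral.integral_sub (i1.const_mul ε) (i2.const_mul μ),
      ← intervalIntegral.integral_sub ((i1.const_mul ε).sub (i2.const_mul μ)) (i3.const_mul k),
      ← intervalIntegral.integral_sub (((i1.const_mul ε).sub (i2.const_mul μ)).sub
        (i3.const_mul k)) (i4.const_mul _)]
    refine intervalIntegral.integral_congr fun x hx => ?_
    rw [uIcc_of_le hab] at hx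
    have hx' := sub hx
    rw [h.pde x hx' t ht]
    linear_combination (e x t) * ode x hx'
  rw [e1, parts, hk]
  ring

/-- The weak form is stated after integration in time: `∫ e p` need not be differentiated under the
integral up to the ends of `[0,1]`, and the limit `a → 0`, `b → 1`, `k → 0` is mere continuity of
both sides in `(a,b,k)`. -/
theorem IsErrorSystem.integral_sub_integral (h : IsErrorSystem ε lam φ t₀ e ex exx et)
    (hlam : ContinuousOn lam (Icc 0 1)) (hφ : ContinuousOn φ (Icc 0 1))
    (cp : Continuous p) (cp' : Continuous p') (cp'' : Continuous p'')
    (hp : ∀ x ∈ Ioo (0 : ℝ) 1, HasDerivAt p (p' x) x)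
    (hp' : ∀ x ∈ Ioo (0 : ℝ) 1, HasDerivAt p' (p'' x) x)
    (ode : ∀ x ∈ Ioo (0 : ℝ) 1, ε * p'' x + lam x * p x = -μ * p x)
    (p1 : p 1 = 0) (p0 : ∫ x in (0 : ℝ)..1, φ x * p x = -ε * p 0)
    {τ₁ τ₂ : ℝ} (h₁ : t₀ < τ₁) (h₂ : τ₁ ≤ τ₂) :
    (∫ x in (0 : ℝ)..1, e x τ₂ * p x) - ∫ x in (0 : ℝ)..1, e x τ₁ * p x
      = -μ * ∫ t in τ₁..τ₂, ∫ x in (0 : ℝ)..1, e x t * p x := by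
  have hI : Icc τ₁ τ₂ ⊆ Ioi t₀ := fun t ht => h₁.trans_le ht.1
  obtain ⟨E, cE, hE⟩ := exists_continuous_extension_rect zero_le_one h₂
    (h.cont.mono (prod_mono_right hI))
  -- `e_x` is continuous up to `x = 0` only; its values on `[0,1/2]` suffice, since it is evaluated
  -- at `0` and at `a ≤ 1/2`.
  obtain ⟨D, cD, hD⟩ := exists_continuous_extension_rect (a := 0) (b := 1 / 2) (by norm_num) h₂
    (h.cont_x.mono (prod_mono (fun x hx => ⟨hx.1, hx.2.trans_lt (by norm_num)⟩) hI))
  obtain ⟨l, cl, hl⟩ := exists_continuous_extension_Icc zero_le_one hlam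
  obtain ⟨f, cf, hf⟩ := exists_continuous_extension_Icc zero_le_one hφ
  have cE' : ∀ {Y : Type} [TopologicalSpace Y] {u v : Y → ℝ}, Continuous u → Continuous v →
      Continuous fun y => E (u y) (v y) := fun hu hv => cE.comp (hu.prodMk hv)
  have cD' : ∀ {Y : Type} [TopologicalSpace Y] {u v : Y → ℝ}, Continuous u → Continuous v →
      Continuous fun y => D (u y) (v y) := fun hu hv => cD.comp (hu.prodMk hv)
  have hτ₁ : τ₁ ∈ Icc τ₁ τ₂ := left_mem_Icc.2 h₂
  have hτ₂ : τ₂ ∈ Icc τ₁ τ₂ := right_mem_Icc.2 h₂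
  -- `q = (a, b, k)`: the ends of the interval and the slope of the correction of `p`
  let R : ℝ × ℝ × ℝ → ℝ → ℝ := fun q t =>
    ε * (-(E q.2.1 t * (p' q.2.1 - q.2.2)) - D q.1 t * (p q.1 - q.2.2 * q.1)
        + E q.1 t * (p' q.1 - q.2.2))
      - μ * (∫ x in q.1..q.2.1, E x t * p x) - q.2.2 * (∫ x in q.1..q.2.1, l x * x * E x t)
      - D 0 t * ∫ x in q.1..q.2.1, f x * (p x - q.2.2 * x)
  let L : ℝ × ℝ × ℝ → ℝ := fun q =>
    ∫ x in q.1..q.2.1, (E x τ₂ - E x τ₁) * (p x - q.2.2 * x)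
  have cL : Continuous L := by
    refine continuous_integral_of_continuous_ends
      (f := fun (q : ℝ × ℝ × ℝ) x => (E x τ₂ - E x τ₁) * (p x - q.2.2 * x)) ?_
      (by fun_prop) (by fun_prop)
    refine ((cE' ?_ ?_).sub (cE' ?_ ?_)).mul ?_ <;> fun_prop
  have cR : Continuous R.uncurry := by
    have k1 : Continuous fun z : (ℝ × ℝ × ℝ) × ℝ => ∫ x in z.1.1..z.1.2.1, E x z.2 * p x := by
      refine continuous_integral_of_continuous_ends
        (f := fun (z : (ℝ × ℝ × ℝ) × ℝ) x => E x z.2 * p x) ?_ (by fun_prop) (by fun_prop)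
      exact (cE' (by fun_prop) (by fun_prop)).mul (by fun_prop)
    have k2 : Continuous fun z : (ℝ × ℝ × ℝ) × ℝ => ∫ x in z.1.1..z.1.2.1, l x * x * E x z.2 := by
      refine continuous_integral_of_continuous_ends
        (f := fun (z : (ℝ × ℝ × ℝ) × ℝ) x => l x * x * E x z.2) ?_ (by fun_prop) (by fun_prop)
      exact Continuous.mul (by fun_prop) (cE' (by fun_prop) (by fun_prop))
    have k3 : Continuous fun z : (ℝ × ℝ × ℝ) × ℝ =>
        ∫ x in z.1.1..z.1.2.1, f x * (p x - z.1.2.2 * x) := by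
      refine continuous_integral_of_continuous_ends
        (f := fun (z : (ℝ × ℝ × ℝ) × ℝ) x => f x * (p x - z.1.2.2 * x)) ?_
        (by fun_prop) (by fun_prop)
      simp only [Function.uncurry_def]
      fun_prop
    have k4 : Continuous fun z : (ℝ × ℝ × ℝ) × ℝ => E z.1.2.1 z.2 := cE' (by fun_prop) (by fun_prop)
    have k5 : Continuous fun z : (ℝ × ℝ × ℝ) × ℝ => E z.1.1 z.2 := cE' (by fun_prop) (by fun_prop)
    have k6 : Continuous fun z : (ℝ × ℝ × ℝ) × ℝ => D z.1.1 z.2 := cD' (by fun_prop) (by fun_prop)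
    have k7 : Continuous fun z : (ℝ × ℝ × ℝ) × ℝ => D 0 z.2 := cD' (by fun_prop) (by fun_prop)
    simp only [R, Function.uncurry_def]
    fun_prop
  have cH : Continuous fun q => ∫ t in τ₁..τ₂, R q t :=
    intervalIntegral.continuous_parametric_intervalIntegral_of_continuous' cR _ _
  have key : ∀ a b : ℝ, 0 < a → a ≤ 1 / 2 → 1 / 2 ≤ b → b < 1 →
      L (a, b, p b / b) = ∫ t in τ₁..τ₂, R (a, b, p b / b) t := by
    intro a b ha ha2 hb2 hb
    have hab : a ≤ b := ha2.trans hb2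
    have sub : Icc a b ⊆ Ioo (0 : ℝ) 1 := fun x hx => ⟨ha.trans_le hx.1, hx.2.trans_lt hb⟩
    have sub' := sub.trans Ioo_subset_Icc_self
    have hk : p b = p b / b * b := by
      have : b ≠ 0 := by linarith
      field_simp
    set k := p b / b
    have cet : ContinuousOn (fun z : ℝ × ℝ => et z.1 z.2) (Icc a b ×ˢ Icc τ₁ τ₂) :=
      h.cont_t.mono (prod_mono sub hI)
    have s1 : L (a, b, k) = ∫ x in a..b, ∫ t in τ₁..τ₂, et x t * (p x - k * x) := by
      refine intervalIntegral.integral_congr fun x hx => ?_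
      rw [uIcc_of_le hab] at hx
      simp only
      rw [intervalIntegral.integral_mul_const, hE x (sub' hx) _ hτ₁, hE x (sub' hx) _ hτ₂]
      congr 1
      refine (intervalIntegral.integral_eq_sub_of_hasDerivAt (fun t ht => ?_) ?_).symm
      · rw [uIcc_of_le h₂] at ht
        exact h.deriv_t x (sub hx) t (hI ht)
      · refine ContinuousOn.intervalIntegrable_of_Icc h₂ ?_
        exact cet.comp (f := fun t : ℝ => (x, t)) (by fun_prop) fun t ht => ⟨hx, ht⟩
    have s2 : ∫ x in a..b, ∫ t in τ₁..τ₂, et x t * (p x - k * x)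
        = ∫ t in τ₁..τ₂, ∫ x in a..b, et x t * (p x - k * x) := by
      apply intervalIntegral_intervalIntegral_swap
      have : IntegrableOn (fun z : ℝ × ℝ => et z.1 z.2 * (p z.1 - k * z.1))
          (Icc a b ×ˢ Icc τ₁ τ₂) :=
        ContinuousOn.integrableOn_compact (isCompact_Icc.prod isCompact_Icc)
          (cet.mul (by fun_prop))
      rw [← uIcc_of_le hab, ← uIcc_of_le h₂] at this
      exact this.mono_set (prod_mono uIoc_subset_uIcc uIoc_subset_uIcc)
    rw [s1, s2]
    refine intervalIntegral.integral_congr fun t ht => ?_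
    rw [uIcc_of_le h₂] at ht
    rw [h.integral_time_deriv hlam hφ cp cp'' hp hp' ode ha hab hb (hI ht) hk]
    have ma : a ∈ Icc a b := left_mem_Icc.2 hab
    have mb : b ∈ Icc a b := right_mem_Icc.2 hab
    have j1 : ∫ x in a..b, e x t * p x = ∫ x in a..b, E x t * p x := by
      refine intervalIntegral.integral_congr fun x hx => ?_
      rw [uIcc_of_le hab] at hx
      simp only [hE x (sub' hx) t ht]
    have j2 : ∫ x in a..b, lam x * x * e x t = ∫ x in a..b, l x * x * E x t := by
      refine intervalIntegral.integral_congr fun x hx => ?_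
      rw [uIcc_of_le hab] at hx
      simp only [hE x (sub' hx) t ht, hl x (sub' hx)]
    have j3 : ∫ x in a..b, φ x * (p x - k * x) = ∫ x in a..b, f x * (p x - k * x) := by
      refine intervalIntegral.integral_congr fun x hx => ?_
      rw [uIcc_of_le hab] at hx
      simp only [hf x (sub' hx)]
    simp only [R]
    rw [j1, j2, j3, hE b (sub' mb) t ht, hE a (sub' ma) t ht, hD a ⟨ha.le, ha2⟩ t ht,
      hD 0 (by constructor <;> norm_num) t ht]
  -- The path `a = δ`, `b = 1 - δ`, `k = p(b)/b` tends to `(0,1,0)` because `p 1 = 0`.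
  have lim : L (0, 1, 0) = ∫ t in τ₁..τ₂, R (0, 1, 0) t := by
    let γ : ℝ → ℝ × ℝ × ℝ := fun δ => (δ, 1 - δ, p (1 - δ) / (1 - δ))
    have hγ : Tendsto γ (𝓝[>] 0) (𝓝 (0, 1, 0)) := by
      have : ContinuousAt γ 0 := by
        refine continuousAt_id.prodMk ((by fun_prop : ContinuousAt (fun δ : ℝ => 1 - δ) 0).prodMk ?_)
        refine ContinuousAt.div (by fun_prop) (by fun_prop) (by norm_num)
      have h0 : γ 0 = (0, 1, 0) := by simp [γ, p1]
      rw [← h0]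
      exact this.tendsto.mono_left nhdsWithin_le_nhds
    refine tendsto_nhds_unique ((cL.tendsto _).comp hγ)
      (((cH.tendsto _).comp hγ).congr' ?_)
    filter_upwards [Ioo_mem_nhdsGT (show (0 : ℝ) < 1 / 2 by norm_num)] with δ hδ
    exact (key δ (1 - δ) hδ.1 hδ.2.le (by linarith [hδ.2]) (by linarith [hδ.1])).symm
  have cEp : ∀ t, Continuous fun x => E x t * p x := fun t =>
    (cE' continuous_id continuous_const).mul cp
  have eL : L (0, 1, 0) = (∫ x in (0 : ℝ)..1, e x τ₂ * p x) - ∫ x in (0 : ℝ)..1, e x τ₁ * p x := by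
    have : ∀ t ∈ Icc τ₁ τ₂, ∫ x in (0 : ℝ)..1, e x t * p x = ∫ x in (0 : ℝ)..1, E x t * p x := by
      intro t ht
      refine intervalIntegral.integral_congr fun x hx => ?_
      rw [uIcc_of_le zero_le_one] at hx
      simp only [hE x hx t ht]
    rw [this _ hτ₁, this _ hτ₂, ← intervalIntegral.integral_sub
      ((cEp _).intervalIntegrable _ _) ((cEp _).intervalIntegrable _ _)]
    refine intervalIntegral.integral_congr fun x _ => ?_
    simp only; ring
  rw [← eL, lim, ← intervalIntegral.integral_const_mul]
  refine intervalIntegral.integral_congr fun t ht => ?_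
  rw [uIcc_of_le h₂] at ht
  have j1 : ∫ x in (0 : ℝ)..1, e x t * p x = ∫ x in (0 : ℝ)..1, E x t * p x := by
    refine intervalIntegral.integral_congr fun x hx => ?_
    rw [uIcc_of_le zero_le_one] at hx
    simp only [hE x hx t ht]
  -- The nonlocal condition on `p`: it makes the injection term cancel `-ε e_x(0,t) p(0)`.
  have j3 : ∫ x in (0 : ℝ)..1, f x * (p x - 0 * x) = -ε * p 0 := by
    rw [← p0]
    refine intervalIntegral.integral_congr fun x hx => ?_
    rw [uIcc_of_le zero_le_one] at hx
    simp only [hf x hx]; ring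
  simp only [R]
  rw [j1, j3, hE 0 (left_mem_Icc.2 zero_le_one) t ht, hE 1 (right_mem_Icc.2 zero_le_one) t ht,
    h.left t (hI ht), h.right t (hI ht)]
  ring

/-- The integrated identity is the linear equation `W' = -μW` in integral form, so `exp(μt) V(t)` is
constant. -/
theorem IsErrorSystem.integral_decay (h : IsErrorSystem ε lam φ t₀ e ex exx et)
    (hlam : ContinuousOn lam (Icc 0 1)) (hφ : ContinuousOn φ (Icc 0 1))
    (cp : Continuous p) (cp' : Continuous p') (cp'' : Continuous p'')
    (hp : ∀ x ∈ Ioo (0 : ℝ) 1, HasDerivAt p (p' x) x)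
    (hp' : ∀ x ∈ Ioo (0 : ℝ) 1, HasDerivAt p' (p'' x) x)
    (ode : ∀ x ∈ Ioo (0 : ℝ) 1, ε * p'' x + lam x * p x = -μ * p x)
    (p1 : p 1 = 0) (p0 : ∫ x in (0 : ℝ)..1, φ x * p x = -ε * p 0)
    {τ₁ τ₂ : ℝ} (h₁ : t₀ < τ₁) (h₂ : τ₁ ≤ τ₂) :
    ∫ x in (0 : ℝ)..1, e x τ₂ * p x
      = Real.exp (-μ * (τ₂ - τ₁)) * ∫ x in (0 : ℝ)..1, e x τ₁ * p x := by
  have hI : Icc τ₁ τ₂ ⊆ Ioi t₀ := fun t ht => h₁.trans_le ht.1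
  obtain ⟨E, cE, hE⟩ := exists_continuous_extension_rect zero_le_one h₂
    (h.cont.mono (prod_mono_right hI))
  have cW : Continuous fun t => ∫ x in (0 : ℝ)..1, E x t * p x :=
    continuous_integral_of_uncurry (h := fun t x => E x t * p x)
      ((cE.comp continuous_swap).mul (cp.comp continuous_snd)) 0 1
  set W : ℝ → ℝ := fun t => ∫ x in (0 : ℝ)..1, E x t * p x
  have hW : ∀ t ∈ Icc τ₁ τ₂, ∫ x in (0 : ℝ)..1, e x t * p x = W t := by
    intro t ht
    refine intervalIntegral.integral_congr fun x hx => ?_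
    rw [uIcc_of_le zero_le_one] at hx
    simp only [hE x hx t ht]
  set V : ℝ → ℝ := fun t => W τ₁ + -μ * ∫ s in τ₁..t, W s
  have hτ₁ : τ₁ ∈ Icc τ₁ τ₂ := left_mem_Icc.2 h₂
  have hV : ∀ t ∈ Icc τ₁ τ₂, W t = V t := by
    intro t ht
    have := h.integral_sub_integral hlam hφ cp cp' cp'' hp hp' ode p1 p0 h₁ ht.1
    rw [hW t ht, hW τ₁ hτ₁] at this
    have e2 : ∫ s in τ₁..t, ∫ x in (0 : ℝ)..1, e x s * p x = ∫ s in τ₁..t, W s := by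
      refine intervalIntegral.integral_congr fun s hs => ?_
      rw [uIcc_of_le ht.1] at hs
      exact hW s ⟨hs.1, hs.2.trans ht.2⟩
    rw [e2] at this
    simp only [V]
    linarith
  have dV : ∀ t, HasDerivAt V (-μ * W t) t := fun t =>
    ((hasDerivAt_integral_upper cW τ₁ t).const_mul (-μ)).const_add _
  have dU : ∀ t, HasDerivAt (fun t => Real.exp (μ * t) * V t)
      (Real.exp (μ * t) * μ * V t + Real.exp (μ * t) * (-μ * W t)) t := fun t => by
    have d1 : HasDerivAt (fun t => Real.exp (μ * t)) (Real.exp (μ * t) * μ) t := by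
      simpa using! ((hasDerivAt_id t).const_mul μ).exp
    exact d1.mul (dV t)
  have const := constant_of_has_deriv_right_zero (f := fun t => Real.exp (μ * t) * V t)
    (a := τ₁) (b := τ₂) (fun t _ => (dU t).continuousAt.continuousWithinAt) (fun t ht => by
      refine (dU t).hasDerivWithinAt.congr_deriv ?_
      rw [hV t ⟨ht.1, ht.2.le⟩]; ring) τ₂ (right_mem_Icc.2 h₂)
  rw [hW τ₂ (right_mem_Icc.2 h₂), hW τ₁ hτ₁, hV τ₂ (right_mem_Icc.2 h₂), hV τ₁ hτ₁]
  have e3 : Real.exp (-μ * (τ₂ - τ₁)) = Real.exp (μ * τ₁) / Real.exp (μ * τ₂) := by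
    rw [← Real.exp_sub]; congr 1; ring
  rw [e3, div_mul_eq_mul_div, ← const]
  field_simp

end ErrorSystem

/-! ### Decay of the error in `L²` -/

/-- Here `g(x) = w(x) - ∫_0^x Φ(x,y) w(y) dy`; by Fubini on the triangle the formal adjoint of this
map is the transformation that takes `p` to `s`. Only pairings and `L²` bounds in both directions
are recorded, since `w` is never differentiated. -/
theorem exists_backstepping_transform {Φ : ℝ → ℝ → ℝ}
    (hΦ : ContinuousOn (fun p : ℝ × ℝ => Φ p.1 p.2) triangle) :
    ∃ A B : ℝ, 0 < A ∧ 0 < B ∧ ∀ g : ℝ → ℝ, ContinuousOn g (Icc 0 1) →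
      ∃ w : ℝ → ℝ, Continuous w ∧
        (∀ p s : ℝ → ℝ, Continuous p →
          (∀ x ∈ Icc (0 : ℝ) 1, s x = p x - ∫ y in x..1, Φ y x * p y) →
          ∫ x in (0 : ℝ)..1, w x * s x = ∫ x in (0 : ℝ)..1, g x * p x) ∧
        ∫ x in (0 : ℝ)..1, w x ^ 2 ≤ A * ∫ x in (0 : ℝ)..1, g x ^ 2 ∧
        ∫ x in (0 : ℝ)..1, g x ^ 2 ≤ B * ∫ x in (0 : ℝ)..1, w x ^ 2 := by
  have cE : Continuous fun p : ℝ × ℝ => ((fun p : ℝ × ℝ => Φ p.1 p.2) ∘ triangleRetract) (p.1, p.2) :=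
    continuous_comp_triangleRetract hΦ
  set E : ℝ → ℝ → ℝ := fun x y => ((fun p : ℝ × ℝ => Φ p.1 p.2) ∘ triangleRetract) (x, y)
  have hE : ∀ x y, 0 ≤ y → y ≤ x → x ≤ 1 → E x y = Φ x y := fun x y h1 h2 h3 => by
    simp only [E, Function.comp]
    rw [triangleRetract_of_mem ⟨h1, h2, h3⟩]
  obtain ⟨M, hM⟩ := (isCompact_Icc.prod (isCompact_Icc (a := (0 : ℝ)) (b := 1))
    |>.exists_bound_of_continuousOn (s := Icc (0 : ℝ) 1 ×ˢ Icc (0 : ℝ) 1) cE.continuousOn)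
  -- The first constant is the Gronwall bound for `w` in terms of `g`; the second comes from `(w -
  -- I)² ≤ 2w² + 2I²` with `I² ≤ M² ∫ w²`.
  refine ⟨2 * Real.exp (2 * M ^ 2), 2 + 2 * M ^ 2, by positivity, by positivity, fun g cg => ?_⟩
  obtain ⟨G, cG, hG⟩ := exists_continuous_extension_Icc zero_le_one cg
  obtain ⟨w, cw, hw⟩ := exists_volterra_solution (k := E) cE cG.continuousOn
  have hgG : ∫ x in (0 : ℝ)..1, g x ^ 2 = ∫ x in (0 : ℝ)..1, G x ^ 2 := by
    refine intervalIntegral.integral_congr fun x hx => ?_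
    rw [uIcc_of_le zero_le_one] at hx
    simp only [hG x hx]
  have cEw : ∀ x, Continuous fun y => E x y * w y := fun x =>
    (continuous_curry_left (h := E) cE x).mul cw
  have hint : ∀ x ∈ Icc (0 : ℝ) 1, |∫ y in (0 : ℝ)..x, E x y * w y|
      ≤ M * ∫ y in (0 : ℝ)..x, |w y| := by
    intro x hx
    rw [← intervalIntegral.integral_const_mul]
    refine (intervalIntegral.abs_integral_le_integral_abs hx.1).trans ?_
    refine intervalIntegral.integral_mono_on hx.1 ((cEw x).abs.intervalIntegrable _ _)
      ((cw.abs.const_mul M).intervalIntegrable _ _) fun y hy => ?_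
    rw [abs_mul]
    exact mul_le_mul_of_nonneg_right (hM (x, y) ⟨hx, hy.1, hy.2.trans hx.2⟩) (abs_nonneg _)
  refine ⟨w, cw, fun p s cp hs => ?_, ?_, ?_⟩
  · have ckp : Continuous fun z : ℝ × ℝ => E z.2 z.1 * p z.2 :=
      (cE.comp continuous_swap).mul (cp.comp continuous_snd)
    have ck : Continuous fun z : ℝ × ℝ => w z.1 * (E z.2 z.1 * p z.2) :=
      (cw.comp continuous_fst).mul ckp
    have swap := integral_triangle_swap (k := fun x y => w x * (E y x * p y)) ck
    have e1 : ∫ x in (0 : ℝ)..1, w x * s x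
        = ∫ x in (0 : ℝ)..1, (w x * p x - ∫ y in x..1, w x * (E y x * p y)) := by
      refine intervalIntegral.integral_congr fun x hx => ?_
      rw [uIcc_of_le zero_le_one] at hx
      rw [hs x hx, intervalIntegral.integral_const_mul, ← mul_sub]
      congr 2
      refine intervalIntegral.integral_congr fun y hy => ?_
      rw [uIcc_of_le hx.2] at hy
      simp only [hE y x hx.1 hy.1 hy.2]
    have e2 : ∫ x in (0 : ℝ)..1, g x * p x
        = ∫ y in (0 : ℝ)..1, (w y * p y - ∫ x in (0 : ℝ)..y, w x * (E y x * p y)) := by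
      refine intervalIntegral.integral_congr fun y hy => ?_
      rw [uIcc_of_le zero_le_one] at hy
      have e3 : ∫ x in (0 : ℝ)..y, w x * (E y x * p y)
          = (∫ x in (0 : ℝ)..y, E y x * w x) * p y := by
        rw [← intervalIntegral.integral_mul_const]
        refine intervalIntegral.integral_congr fun x _ => ?_
        ring
      rw [e3, ← hG y hy, hw y hy]
      ring
    have c1 := continuous_integral_lower (h := fun x y => w x * (E y x * p y)) ck
    have c2 : Continuous fun y => ∫ x in (0 : ℝ)..y, w x * (E y x * p y) :=
      (continuous_primitive_of_uncurry (h := fun y x => w x * (E y x * p y))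
        (ck.comp continuous_swap)).comp (continuous_id.prodMk continuous_id)
    have cwp : Continuous fun x => w x * p x := cw.mul cp
    rw [e1, e2, intervalIntegral.integral_sub (cwp.intervalIntegrable _ _)
      (c1.intervalIntegrable _ _), intervalIntegral.integral_sub
      (cwp.intervalIntegrable _ _) (c2.intervalIntegrable _ _), swap]
  · rw [hgG]
    refine integral_sq_le_of_volterra cw cG fun x hx => ?_
    rw [hw x hx]
    exact (abs_add_le _ _).trans (add_le_add le_rfl (hint x hx))
  · rw [hgG, add_mul]
    have hpt : ∀ x ∈ Icc (0 : ℝ) 1,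
        G x ^ 2 ≤ 2 * w x ^ 2 + 2 * M ^ 2 * ∫ y in (0 : ℝ)..1, w y ^ 2 := by
      intro x hx
      have h1 := hint x hx
      have h2 := sq_integral_abs_le cw hx
      have h3 : ∫ y in (0 : ℝ)..x, w y ^ 2 ≤ ∫ y in (0 : ℝ)..1, w y ^ 2 :=
        intervalIntegral.integral_mono_interval le_rfl hx.1 hx.2
          (Eventually.of_forall fun y => sq_nonneg _) ((cw.pow 2).intervalIntegrable _ _)
      have h4 := hw x hx
      set I := ∫ y in (0 : ℝ)..x, E x y * w y
      set m := ∫ y in (0 : ℝ)..x, |w y|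
      have h5 : I ^ 2 ≤ M ^ 2 * ∫ y in (0 : ℝ)..1, w y ^ 2 := by
        have : I ^ 2 ≤ (M * m) ^ 2 := by
          rw [← sq_abs I]; exact pow_le_pow_left₀ (abs_nonneg _) h1 2
        rw [mul_pow] at this
        exact this.trans (mul_le_mul_of_nonneg_left (h2.trans h3) (sq_nonneg M))
      have h6 : G x = w x - I := by linarith
      rw [h6]
      nlinarith [sq_nonneg (w x + I)]
    refine (intervalIntegral.integral_mono_on zero_le_one ((cG.pow 2).intervalIntegrable _ _)
      (Continuous.intervalIntegrable (by fun_prop) _ _) hpt).trans ?_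
    rw [intervalIntegral.integral_add (Continuous.intervalIntegrable (by fun_prop) _ _) (by simp),
      intervalIntegral.integral_const_mul]
    simp

/-- The sines diagonalize the target dynamics: the `n`-th coefficient of `w` decays with rate `c +
ε(nπ)² ≥ c`, so Parseval gives decay of `w`, and the transformation bounds return it to `e`. -/
theorem exists_integral_sq_decay {ε c : ℝ} {lam : ℝ → ℝ} {Φ : ℝ → ℝ → ℝ} (hε : 0 < ε)
    (hlam : ContinuousOn lam (Icc 0 1)) (hΦ : IsObserverKernel ε lam c Φ) :
    ∃ C : ℝ, 0 < C ∧ ∀ (t₀ : ℝ) (e ex exx et : ℝ → ℝ → ℝ),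
      IsErrorSystem ε lam (observerGain ε Φ) t₀ e ex exx et →
      ∀ τ₁ τ₂, t₀ < τ₁ → τ₁ ≤ τ₂ →
        ∫ x in (0 : ℝ)..1, e x τ₂ ^ 2
          ≤ C * Real.exp (-2 * c * (τ₂ - τ₁)) * ∫ x in (0 : ℝ)..1, e x τ₁ ^ 2 := by
  obtain ⟨A, B, hA, hB, tr⟩ := exists_backstepping_transform hΦ.regular.continuousOn
  refine ⟨B * A, by positivity, fun t₀ e ex exx et h τ₁ τ₂ h₁ h₂ => ?_⟩
  have ce : ∀ t, t₀ < t → ContinuousOn (fun x => e x t) (Icc 0 1) := fun t ht =>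
    h.cont.comp (f := fun x : ℝ => (x, t)) (by fun_prop) fun x hx => ⟨hx, ht⟩
  have cφ : ContinuousOn (observerGain ε Φ) (Icc 0 1) :=
    continuousOn_const.mul (hΦ.regular.continuousOn.comp (f := fun x : ℝ => (x, (0 : ℝ)))
      (by fun_prop) fun x hx => ⟨le_rfl, hx.1, hx.2⟩)
  obtain ⟨w₁, cw₁, tr₁, up₁, -⟩ := tr _ (ce τ₁ h₁)
  obtain ⟨w₂, cw₂, tr₂, -, lo₂⟩ := tr _ (ce τ₂ (h₁.trans_le h₂))
  have coeff : ∀ n : ℤ, (∫ x in (0 : ℝ)..1, w₂ x * Real.sin (n * Real.pi * x)) ^ 2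
      ≤ Real.exp (-2 * c * (τ₂ - τ₁))
        * (∫ x in (0 : ℝ)..1, w₁ x * Real.sin (n * Real.pi * x)) ^ 2 := by
    intro n
    set k : ℝ := n * Real.pi
    obtain ⟨p, p', p'', cp, cp', cp'', hp, hp', ode, p1, p0, hs⟩ :=
      exists_adjoint_eigenfunction hε hlam hΦ (s := fun x => Real.sin (k * x))
        (s' := fun x => Real.cos (k * x) * k) (κ := k ^ 2)
        (fun x => by simpa using! ((hasDerivAt_id x).const_mul k).sin)
        (fun x => by
          have := (((hasDerivAt_id' x).const_mul k).cos).mul_const k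
          refine this.congr_deriv ?_
          ring) (by simp) (by simp [k, Real.sin_int_mul_pi])
    have p0' : ∫ x in (0 : ℝ)..1, observerGain ε Φ x * p x = -ε * p 0 := by
      rw [p0, ← intervalIntegral.integral_const_mul]
      refine intervalIntegral.integral_congr fun x _ => ?_
      simp only [observerGain]; ring
    have dec := h.integral_decay hlam cφ cp cp' cp'' hp hp' ode p1 p0' h₁ h₂
    rw [tr₁ p _ cp hs, tr₂ p _ cp hs, dec, mul_pow]
    refine mul_le_mul_of_nonneg_right ?_ (sq_nonneg _)
    rw [← Real.exp_nat_mul, Real.exp_le_exp]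
    -- Diffusion only adds to the rate and is discarded.
    have : 0 ≤ ε * k ^ 2 * (τ₂ - τ₁) := mul_nonneg (by positivity) (by linarith)
    push_cast
    nlinarith
  have hw : ∫ x in (0 : ℝ)..1, w₂ x ^ 2
      ≤ Real.exp (-2 * c * (τ₂ - τ₁)) * ∫ x in (0 : ℝ)..1, w₁ x ^ 2 :=
    hasSum_le coeff (hasSum_sq_integral_sin cw₂) ((hasSum_sq_integral_sin cw₁).mul_left _)
  calc ∫ x in (0 : ℝ)..1, e x τ₂ ^ 2 ≤ B * ∫ x in (0 : ℝ)..1, w₂ x ^ 2 := lo₂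
    _ ≤ B * (Real.exp (-2 * c * (τ₂ - τ₁)) * (A * ∫ x in (0 : ℝ)..1, e x τ₁ ^ 2)) := by
      gcongr; exact hw.trans (by gcongr)
    _ = _ := by ring

/-! ### `L²` norms and the initial time -/

/-- Subadditivity of the square root, applied to the subadditivity of the integral over a union. -/
theorem eLpNorm_two_restrict_union_le (f : ℝ → ℝ) (s t : Set ℝ) :
    eLpNorm f 2 (volume.restrict (s ∪ t))
      ≤ eLpNorm f 2 (volume.restrict s) + eLpNorm f 2 (volume.restrict t) := by
  simp only [eLpNorm_eq_lintegral_rpow_enorm_toReal two_ne_zero ENNReal.ofNat_ne_top]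
  refine le_trans ?_ (ENNReal.rpow_add_le_add_rpow _ _ (by norm_num) (by norm_num))
  exact ENNReal.rpow_le_rpow (lintegral_union_le _ s t) (by norm_num)

theorem eLpNorm_two_eq_sqrt_integral {f : ℝ → ℝ} (hf : ContinuousOn f (Icc 0 1)) :
    eLpNorm f 2 (volume.restrict (Ioo 0 1))
      = ENNReal.ofReal (Real.sqrt (∫ x in (0 : ℝ)..1, f x ^ 2)) := by
  obtain ⟨M, hM⟩ := isCompact_Icc.exists_bound_of_continuousOn hf
  have hmem : MemLp f 2 (volume.restrict (Ioo 0 1)) := by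
    refine MemLp.of_bound ((hf.mono Ioo_subset_Icc_self).aestronglyMeasurable measurableSet_Ioo) M ?_
    exact (ae_restrict_iff' measurableSet_Ioo).2
      (Eventually.of_forall fun x hx => hM x (Ioo_subset_Icc_self hx))
  rw [hmem.eLpNorm_eq_integral_rpow_norm two_ne_zero ENNReal.ofNat_ne_top]
  congr 1
  rw [Real.sqrt_eq_rpow, intervalIntegral.integral_of_le zero_le_one, integral_Ioc_eq_integral_Ioo]
  simp

/-- The equation holds only after `t₀`, so the estimate starts from `τ > t₀`. The triangle
inequality compares `e(τ)` with `e(t₀)`, and `L²` attainment removes the difference as `τ → t₀`. -/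
theorem eLpNorm_decay_of_integral_sq_decay {c C t₀ : ℝ} (hC : 0 < C) {e : ℝ → ℝ → ℝ}
    (ce : ContinuousOn (fun p : ℝ × ℝ => e p.1 p.2) (Icc 0 1 ×ˢ Ioi t₀))
    (hinit : HasL2InitialValue e 0 1 t₀)
    (dec : ∀ τ₁ τ₂, t₀ < τ₁ → τ₁ ≤ τ₂ → ∫ x in (0 : ℝ)..1, e x τ₂ ^ 2
      ≤ C * Real.exp (-2 * c * (τ₂ - τ₁)) * ∫ x in (0 : ℝ)..1, e x τ₁ ^ 2) {t : ℝ} (ht : t₀ ≤ t) :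
    eLpNorm (fun x => e x t) 2 (volume.restrict (Ioo 0 1))
      ≤ ENNReal.ofReal (max 1 (Real.sqrt C) * Real.exp (-c * (t - t₀)))
        * eLpNorm (fun x => e x t₀) 2 (volume.restrict (Ioo 0 1)) := by
  set D := max 1 (Real.sqrt C)
  -- At `t = t₀` nothing is gained, and the constant must be at least one; hence the maximum with
  -- `1` in `D`.
  rcases ht.eq_or_lt with rfl | ht
  · simp only [sub_self, mul_zero, Real.exp_zero, mul_one]
    refine le_mul_of_one_le_left zero_le ?_
    rw [← ENNReal.ofReal_one]
    exact ENNReal.ofReal_le_ofReal (le_max_left _ _)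
  have cet : ∀ t, t₀ < t → ContinuousOn (fun x => e x t) (Icc 0 1) := fun t ht =>
    ce.comp (f := fun x : ℝ => (x, t)) (by fun_prop) fun x hx => ⟨hx, ht⟩
  have step : ∀ τ ∈ Ioo t₀ t, eLpNorm (fun x => e x t) 2 (volume.restrict (Ioo 0 1))
      ≤ ENNReal.ofReal (D * Real.exp (-c * (t - τ)))
        * (eLpNorm (fun x => e x τ - e x t₀) 2 (volume.restrict (Ioo 0 1))
          + eLpNorm (fun x => e x t₀) 2 (volume.restrict (Ioo 0 1))) := by
    intro τ hτ
    have h1 : eLpNorm (fun x => e x t) 2 (volume.restrict (Ioo 0 1))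
        ≤ ENNReal.ofReal (D * Real.exp (-c * (t - τ)))
          * eLpNorm (fun x => e x τ) 2 (volume.restrict (Ioo 0 1)) := by
      rw [eLpNorm_two_eq_sqrt_integral (cet t ht), eLpNorm_two_eq_sqrt_integral (cet τ hτ.1),
        ← ENNReal.ofReal_mul (by positivity)]
      refine ENNReal.ofReal_le_ofReal ?_
      refine (Real.sqrt_le_sqrt (dec τ t hτ.1 hτ.2.le)).trans ?_
      rw [Real.sqrt_mul (by positivity), Real.sqrt_mul hC.le]
      have : Real.sqrt (Real.exp (-2 * c * (t - τ))) = Real.exp (-c * (t - τ)) := by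
        rw [← Real.exp_half]; congr 1; ring
      rw [this]
      gcongr
      exact le_max_right _ _
    refine h1.trans (mul_le_mul_right ?_ _)
    have m1 : AEStronglyMeasurable (fun x => e x τ) (volume.restrict (Ioo 0 1)) :=
      ((cet τ hτ.1).mono Ioo_subset_Icc_self).aestronglyMeasurable measurableSet_Ioo
    have h2 := eLpNorm_add_le (p := 2) (m1.sub hinit.memLp.1) hinit.memLp.1 one_le_two
    refine (le_of_eq ?_).trans h2
    congr 1
    funext x
    simp
  have lim : Tendsto (fun τ => ENNReal.ofReal (D * Real.exp (-c * (t - τ)))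
        * (eLpNorm (fun x => e x τ - e x t₀) 2 (volume.restrict (Ioo 0 1))
          + eLpNorm (fun x => e x t₀) 2 (volume.restrict (Ioo 0 1)))) (𝓝[>] t₀)
      (𝓝 (ENNReal.ofReal (D * Real.exp (-c * (t - t₀)))
        * (0 + eLpNorm (fun x => e x t₀) 2 (volume.restrict (Ioo 0 1))))) := by
    refine ENNReal.Tendsto.mul ?_ (Or.inr ?_) (hinit.tendsto.add tendsto_const_nhds)
      (Or.inr ENNReal.ofReal_ne_top)
    · refine (ENNReal.continuous_ofReal.tendsto _).comp ?_
      have : Continuous fun τ => D * Real.exp (-c * (t - τ)) := by fun_prop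
      exact (this.tendsto t₀).mono_left nhdsWithin_le_nhds
    · rw [zero_add]; exact hinit.memLp.2.ne
  rw [zero_add] at lim
  refine ge_of_tendsto lim ?_
  filter_upwards [Ioo_mem_nhdsGT ht] with τ hτ using step τ hτ

theorem measurableEmbedding_affine (y₀ : ℝ) {s : ℝ} (hs : s ≠ 0) :
    MeasurableEmbedding fun x : ℝ => y₀ + s * x :=
  (measurableEmbedding_addLeft y₀).comp (measurableEmbedding_mulLeft₀ hs)

theorem map_affine_restrict_Ioo {y₀ s : ℝ} (hs : s ≠ 0) {J : Set ℝ} (hJ : MeasurableSet J)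
    (hpre : (fun x => y₀ + s * x) ⁻¹' J = Ioo 0 1) :
    (volume.restrict (Ioo (0 : ℝ) 1)).map (fun x : ℝ => y₀ + s * x)
      = ENNReal.ofReal |s⁻¹| • volume.restrict J := by
  have e : (fun x : ℝ => y₀ + s * x) = (fun x => y₀ + x) ∘ (fun x => s * x) := rfl
  rw [← hpre, ← Measure.restrict_map (measurableEmbedding_affine y₀ hs).measurable hJ, e,
    ← Measure.map_map (by fun_prop) (by fun_prop), Real.map_volume_mul_left hs,
    Measure.map_smul, map_add_left_eq_self, Measure.restrict_smul]

theorem eLpNorm_comp_affine {y₀ s : ℝ} (hs : s ≠ 0) {J : Set ℝ} (hJ : MeasurableSet J)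
    (hpre : (fun x => y₀ + s * x) ⁻¹' J = Ioo 0 1) (f : ℝ → ℝ) :
    eLpNorm (fun x => f (y₀ + s * x)) 2 (volume.restrict (Ioo 0 1))
      = ENNReal.ofReal |s⁻¹| ^ (1 / (2 : ENNReal)).toReal * eLpNorm f 2 (volume.restrict J) := by
  have h := (measurableEmbedding_affine y₀ hs).eLpNorm_map_measure (g := f) (p := 2)
    (μ := volume.restrict (Ioo 0 1))
  rw [map_affine_restrict_Ioo hs hJ hpre, eLpNorm_smul_measure_of_ne_top ENNReal.ofNat_ne_top,
    smul_eq_mul] at h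
  exact h.symm

theorem memLp_comp_affine {y₀ s : ℝ} (hs : s ≠ 0) {J : Set ℝ} (hJ : MeasurableSet J)
    (hpre : (fun x => y₀ + s * x) ⁻¹' J = Ioo 0 1) {f : ℝ → ℝ}
    (hf : MemLp f 2 (volume.restrict J)) :
    MemLp (fun x => f (y₀ + s * x)) 2 (volume.restrict (Ioo 0 1)) := by
  refine ⟨?_, ?_⟩
  · have m : AEStronglyMeasurable f (Measure.map (fun x : ℝ => y₀ + s * x)
        (volume.restrict (Ioo 0 1))) := by
      rw [map_affine_restrict_Ioo hs hJ hpre]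
      exact hf.1.smul_measure _
    exact m.comp_measurable (measurableEmbedding_affine y₀ hs).measurable
  · rw [eLpNorm_comp_affine hs hJ hpre]
    exact ENNReal.mul_lt_top (ENNReal.rpow_lt_top_of_nonneg (by norm_num) ENNReal.ofReal_ne_top) hf.2

/-! ### The gauge transformation -/

section Gauge
variable {ε t₀ : ℝ} {ν lamBar : ℝ → ℝ} {Ubar : Fin 2 → ℝ → ℝ} {ubar : ℝ → ℝ → ℝ}

/-- Extending `ν` continuously to the line makes the exponent a genuine primitive, with a two-sided
derivative at interior points and continuity at the ends. -/
theorem exists_gaugeExp_extension (ε : ℝ) (hν : ContinuousOn ν (Icc (-1) 1)) :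
    ∃ g : ℝ → ℝ, Continuous g ∧ (∀ y ∈ Icc (-1 : ℝ) 1, gaugeExp ε ν y = g y) ∧
      ∀ y ∈ Ioo (-1 : ℝ) 1, HasDerivAt g (ν y / (2 * ε)) y := by
  obtain ⟨n, cn, hn⟩ := exists_continuous_extension_Icc (by norm_num) hν
  have cn' : Continuous fun z => n z / (2 * ε) := cn.div_const _
  refine ⟨fun y => ∫ z in (-1 : ℝ)..y, n z / (2 * ε), ?_, fun y hy => ?_, fun y hy => ?_⟩
  · exact continuous_iff_continuousAt.2 fun y => (hasDerivAt_integral_upper cn' (-1) y).continuousAt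
  · refine intervalIntegral.integral_congr fun z hz => ?_
    rw [uIcc_of_le hy.1] at hz
    simp only [hn z ⟨hz.1, hz.2.trans hy.2⟩]
  · rw [← hn y (Ioo_subset_Icc_self hy)]
    exact hasDerivAt_integral_upper cn' (-1) y

theorem hasDerivAt_gaugeExp (hν : ContinuousOn ν (Icc (-1) 1)) {y : ℝ} (hy : y ∈ Ioo (-1 : ℝ) 1) :
    HasDerivAt (gaugeExp ε ν) (ν y / (2 * ε)) y := by
  obtain ⟨g, -, hg, hd⟩ := exists_gaugeExp_extension ε hν
  refine (hd y hy).congr_of_eventuallyEq ?_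
  filter_upwards [Ioo_mem_nhds hy.1 hy.2] with z hz using hg z (Ioo_subset_Icc_self hz)

theorem continuousOn_gaugeExp (hν : ContinuousOn ν (Icc (-1) 1)) :
    ContinuousOn (gaugeExp ε ν) (Icc (-1) 1) := by
  obtain ⟨g, cg, hg, -⟩ := exists_gaugeExp_extension ε hν
  exact cg.continuousOn.congr hg

theorem IsPlantSolution.hasDerivAt_gauged (hν : ContDiffOn ℝ 1 ν (Icc (-1) 1))
    (h : IsPlantSolution ε ν lamBar Ubar t₀ ubar) {y t : ℝ} (hy : y ∈ Ioo (-1 : ℝ) 1) (ht : t > t₀) :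
    HasDerivAt (fun z => gauged ε ν ubar z t)
      (Real.exp (gaugeExp ε ν y) * (ν y / (2 * ε) * ubar y t + pdX ubar y t)) y := by
  have d := (hasDerivAt_gaugeExp (ε := ε) hν.continuousOn hy).exp.mul
    (h.regular.diff_x y hy t ht).hasDerivAt
  refine d.congr_deriv ?_
  simp only [pdX]; ring

theorem IsPlantSolution.pdX_gauged (hν : ContDiffOn ℝ 1 ν (Icc (-1) 1))
    (h : IsPlantSolution ε ν lamBar Ubar t₀ ubar) {y t : ℝ} (hy : y ∈ Ioo (-1 : ℝ) 1) (ht : t > t₀) :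
    pdX (gauged ε ν ubar) y t
      = Real.exp (gaugeExp ε ν y) * (ν y / (2 * ε) * ubar y t + pdX ubar y t) :=
  (h.hasDerivAt_gauged hν hy ht).deriv

theorem IsPlantSolution.hasDerivAt_pdX_gauged (hν : ContDiffOn ℝ 1 ν (Icc (-1) 1))
    (h : IsPlantSolution ε ν lamBar Ubar t₀ ubar) {y t : ℝ} (hy : y ∈ Ioo (-1 : ℝ) 1) (ht : t > t₀) :
    HasDerivAt (fun z => pdX (gauged ε ν ubar) z t)
      (Real.exp (gaugeExp ε ν y) * ((ν y / (2 * ε)) ^ 2 * ubar y t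
        + derivWithin ν (Icc (-1) 1) y / (2 * ε) * ubar y t
        + 2 * (ν y / (2 * ε)) * pdX ubar y t + pdXX ubar y t)) y := by
  have dν : HasDerivAt ν (derivWithin ν (Icc (-1) 1) y) y :=
    ((hν.differentiableOn one_ne_zero y (Ioo_subset_Icc_self hy)).hasDerivWithinAt).hasDerivAt
      (Icc_mem_nhds hy.1 hy.2)
  have d1 := (h.regular.diff_x y hy t ht).hasDerivAt
  have d2 := (h.regular.diff_xx y hy t ht).hasDerivAt
  have d := (hasDerivAt_gaugeExp (ε := ε) hν.continuousOn hy).exp.mul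
    (((dν.div_const (2 * ε)).mul d1).add d2)
  have d' := d.congr_of_eventuallyEq (f₁ := fun z => pdX (gauged ε ν ubar) z t) (by
    filter_upwards [Ioo_mem_nhds hy.1 hy.2] with z hz using h.pdX_gauged hν hz ht)
  refine d'.congr_deriv ?_
  simp only [Pi.add_apply, Pi.mul_apply, pdXX, pdX]
  ring

theorem IsPlantSolution.pdXX_gauged (hν : ContDiffOn ℝ 1 ν (Icc (-1) 1))
    (h : IsPlantSolution ε ν lamBar Ubar t₀ ubar) {y t : ℝ} (hy : y ∈ Ioo (-1 : ℝ) 1) (ht : t > t₀) :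
    pdXX (gauged ε ν ubar) y t
      = Real.exp (gaugeExp ε ν y) * ((ν y / (2 * ε)) ^ 2 * ubar y t
        + derivWithin ν (Icc (-1) 1) y / (2 * ε) * ubar y t
        + 2 * (ν y / (2 * ε)) * pdX ubar y t + pdXX ubar y t) :=
  (h.hasDerivAt_pdX_gauged hν hy ht).deriv

theorem IsPlantSolution.hasDerivAt_time_gauged
    (h : IsPlantSolution ε ν lamBar Ubar t₀ ubar) {y t : ℝ} (hy : y ∈ Ioo (-1 : ℝ) 1) (ht : t > t₀) :
    HasDerivAt (fun s => gauged ε ν ubar y s) (Real.exp (gaugeExp ε ν y) * pdT ubar y t) t :=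
  (h.regular.diff_t y hy t ht).hasDerivAt.const_mul _

theorem IsPlantSolution.pdT_gauged
    (h : IsPlantSolution ε ν lamBar Ubar t₀ ubar) {y t : ℝ} (hy : y ∈ Ioo (-1 : ℝ) 1) (ht : t > t₀) :
    pdT (gauged ε ν ubar) y t = Real.exp (gaugeExp ε ν y) * pdT ubar y t :=
  (h.hasDerivAt_time_gauged hy ht).deriv

/-- With `g' = ν/(2ε)` the cross term `2ε g' ū_y` is exactly the advection `ν ū_y`, while `ε(g'² +
g'') = ν²/(4ε) + ν'/2` is what the definition of `reaction` subtracts. -/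
theorem IsPlantSolution.pde_gauged (hε : 0 < ε) (hν : ContDiffOn ℝ 1 ν (Icc (-1) 1))
    (h : IsPlantSolution ε ν lamBar Ubar t₀ ubar) {y t : ℝ} (hy : y ∈ Ioo (-1 : ℝ) 1) (ht : t > t₀) :
    pdT (gauged ε ν ubar) y t = ε * pdXX (gauged ε ν ubar) y t
      + reaction ε ν lamBar y * gauged ε ν ubar y t := by
  rw [h.pdT_gauged hy ht, h.pdXX_gauged hν hy ht, h.pde y hy t ht, reaction, gauged]
  field_simp
  ring

theorem IsPlantSolution.continuousOn_gauged (hν : ContDiffOn ℝ 1 ν (Icc (-1) 1))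
    (h : IsPlantSolution ε ν lamBar Ubar t₀ ubar) :
    ContinuousOn (fun p : ℝ × ℝ => gauged ε ν ubar p.1 p.2) (Icc (-1) 1 ×ˢ Ioi t₀) := by
  have cg : ContinuousOn (fun p : ℝ × ℝ => gaugeExp ε ν p.1) (Icc (-1) 1 ×ˢ Ioi t₀) :=
    (continuousOn_gaugeExp hν.continuousOn).comp continuousOn_fst fun p hp => hp.1
  exact (Real.continuous_exp.comp_continuousOn cg).mul h.cont

theorem IsPlantSolution.isC21On_gauged (hν : ContDiffOn ℝ 1 ν (Icc (-1) 1))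
    (h : IsPlantSolution ε ν lamBar Ubar t₀ ubar) :
    IsC21On (gauged ε ν ubar) (Ioo (-1) 1) t₀ := by
  have sub : Ioo (-1 : ℝ) 1 ×ˢ Ioi t₀ ⊆ Icc (-1) 1 ×ˢ Ioi t₀ := prod_mono_left Ioo_subset_Icc_self
  have lift : ∀ {f : ℝ → ℝ}, ContinuousOn f (Icc (-1) 1) →
      ContinuousOn (fun p : ℝ × ℝ => f p.1) (Ioo (-1) 1 ×ˢ Ioi t₀) := fun hf =>
    hf.comp continuousOn_fst fun p hp => Ioo_subset_Icc_self hp.1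
  have cexp : ContinuousOn (fun p : ℝ × ℝ => Real.exp (gaugeExp ε ν p.1))
      (Ioo (-1) 1 ×ˢ Ioi t₀) :=
    Real.continuous_exp.comp_continuousOn (lift (continuousOn_gaugeExp hν.continuousOn))
  have cν := lift hν.continuousOn
  have cν' := lift (hν.continuousOn_derivWithin (uniqueDiffOn_Icc (by norm_num)) le_rfl)
  have cu := h.cont.mono sub
  refine ⟨fun y hy t ht => (h.hasDerivAt_gauged hν hy ht).differentiableAt,
    fun y hy t ht => (h.hasDerivAt_pdX_gauged hν hy ht).differentiableAt,
    fun y hy t ht => (h.hasDerivAt_time_gauged hy ht).differentiableAt, ?_, ?_, ?_⟩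
  · exact (cexp.mul (((cν.div_const (2 * ε)).mul cu).add h.regular.cont_x)).congr
      fun p hp => h.pdX_gauged hν hp.1 hp.2
  · exact (cexp.mul ((((((cν.div_const (2 * ε)).pow 2).mul cu).add
      ((cν'.div_const (2 * ε)).mul cu)).add
      ((continuousOn_const.mul (cν.div_const (2 * ε))).mul h.regular.cont_x)).add
      h.regular.cont_xx)).congr fun p hp => h.pdXX_gauged hν hp.1 hp.2
  · exact (cexp.mul h.regular.cont_t).congr fun p hp => h.pdT_gauged hp.1 hp.2

theorem exists_gaugeExp_bound (hν : ContinuousOn ν (Icc (-1) 1)) :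
    ∃ K : ℝ, 0 < K ∧ ∀ y ∈ Icc (-1 : ℝ) 1,
      Real.exp (gaugeExp ε ν y) ≤ K ∧ Real.exp (-gaugeExp ε ν y) ≤ K := by
  obtain ⟨B, hB⟩ := isCompact_Icc.exists_bound_of_continuousOn (continuousOn_gaugeExp (ε := ε) hν)
  refine ⟨Real.exp B, Real.exp_pos _, fun y hy => ?_⟩
  have := abs_le.1 (hB y hy)
  constructor <;> rw [Real.exp_le_exp] <;> linarith

theorem hasL2InitialValue_gauged (hν : ContDiffOn ℝ 1 ν (Icc (-1) 1))
    (h : HasL2InitialValue ubar (-1) 1 t₀) :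
    HasL2InitialValue (gauged ε ν ubar) (-1) 1 t₀ := by
  obtain ⟨K, hK, hb⟩ := exists_gaugeExp_bound (ε := ε) hν.continuousOn
  have hbd : ∀ t, ∀ᵐ y ∂(volume.restrict (Ioo (-1 : ℝ) 1)),
      ‖gauged ε ν ubar y t - gauged ε ν ubar y t₀‖ ≤ K * ‖ubar y t - ubar y t₀‖ := fun t =>
    (ae_restrict_iff' measurableSet_Ioo).2 (Eventually.of_forall fun y hy => by
      rw [gauged, gauged, ← mul_sub, norm_mul, Real.norm_eq_abs (Real.exp _), Real.abs_exp]
      exact mul_le_mul_of_nonneg_right (hb y (Ioo_subset_Icc_self hy)).1 (norm_nonneg _))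
  refine ⟨?_, ?_⟩
  · have m : AEStronglyMeasurable (fun y => Real.exp (gaugeExp ε ν y))
        (volume.restrict (Ioo (-1) 1)) :=
      (Real.continuous_exp.comp_continuousOn ((continuousOn_gaugeExp hν.continuousOn).mono
        Ioo_subset_Icc_self)).aestronglyMeasurable measurableSet_Ioo
    refine h.memLp.of_le_mul (c := K) (m.mul h.memLp.1) ?_
    refine (ae_restrict_iff' measurableSet_Ioo).2 (Eventually.of_forall fun y hy => ?_)
    rw [gauged, norm_mul, Real.norm_eq_abs (Real.exp _), Real.abs_exp]
    exact mul_le_mul_of_nonneg_right (hb y (Ioo_subset_Icc_self hy)).1 (norm_nonneg _)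
  · have lim := ENNReal.Tendsto.const_mul (a := ENNReal.ofReal K) h.tendsto
      (Or.inr ENNReal.ofReal_ne_top)
    rw [mul_zero] at lim
    exact tendsto_of_tendsto_of_tendsto_of_le_of_le tendsto_const_nhds lim (fun _ => zero_le)
      fun t => eLpNorm_le_mul_eLpNorm_of_ae_le_mul (hbd t) 2

end Gauge

/-! ### Folding -/

section Fold
variable {y₀ : ℝ}

/-- The open pieces `(-1, y₀)` and `(y₀, 1)`. -/
def foldPiece (y₀ : ℝ) (i : Fin 2) : Set ℝ := ![Ioo (-1) y₀, Ioo y₀ 1] i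

theorem foldSlope_ne_zero (hy₀ : y₀ ∈ Ioo (-1 : ℝ) 1) (i : Fin 2) : foldSlope y₀ i ≠ 0 := by
  have := hy₀.1
  have := hy₀.2
  fin_cases i <;> simp [foldSlope] <;> intro <;> linarith

theorem fold_mem_Icc (hy₀ : y₀ ∈ Ioo (-1 : ℝ) 1) (i : Fin 2) {x : ℝ} (hx : x ∈ Icc (0 : ℝ) 1) :
    y₀ + foldSlope y₀ i * x ∈ Icc (-1 : ℝ) 1 := by
  obtain ⟨h1, h2⟩ := hy₀
  obtain ⟨h3, h4⟩ := hx
  fin_cases i <;> simp [foldSlope] <;> constructor <;> nlinarith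

theorem fold_mem_Ioo (hy₀ : y₀ ∈ Ioo (-1 : ℝ) 1) (i : Fin 2) {x : ℝ} (hx : x ∈ Ico (0 : ℝ) 1) :
    y₀ + foldSlope y₀ i * x ∈ Ioo (-1 : ℝ) 1 := by
  obtain ⟨h1, h2⟩ := hy₀
  obtain ⟨h3, h4⟩ := hx
  fin_cases i <;> simp [foldSlope] <;> constructor <;> nlinarith

theorem fold_one (i : Fin 2) : y₀ + foldSlope y₀ i * 1 = ![-1, 1] i := by
  fin_cases i <;> simp [foldSlope]

theorem measurableSet_foldPiece (i : Fin 2) : MeasurableSet (foldPiece y₀ i) := by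
  fin_cases i <;> simp [foldPiece]

theorem foldPiece_subset (hy₀ : y₀ ∈ Ioo (-1 : ℝ) 1) (i : Fin 2) :
    foldPiece y₀ i ⊆ Ioo (-1 : ℝ) 1 := by
  fin_cases i
  · exact Ioo_subset_Ioo_right hy₀.2.le
  · exact Ioo_subset_Ioo_left hy₀.1.le

theorem preimage_foldPiece (hy₀ : y₀ ∈ Ioo (-1 : ℝ) 1) (i : Fin 2) :
    (fun x => y₀ + foldSlope y₀ i * x) ⁻¹' foldPiece y₀ i = Ioo 0 1 := by
  obtain ⟨h1, h2⟩ := hy₀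
  ext x
  fin_cases i
  · simp only [foldSlope, foldPiece, mem_preimage, mem_Ioo, Fin.zero_eta, Matrix.cons_val_zero]
    constructor <;> rintro ⟨h3, h4⟩ <;> constructor <;> nlinarith
  · simp only [foldSlope, foldPiece, mem_preimage, mem_Ioo, Fin.mk_one, Matrix.cons_val_one]
    simp only [Matrix.cons_val_fin_one]
    constructor <;> rintro ⟨h3, h4⟩ <;> constructor <;> nlinarith

theorem contDiffOn_foldReaction {lam : ℝ → ℝ} (hy₀ : y₀ ∈ Ioo (-1 : ℝ) 1)
    (hlam : ContDiffOn ℝ 1 lam (Icc (-1) 1)) (i : Fin 2) :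
    ContDiffOn ℝ 1 (foldReaction lam y₀ i) (Icc 0 1) :=
  hlam.comp (f := fun x => y₀ + foldSlope y₀ i * x) (by fun_prop) fun _ hx => fold_mem_Icc hy₀ i hx

theorem unfolded_fold (hy₀ : y₀ ∈ Ioo (-1 : ℝ) 1) (uhat : Fin 2 → ℝ → ℝ → ℝ) (i : Fin 2) {x : ℝ}
    (hx : x ∈ Ioo (0 : ℝ) 1) (t : ℝ) :
    unfolded y₀ uhat (y₀ + foldSlope y₀ i * x) t = uhat i x t := by
  obtain ⟨h1, h2⟩ := hy₀
  obtain ⟨h3, h4⟩ := hx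
  have n1 : 1 + y₀ ≠ 0 := by linarith
  have n2 : 1 - y₀ ≠ 0 := by linarith
  fin_cases i
  · have e : y₀ + foldSlope y₀ 0 * x = y₀ - (1 + y₀) * x := by simp [foldSlope]; ring
    simp only [unfolded, Fin.zero_eta, e]
    rw [if_pos (by nlinarith)]
    congr 1
    field_simp
    ring
  · have e : y₀ + foldSlope y₀ 1 * x = y₀ + (1 - y₀) * x := by simp [foldSlope]
    simp only [unfolded, Fin.mk_one, e]
    rw [if_neg (by nlinarith)]
    congr 1
    field_simp
    ring

/-- The estimation error on one folded piece. -/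
noncomputable def foldError (ε : ℝ) (ν : ℝ → ℝ) (y₀ : ℝ) (ubar : ℝ → ℝ → ℝ)
    (uhat : Fin 2 → ℝ → ℝ → ℝ) (i : Fin 2) (x t : ℝ) : ℝ :=
  gauged ε ν ubar (y₀ + foldSlope y₀ i * x) t - uhat i x t

variable {ε t₀ : ℝ} {ν lamBar : ℝ → ℝ} {Ubar : Fin 2 → ℝ → ℝ} {ubar : ℝ → ℝ → ℝ}
  {uhat : Fin 2 → ℝ → ℝ → ℝ} {Φ : Fin 2 → ℝ → ℝ → ℝ}

/-- Folding by slope `s` multiplies second derivatives by `s²`, which the folded diffusion `ε/s²`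
compensates. Measurements and inputs cancel those of the plant: the value at the fold and the
boundary input give zero ends, and the measured slope turns the injection into `-φ e_x(0,t)`. -/
theorem isErrorSystem_foldError (hε : 0 < ε) (hν : ContDiffOn ℝ 1 ν (Icc (-1) 1))
    (hy₀ : y₀ ∈ Ioo (-1 : ℝ) 1) (hu : IsPlantSolution ε ν lamBar Ubar t₀ ubar)
    (hv : IsObserverSolution ε ν lamBar y₀ Φ Ubar ubar t₀ uhat) (i : Fin 2) :
    IsErrorSystem (foldDiff ε y₀ i) (foldReaction (reaction ε ν lamBar) y₀ i)
      (observerGain (foldDiff ε y₀ i) (Φ i)) t₀ (foldError ε ν y₀ ubar uhat i)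
      (fun x t => foldSlope y₀ i * pdX (gauged ε ν ubar) (y₀ + foldSlope y₀ i * x) t
        - derivWithin (fun z => uhat i z t) (Icc 0 1) x)
      (fun x t => foldSlope y₀ i ^ 2 * pdXX (gauged ε ν ubar) (y₀ + foldSlope y₀ i * x) t
        - pdXX (uhat i) x t)
      (fun x t => pdT (gauged ε ν ubar) (y₀ + foldSlope y₀ i * x) t - pdT (uhat i) x t) := by
  have v := hv i
  have g := hu.isC21On_gauged hν
  set s := foldSlope y₀ i with hs
  have hs0 : s ≠ 0 := foldSlope_ne_zero hy₀ i
  have cA : Continuous fun p : ℝ × ℝ => (y₀ + s * p.1, p.2) := by fun_prop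
  have mIoo : ∀ x ∈ Ioo (0 : ℝ) 1, y₀ + s * x ∈ Ioo (-1 : ℝ) 1 := fun x hx =>
    fold_mem_Ioo hy₀ i ⟨hx.1.le, hx.2⟩
  have dA : ∀ x, HasDerivAt (fun z => y₀ + s * z) s x := fun x => by
    simpa using! ((hasDerivAt_id x).const_mul s).const_add y₀
  have dW : ∀ x ∈ Ioo (0 : ℝ) 1, ∀ t,
      derivWithin (fun z => uhat i z t) (Icc 0 1) x = pdX (uhat i) x t := fun x hx t =>
    derivWithin_of_mem_nhds (Icc_mem_nhds hx.1 hx.2)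
  refine ⟨?_, ?_, ?_, ?_, fun x hx t ht => ?_, fun x hx t ht => ?_, fun x hx t ht => ?_,
    fun x hx t ht => ?_, fun t ht => ?_, fun t ht => ?_⟩
  · exact ((hu.continuousOn_gauged hν).comp cA.continuousOn fun p hp =>
      ⟨fold_mem_Icc hy₀ i hp.1, hp.2⟩).sub v.cont
  · exact (continuousOn_const.mul (g.cont_x.comp cA.continuousOn fun p hp =>
      ⟨fold_mem_Ioo hy₀ i hp.1, hp.2⟩)).sub v.cont_slope
  · exact (continuousOn_const.mul (g.cont_xx.comp cA.continuousOn fun p hp =>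
      ⟨mIoo _ hp.1, hp.2⟩)).sub v.regular.cont_xx
  · exact (g.cont_t.comp cA.continuousOn fun p hp => ⟨mIoo _ hp.1, hp.2⟩).sub v.regular.cont_t
  · have d1 := HasDerivAt.comp x (g.diff_x _ (mIoo x hx) t ht).hasDerivAt (dA x)
    have d2 := (v.regular.diff_x x hx t ht).hasDerivAt
    rw [dW x hx t]
    refine (d1.sub d2).congr_deriv ?_
    simp only [pdX]; ring
  · have d1 := (HasDerivAt.comp x (g.diff_xx _ (mIoo x hx) t ht).hasDerivAt (dA x)).const_mul s
    have d2 := (v.regular.diff_xx x hx t ht).hasDerivAt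
    have d3 := (d1.sub d2).congr_of_eventuallyEq
      (f₁ := fun z => s * pdX (gauged ε ν ubar) (y₀ + s * z) t
        - derivWithin (fun z => uhat i z t) (Icc 0 1) z) (by
        filter_upwards [Ioo_mem_nhds hx.1 hx.2] with z hz
        rw [dW z hz t]; rfl)
    refine d3.congr_deriv ?_
    simp only [pdXX]; ring
  · exact (g.diff_t _ (mIoo x hx) t ht).hasDerivAt.sub (v.regular.diff_t x hx t ht).hasDerivAt
  · rw [hu.pde_gauged hε hν (mIoo x hx) ht, v.pde x hx t ht]
    simp only [foldError, foldReaction, foldDiff, mul_zero, add_zero, ← hs]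
    field_simp
    ring
  · simp only [foldError, mul_zero, add_zero]
    rw [v.left t ht, sub_self]
  · simp only [foldError]
    rw [v.right t ht, fold_one]
    fin_cases i
    · simp [gauged, gaugedInput, hu.left t ht]
    · simp [gauged, gaugedInput, hu.right t ht]

/-- Attainment of the initial value survives multiplication by the bounded gauge factor, restriction
to a piece, affine rescaling and subtraction. Measurability at later times is what the triangle
inequality needs. -/
theorem hasL2InitialValue_foldError (hν : ContDiffOn ℝ 1 ν (Icc (-1) 1))
    (hy₀ : y₀ ∈ Ioo (-1 : ℝ) 1) (hu : HasL2InitialValue ubar (-1) 1 t₀) (i : Fin 2)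
    (hv : HasL2InitialValue (uhat i) 0 1 t₀)
    (mu : ∀ t > t₀, AEStronglyMeasurable (fun y => gauged ε ν ubar y t)
      (volume.restrict (Ioo (-1) 1)))
    (mv : ∀ t > t₀, AEStronglyMeasurable (fun x => uhat i x t) (volume.restrict (Ioo 0 1))) :
    HasL2InitialValue (foldError ε ν y₀ ubar uhat i) 0 1 t₀ := by
  have hg := hasL2InitialValue_gauged (ε := ε) hν hu
  have hs := foldSlope_ne_zero hy₀ i
  have hJ := measurableSet_foldPiece (y₀ := y₀) i
  have hpre := preimage_foldPiece hy₀ i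
  have hle : volume.restrict (foldPiece y₀ i) ≤ volume.restrict (Ioo (-1) 1) :=
    Measure.restrict_mono (foldPiece_subset hy₀ i) le_rfl
  have mg := memLp_comp_affine hs hJ hpre (hg.memLp.mono_measure hle)
  refine ⟨mg.sub hv.memLp, ?_⟩
  set κ : ENNReal := ENNReal.ofReal |(foldSlope y₀ i)⁻¹| ^ (1 / (2 : ENNReal)).toReal
  have hκ : κ ≠ ⊤ := ENNReal.rpow_ne_top_of_nonneg (by norm_num) ENNReal.ofReal_ne_top
  have lim := (ENNReal.Tendsto.const_mul (a := κ) hg.tendsto (Or.inr hκ)).add hv.tendsto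
  rw [mul_zero, add_zero] at lim
  refine tendsto_of_tendsto_of_tendsto_of_le_of_le' tendsto_const_nhds lim
    (Eventually.of_forall fun _ => zero_le) ?_
  filter_upwards [self_mem_nhdsWithin] with t ht
  have mgt : AEStronglyMeasurable (fun x => gauged ε ν ubar (y₀ + foldSlope y₀ i * x) t)
      (volume.restrict (Ioo 0 1)) := by
    have m : AEStronglyMeasurable (fun y => gauged ε ν ubar y t)
        (Measure.map (fun x : ℝ => y₀ + foldSlope y₀ i * x) (volume.restrict (Ioo 0 1))) := by
      rw [map_affine_restrict_Ioo hs hJ hpre]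
      exact ((mu t ht).mono_measure hle).smul_measure _
    exact m.comp_measurable (measurableEmbedding_affine y₀ hs).measurable
  have tri := eLpNorm_sub_le (p := 2) (mgt.sub mg.1) ((mv t ht).sub hv.memLp.1) one_le_two
  have e := eLpNorm_comp_affine hs hJ hpre (fun y => gauged ε ν ubar y t - gauged ε ν ubar y t₀)
  refine le_trans (le_of_eq ?_) (tri.trans (add_le_add (e.le.trans ?_) le_rfl))
  · congr 1
    funext x
    simp only [foldError, Pi.sub_apply]
    ring
  · exact mul_le_mul_right (eLpNorm_mono_measure _ hle) _

theorem error_eq_foldError (ε : ℝ) (ν : ℝ → ℝ) (hy₀ : y₀ ∈ Ioo (-1 : ℝ) 1)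
    (ubar : ℝ → ℝ → ℝ) (uhat : Fin 2 → ℝ → ℝ → ℝ) (i : Fin 2) {x : ℝ} (hx : x ∈ Ioo (0 : ℝ) 1)
    (t : ℝ) :
    ubar (y₀ + foldSlope y₀ i * x) t - stateEstimate ε ν y₀ uhat (y₀ + foldSlope y₀ i * x) t
      = Real.exp (-gaugeExp ε ν (y₀ + foldSlope y₀ i * x)) * foldError ε ν y₀ ubar uhat i x t := by
  rw [stateEstimate, unfolded_fold hy₀ uhat i hx, foldError, gauged, mul_sub, ← mul_assoc,
    ← Real.exp_add]
  simp

/-- The gauge factor costs `K` in each direction, hence `K²`. The Jacobian factor `κ` of the fold is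
the same at both times and, being positive and finite, cancels. -/
theorem eLpNorm_foldPiece_le (hy₀ : y₀ ∈ Ioo (-1 : ℝ) 1)
    {K A : ℝ} (hK : 0 < K)
    (hb : ∀ y ∈ Icc (-1 : ℝ) 1, Real.exp (gaugeExp ε ν y) ≤ K ∧ Real.exp (-gaugeExp ε ν y) ≤ K)
    (i : Fin 2) {t : ℝ}
    (dec : eLpNorm (fun x => foldError ε ν y₀ ubar uhat i x t) 2 (volume.restrict (Ioo 0 1))
      ≤ ENNReal.ofReal A
        * eLpNorm (fun x => foldError ε ν y₀ ubar uhat i x t₀) 2 (volume.restrict (Ioo 0 1))) :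
    eLpNorm (fun y => ubar y t - stateEstimate ε ν y₀ uhat y t) 2
        (volume.restrict (foldPiece y₀ i))
      ≤ ENNReal.ofReal (K ^ 2) * ENNReal.ofReal A
        * eLpNorm (fun y => ubar y t₀ - stateEstimate ε ν y₀ uhat y t₀) 2
          (volume.restrict (foldPiece y₀ i)) := by
  have hs := foldSlope_ne_zero hy₀ i
  have hJ := measurableSet_foldPiece (y₀ := y₀) i
  have hpre := preimage_foldPiece hy₀ i
  set κ : ENNReal := ENNReal.ofReal |(foldSlope y₀ i)⁻¹| ^ (1 / (2 : ENNReal)).toReal with hκdef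
  have hκ : κ ≠ ⊤ := ENNReal.rpow_ne_top_of_nonneg (by norm_num) ENNReal.ofReal_ne_top
  have hκ0 : κ ≠ 0 := (ENNReal.rpow_pos (ENNReal.ofReal_pos.2 (abs_pos.2 (inv_ne_zero hs)))
    ENNReal.ofReal_ne_top).ne'
  set d : ℝ → ℝ → ℝ := fun t y => ubar y t - stateEstimate ε ν y₀ uhat y t
  have comp : ∀ t, eLpNorm (fun x => d t (y₀ + foldSlope y₀ i * x)) 2 (volume.restrict (Ioo 0 1))
      = κ * eLpNorm (d t) 2 (volume.restrict (foldPiece y₀ i)) := fun t =>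
    eLpNorm_comp_affine hs hJ hpre (d t)
  have mem : ∀ x ∈ Ioo (0 : ℝ) 1, y₀ + foldSlope y₀ i * x ∈ Icc (-1 : ℝ) 1 := fun x hx =>
    fold_mem_Icc hy₀ i (Ioo_subset_Icc_self hx)
  have up : eLpNorm (fun x => d t (y₀ + foldSlope y₀ i * x)) 2 (volume.restrict (Ioo 0 1))
      ≤ ENNReal.ofReal K
        * eLpNorm (fun x => foldError ε ν y₀ ubar uhat i x t) 2 (volume.restrict (Ioo 0 1)) := by
    refine eLpNorm_le_mul_eLpNorm_of_ae_le_mul ?_ 2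
    refine (ae_restrict_iff' measurableSet_Ioo).2 (Eventually.of_forall fun x hx => ?_)
    simp only [d]
    rw [error_eq_foldError ε ν hy₀ ubar uhat i hx, norm_mul, Real.norm_eq_abs (Real.exp _),
      Real.abs_exp]
    exact mul_le_mul_of_nonneg_right (hb _ (mem x hx)).2 (norm_nonneg _)
  have lo : eLpNorm (fun x => foldError ε ν y₀ ubar uhat i x t₀) 2 (volume.restrict (Ioo 0 1))
      ≤ ENNReal.ofReal K
        * eLpNorm (fun x => d t₀ (y₀ + foldSlope y₀ i * x)) 2 (volume.restrict (Ioo 0 1)) := by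
    refine eLpNorm_le_mul_eLpNorm_of_ae_le_mul ?_ 2
    refine (ae_restrict_iff' measurableSet_Ioo).2 (Eventually.of_forall fun x hx => ?_)
    simp only [d]
    have e : foldError ε ν y₀ ubar uhat i x t₀ = Real.exp (gaugeExp ε ν (y₀ + foldSlope y₀ i * x))
        * (ubar (y₀ + foldSlope y₀ i * x) t₀
          - stateEstimate ε ν y₀ uhat (y₀ + foldSlope y₀ i * x) t₀) := by
      rw [error_eq_foldError ε ν hy₀ ubar uhat i hx, ← mul_assoc, ← Real.exp_add]
      simp
    rw [e, norm_mul, Real.norm_eq_abs (Real.exp _), Real.abs_exp]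
    exact mul_le_mul_of_nonneg_right (hb _ (mem x hx)).1 (norm_nonneg _)
  rw [comp] at up lo
  have all : κ * eLpNorm (d t) 2 (volume.restrict (foldPiece y₀ i))
      ≤ κ * (ENNReal.ofReal (K ^ 2) * ENNReal.ofReal A
        * eLpNorm (d t₀) 2 (volume.restrict (foldPiece y₀ i))) := by
    calc _ ≤ ENNReal.ofReal K * (ENNReal.ofReal A * (ENNReal.ofReal K * (κ
            * eLpNorm (d t₀) 2 (volume.restrict (foldPiece y₀ i))))) := by
          refine up.trans (mul_le_mul_right (dec.trans (mul_le_mul_right lo _)) _)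
      _ = _ := by rw [pow_two, ENNReal.ofReal_mul hK.le]; ring
  exact (ENNReal.mul_le_mul_iff_right hκ0 hκ).1 all

end Fold

/-! ### ### Assembly of the two pieces -/

theorem theorem2 (ε : ℝ) (hε : 0 < ε) (ν lamBar : ℝ → ℝ)
    (hν : ContDiffOn ℝ 1 ν (Icc (-1) 1))
    (hlam : ContDiffOn ℝ 1 (reaction ε ν lamBar) (Icc (-1) 1))
    (y₀ : ℝ) (hy₀ : y₀ ∈ Ioo (-1 : ℝ) 1) (c : Fin 2 → ℝ) (hc : ∀ i, 0 < c i) :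
    (∀ i, ∃ Φ : ℝ → ℝ → ℝ, IsObserverKernel (foldDiff ε y₀ i)
      (foldReaction (reaction ε ν lamBar) y₀ i) (c i) Φ) ∧
    ∀ Φ : Fin 2 → ℝ → ℝ → ℝ,
      (∀ i, IsObserverKernel (foldDiff ε y₀ i)
        (foldReaction (reaction ε ν lamBar) y₀ i) (c i) (Φ i)) →
      ∃ C γ : ℝ, 0 < C ∧ 0 < γ ∧
        ∀ (t₀ : ℝ) (Ubar : Fin 2 → ℝ → ℝ) (ubar : ℝ → ℝ → ℝ) (uhat : Fin 2 → ℝ → ℝ → ℝ),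
          IsPlantSolution ε ν lamBar Ubar t₀ ubar →
          IsObserverSolution ε ν lamBar y₀ Φ Ubar ubar t₀ uhat →
          ∀ t ≥ t₀,
            eLpNorm (fun y => ubar y t - stateEstimate ε ν y₀ uhat y t) 2
                (volume.restrict (Ioo (-1) 1))
              ≤ ENNReal.ofReal (C * Real.exp (-γ * (t - t₀))) *
                eLpNorm (fun y => ubar y t₀ - stateEstimate ε ν y₀ uhat y t₀) 2
                  (volume.restrict (Ioo (-1) 1)) := by
  have hlamF := contDiffOn_foldReaction hy₀ hlam
  refine ⟨fun i => exists_observerKernel (hlamF i) (c i), fun Φ hΦ => ?_⟩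
  have hεi : ∀ i, 0 < foldDiff ε y₀ i := fun i =>
    div_pos hε (sq_pos_of_ne_zero (foldSlope_ne_zero hy₀ i))
  choose C hC hdec using fun i =>
    exists_integral_sq_decay (hεi i) (hlamF i).continuousOn (hΦ i)
  obtain ⟨K, hK, hb⟩ := exists_gaugeExp_bound (ε := ε) hν.continuousOn
  -- The slower of the two pieces determines the common rate.
  set γ := min (c 0) (c 1)
  have hγ : ∀ i, γ ≤ c i := fun i => by
    fin_cases i
    · exact min_le_left _ _
    · exact min_le_right _ _
  set D : Fin 2 → ℝ := fun i => max 1 (Real.sqrt (C i))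
  have hD : ∀ i, 0 < D i := fun i => zero_lt_one.trans_le (le_max_left _ _)
  have hD0 := hD 0
  have hD1 := hD 1
  -- The constants add because the initial norm on each piece is bounded by that on the whole
  -- interval. Neither constant involves the solution or `t₀`.
  refine ⟨K ^ 2 * (D 0 + D 1), γ, by positivity, lt_min (hc 0) (hc 1), ?_⟩
  intro t₀ Ubar ubar uhat hu hv t ht
  set d : ℝ → ℝ → ℝ := fun t y => ubar y t - stateEstimate ε ν y₀ uhat y t
  have piece : ∀ i, eLpNorm (d t) 2 (volume.restrict (foldPiece y₀ i))
      ≤ ENNReal.ofReal (K ^ 2) * ENNReal.ofReal (D i * Real.exp (-γ * (t - t₀)))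
        * eLpNorm (d t₀) 2 (volume.restrict (Ioo (-1) 1)) := by
    intro i
    have sys := isErrorSystem_foldError hε hν hy₀ hu hv i
    have hinit : HasL2InitialValue (foldError ε ν y₀ ubar uhat i) 0 1 t₀ := by
      refine hasL2InitialValue_foldError hν hy₀ hu.initial i (hv i).initial
        (fun t ht => ?_) (fun t ht => ?_)
      · exact ((hu.continuousOn_gauged hν).comp (f := fun y : ℝ => (y, t)) (s := Ioo (-1) 1)
          (by fun_prop) fun y hy => ⟨Ioo_subset_Icc_self hy, ht⟩).aestronglyMeasurable
          measurableSet_Ioo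
      · exact ((hv i).cont.comp (f := fun y : ℝ => (y, t)) (s := Ioo 0 1)
          (by fun_prop) fun y hy => ⟨Ioo_subset_Icc_self hy, ht⟩).aestronglyMeasurable
          measurableSet_Ioo
    have dec := eLpNorm_decay_of_integral_sq_decay (hC i) sys.cont hinit
      (hdec i t₀ _ _ _ _ sys) ht
    have dec' := dec.trans (mul_le_mul_left (ENNReal.ofReal_le_ofReal
      (show _ ≤ D i * Real.exp (-γ * (t - t₀)) by
        refine mul_le_mul_of_nonneg_left (Real.exp_le_exp.2 ?_) (hD i).le
        nlinarith [hγ i, sub_nonneg.2 ht])) _)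
    refine (eLpNorm_foldPiece_le hy₀ hK hb i dec').trans (mul_le_mul_right ?_ _)
    exact eLpNorm_mono_measure _ (Measure.restrict_mono (foldPiece_subset hy₀ i) le_rfl)
  -- The open pieces miss only the point `y₀`, so the value assigned to the estimate there is
  -- irrelevant.
  have hae : (foldPiece y₀ 0 ∪ foldPiece y₀ 1 : Set ℝ) =ᵐ[volume] Ioo (-1) 1 := by
    have h1 : (Ioo (-1) y₀ ∪ Ioo y₀ 1 : Set ℝ) =ᵐ[volume] (Ioc (-1) y₀ ∪ Ioo y₀ 1 : Set ℝ) :=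
      Ioo_ae_eq_Ioc.union (ae_eq_refl _)
    rwa [Ioc_union_Ioo_eq_Ioo hy₀.1.le hy₀.2] at h1
  rw [← Measure.restrict_congr_set hae]
  refine (eLpNorm_two_restrict_union_le _ _ _).trans ((add_le_add (piece 0) (piece 1)).trans ?_)
  rw [Measure.restrict_congr_set hae, ← add_mul, ← mul_add,
    ← ENNReal.ofReal_add (by positivity) (by positivity), ← ENNReal.ofReal_mul (by positivity)]
  refine mul_le_mul_left (ENNReal.ofReal_le_ofReal (le_of_eq ?_)) _
  ring
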